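/- **Setting.** Let $I$ be a positive definite symmetric $3\times 3$ matrix, $m,r>0$ and $\rho=mr^2$. The motion of Chaplygin's sphere (mass $m$, radius $r$, moment of inertia tensor $I$, center of mass at the center, rolling without slipping on a horizontal plane) is described by $(A,\omega,p)\in \mathrm{SO}(3)\times\mathbf R^3\times\mathbf R^2$ with $$\dot A\,z=A(\omega\times z)\quad(z\in\mathbf R^3),\qquad I\dot\omega-(I\omega)\times\omega=\rho\,(\langle u,\dot\omega\rangle u-\dot\omega),\qquad \dot p=r\,(A\omega)\times e_3,\qquad u:=A^{-1}e_3 .$$ The equations for $(A,\omega)$ describe the rotational motion; together with $\dot u=u\times\omega$, the equation for $\omega$ gives the $\mathrm E(2)$-reduced system for $(u,\omega)\in S^2\times\mathbf R^3$. Put $I_{\rho,u}\,\omega=(I+\rho)\omega-\rho\langle u,\omega\rangle u$. The moment of momentum about the contact point, $j=A\,I_{\rho,u}\,\omega$, and the kinetic energy $T=\frac12\langle I\omega,\omega\rangle+\frac12\rho\|u\times\omega\|^2$ are constants of motion. For fixed $j$ let $T_j$ be the function on $\mathrm{SO}(3)$ given by $T_j(A)=T(A,\omega)$ with $\omega=I_{\rho,u}^{-1}A^{-1}j$.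 The motion in an open subset $M$ of a phase space is *quasi-periodic on analytic $n$-tori, depending analytically on parameters $\varepsilon\in E$* ($E$ open in $\mathbf R^s$) if there are an analytic diffeomorphism $\Phi:(\mathbf R^n/\mathbf Z^n)\times E\to M$ and an analytic $\nu:E\to\mathbf R^n$ such that $t\mapsto\Phi(x+t\,\nu(\varepsilon),\varepsilon)$ is a solution for all $x$ and $\varepsilon$. **Proposition.** Let $j=j_3e_3$ be vertical, and let $T$ be a regular value of $T_j$. 1. Each solution of the $\mathrm E(2)$-reduced system on the corresponding level set in the $(u,\omega)$-space is periodic, with a positive minimal period. 2. The rotational motion is quasi-periodic on analytic 2-tori depending analytically on $j$ and $T$: for each $(A_0,\omega_0)$ with moment $j_3e_3$ and energy $T$ there are an open neighborhood $E$ of $(j_3,T)$ in $\mathbf R^2$ and a neighborhood $M$ of $(A_0,\omega_0)$, open in the set of all $(A,\omega)$ with vertical moment, on which the motion is quasi-periodic on analytic 2-tori with parameters $\varepsilon\in E$ as above, where the torus $\Phi(\cdot,\varepsilon)$ lies in the level set with moment $\varepsilon_1e_3$ and energy $\varepsilon_2$. The solution starting at $(A_0,\omega_0)$ is $t\mapsto\Phi(x_0+t\,\nu(j_3,T),(j_3,T))$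 for some $x_0$. 3. Let $(A(t),\omega(t),p(t))$ be a solution of the full system with moment $j_3e_3$ and energy $T$, and let $P$ be the minimal period of $(u(t),\omega(t))$. Suppose that $(A(t),\omega(t))$ is not periodic with period $P$. Then the full motion is quasi-periodic on analytic 2-tori depending analytically on $j$ and $T$: there are an open neighborhood $E$ of $(j_3,T)$, an analytic map $\Phi$ from $(\mathbf R^2/\mathbf Z^2)\times E$ to $\mathrm{SO}(3)\times\mathbf R^3\times\mathbf R^2$ and an analytic $\nu:E\to\mathbf R^2$ such that, with additional translation parameter $c\in\mathbf R^2$, the map $(x,(\varepsilon,c))\mapsto\Phi(x,\varepsilon)+(0,0,c)$ is an analytic diffeomorphism from $(\mathbf R^2/\mathbf Z^2)\times(E\times\mathbf R^2)$ onto an open subset of the set of all $(A,\omega,p)$ with vertical moment, $t\mapsto\Phi(x+t\,\nu(\varepsilon),\varepsilon)+(0,0,c)$ is a solution of the full system for all $x,\varepsilon,c$, with moment $\varepsilon_1e_3$ and energy $\varepsilon_2$, and $(A(t),\omega(t),p(t))=\Phi(x_0+t\,\nu(j_3,T),(j_3,T))+(0,0,c_0)$ for some $x_0,c_0$ and all $t$.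 In particular $p(t)$ stays in a bounded subset of the plane. 4. If, in the situation of 3, $(A(t),\omega(t))$ is periodic with the period $P$, then $p(t)=t\,w+q(t)$ for a constant vector $w\in\mathbf R^2$ and a function $q$ which is periodic with period $P$. -/

import Mathlib

open Matrix

attribute [local instance] Matrix.normedAddCommGroup Matrix.normedSpace

namespace ChaplyginSphere

/-- Vectors of `ℝ³`, in coordinates. -/
abbrev Vec : Type := Fin 3 → ℝ

/-- Vectors of the horizontal plane `ℝ²`. -/
abbrev Plane : Type := Fin 2 → ℝ

/-- Real `3 × 3` matrices. -/
abbrev Mat : Type := Matrix (Fin 3) (Fin 3) ℝ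

/-- The vertical unit vector. -/
def e₃ : Vec := ![0, 0, 1]

/-- `SO(3)` as a subset of the space of matrices. -/
def SO3 : Set Mat := {A | Aᵀ * A = 1 ∧ A.det = 1}

/-- The antisymmetric matrix of the linear map `z ↦ ω × z`. -/
def hat (ω : Vec) : Mat :=
  !![0, -ω 2, ω 1; ω 2, 0, -ω 0; -ω 1, ω 0, 0]

theorem hat_mulVec (ω z : Vec) : hat ω *ᵥ z = ω ⨯₃ z := by
  ext i
  fin_cases i <;> simp [hat, cross_apply, Matrix.mulVec, dotProduct, Fin.sum_univ_three] <;> ring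

/-- `u = A⁻¹ e₃`, the vertical direction in body coordinates (for `A ∈ SO(3)` the inverse is the
transpose). -/
def vert (A : Mat) : Vec := Aᵀ *ᵥ e₃

/-- The symmetric matrix `I_{ρ,u} ω = (I + ρ) ω - ρ ⟨u, ω⟩ u`. -/
def inertiaAt (I : Mat) (ρ : ℝ) (u : Vec) : Mat :=
  I + ρ • (1 : Mat) - ρ • vecMulVec u u

/-- The moment of momentum about the point of contact, `j = A I_{ρ,u} ω` with `u = A⁻¹ e₃`. -/
def moment (I : Mat) (ρ : ℝ) (A : Mat) (ω : Vec) : Vec :=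
  A *ᵥ (inertiaAt I ρ (vert A) *ᵥ ω)

/-- The kinetic energy `T = ½ ⟨I ω, ω⟩ + ½ ρ ‖u × ω‖²`. -/
noncomputable def energy (I : Mat) (ρ : ℝ) (u ω : Vec) : ℝ :=
  1 / 2 * ((I *ᵥ ω) ⬝ᵥ ω) + 1 / 2 * ρ * ((u ⨯₃ ω) ⬝ᵥ (u ⨯₃ ω))

/-- The angular velocity `ω_j(A) = I_{ρ,u}⁻¹ A⁻¹ j`, the unique `ω` for which `(A, ω)` has
moment `j`. -/
noncomputable def omegaOf (I : Mat) (ρ : ℝ) (j : Vec) (A : Mat) : Vec :=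
  (inertiaAt I ρ (vert A))⁻¹ *ᵥ (Aᵀ *ᵥ j)

/-- The function `T_j` on `SO(3)`: the kinetic energy on the level set of the moment `j`. -/
noncomputable def energyOn (I : Mat) (ρ : ℝ) (j : Vec) (A : Mat) : ℝ :=
  energy I ρ (vert A) (omegaOf I ρ j A)

/-- `T` is a regular value of `T_j : SO(3) → ℝ`: at each point `A` of the level set, the derivative
of `T_j` in the direction of some tangent vector `A ∘ hat ν` of `SO(3)` is nonzero. -/
def IsRegularValue (I : Mat) (ρ : ℝ) (j : Vec) (T : ℝ) : Prop :=
  ∀ A ∈ SO3, energyOn I ρ j A = T →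
    ∃ ν : Vec, deriv (fun s : ℝ => energyOn I ρ j (A * NormedSpace.exp (s • hat ν))) 0 ≠ 0

/-- The common level set of the constants of motion `j` and `T` in the `(A, ω)`-space. -/
def levelSet (I : Mat) (ρ : ℝ) (j : Vec) (T : ℝ) : Set (Mat × Vec) :=
  {z | z.1 ∈ SO3 ∧ moment I ρ z.1 z.2 = j ∧ energy I ρ (vert z.1) z.2 = T}

/-- The projection `(A, ω) ↦ (u, ω)`, `u = A⁻¹ e₃`, onto the `E(2)`-reduced phase space. -/
def reduce (z : Mat × Vec) : Vec × Vec := (vert z.1, z.2)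

/-- The states of the rotational motion with vertical moment. -/
def verticalRot (I : Mat) (ρ : ℝ) : Set (Mat × Vec) :=
  {z | z.1 ∈ SO3 ∧ ∃ h : ℝ, moment I ρ z.1 z.2 = h • e₃}

/-- The states `(A, ω, p)` of the full system with vertical moment. -/
def verticalFull (I : Mat) (ρ : ℝ) : Set (Mat × Vec × Plane) :=
  {z | (z.1, z.2.1) ∈ verticalRot I ρ}

/-- The dynamical equation
`I dω/dt - (I ω) × ω = ρ (⟨u, dω/dt⟩ u - dω/dt)`, with `ω' = dω/dt`. -/
def DynamicalEq (I : Mat) (ρ : ℝ) (u ω ω' : Vec) : Prop :=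
  I *ᵥ ω' - (I *ᵥ ω) ⨯₃ ω = ρ • ((u ⬝ᵥ ω') • u - ω')

/-- Solutions `t ↦ (u, ω)` of the `E(2)`-reduced system in `S² × ℝ³`. -/
def IsReducedSolution (I : Mat) (ρ : ℝ) (γ : ℝ → Vec × Vec) : Prop :=
  ∀ t, (γ t).1 ⬝ᵥ (γ t).1 = 1 ∧
    ∃ ω' : Vec, HasDerivAt γ ((γ t).1 ⨯₃ (γ t).2, ω') t ∧ DynamicalEq I ρ (γ t).1 (γ t).2 ω'

/-- Solutions `t ↦ (A, ω)` of the rotational motion in `SO(3) × ℝ³`. -/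
def IsRotSolution (I : Mat) (ρ : ℝ) (γ : ℝ → Mat × Vec) : Prop :=
  ∀ t, (γ t).1 ∈ SO3 ∧
    ∃ ω' : Vec, HasDerivAt γ ((γ t).1 * hat (γ t).2, ω') t ∧
      DynamicalEq I ρ (vert (γ t).1) (γ t).2 ω'

/-- The velocity `r (A ω) × e₃` of the point of contact, as a vector of the horizontal plane. -/
def contactVelocity (r : ℝ) (A : Mat) (ω : Vec) : Plane :=
  ![(r • ((A *ᵥ ω) ⨯₃ e₃)) 0, (r • ((A *ᵥ ω) ⨯₃ e₃)) 1]

/-- Solutions `t ↦ (A, ω, p)` of the full system in `SO(3) × ℝ³ × ℝ²`, for a sphere of mass `m`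
and radius `r`. -/
def IsFullSolution (I : Mat) (m r : ℝ) (γ : ℝ → Mat × Vec × Plane) : Prop :=
  ∀ t, (γ t).1 ∈ SO3 ∧
    ∃ ω' : Vec, HasDerivAt γ ((γ t).1 * hat (γ t).2.1, ω', contactVelocity r (γ t).1 (γ t).2.1) t ∧
      DynamicalEq I (m * r ^ 2) (vert (γ t).1) (γ t).2.1 ω'

/-- `P` is the minimal period of the (nonconstant) periodic motion `f`. -/
def IsMinimalPeriod {X : Type*} (f : ℝ → X) (P : ℝ) : Prop :=
  0 < P ∧ Function.Periodic f P ∧ ∀ Q, 0 < Q → Q < P → ¬ Function.Periodic f Q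

/-- The motion in an open subset `M` of the phase space `V` is quasiperiodic on analytic
`n`-dimensional tori, with analytic dependence on the parameters `ε ∈ E`.

The analytic diffeomorphism `(ℝⁿ/ℤⁿ) × E → M` is given by its lift `Φ` to `ℝⁿ × E`: an analytic
immersion which is `ℤⁿ`-periodic in the first variable, injective modulo `ℤⁿ`, and whose image `M`
is open in `V`. (It is used with `V` a submanifold of dimension `n + dim E` near `M`, so that the
induced bijection onto `M` is a local diffeomorphism.)
The pullback of the velocity field is the constant field `ν ε` on each torus. -/
structure IsQuasiperiodicFamily {S Q : Type*} [NormedAddCommGroup S] [NormedSpace ℝ S]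
    [NormedAddCommGroup Q] [NormedSpace ℝ Q] {n : ℕ} (V : Set S) (IsSol : (ℝ → S) → Prop)
    (E : Set Q) (Φ : (Fin n → ℝ) × Q → S) (ν : Q → Fin n → ℝ) : Prop where
  isOpen_param : IsOpen E
  analytic_map : AnalyticOnNhd ℝ Φ (Set.univ ×ˢ E)
  analytic_freq : AnalyticOnNhd ℝ ν E
  eq_iff : ∀ x y : Fin n → ℝ, ∀ ε ∈ E, ∀ δ ∈ E,
    Φ (x, ε) = Φ (y, δ) ↔ ε = δ ∧ ∃ k : Fin n → ℤ, ∀ i, x i = y i + k i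
  immersion : ∀ x : Fin n → ℝ, ∀ ε ∈ E, Function.Injective (fderiv ℝ Φ (x, ε))
  isOpen_image : ∃ U : Set S, IsOpen U ∧ Φ '' (Set.univ ×ˢ E) = U ∩ V
  motion : ∀ x : Fin n → ℝ, ∀ ε ∈ E, IsSol (fun t : ℝ => Φ (x + t • ν ε, ε))

/-- The family of tori in the full phase space obtained from `Φ` by all horizontal translations
`c ∈ ℝ²`. -/
def translates {n : ℕ} (Φ : (Fin n → ℝ) × (ℝ × ℝ) → Mat × Vec × Plane) :
    (Fin n → ℝ) × ((ℝ × ℝ) × Plane) → Mat × Vec × Plane :=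
  fun z => Φ (z.1, z.2.1) + (0, 0, z.2.2)

end ChaplyginSphere

/-!
With vertical moment `j = j₃ e₃` the equation `I_{ρ,u} ω = j₃ u` says that `ω` is a multiple of
`B u`, where `B = (I + ρ)⁻¹`, and the energy becomes a function of `⟨u, B u⟩` alone. Hence `u` moves
on the sphere along a level curve of the quadratic form `⟨u, B u⟩`. At a regular energy the level is
not an eigenvalue of `B`, so the curve is a closed curve about a principal axis, traversed without
rest points; the time along it, divided by the period, is a uniform phase which depends analytically
on `(j₃, T)`.

The attitude `A` is determined by `u` up to a rotation about `e₃`, and both the system and the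
moment are invariant under these rotations. The angle of this rotation, corrected by the multiple
`θ` of a full turn by which `A` has advanced after one period of `u`, is the second angle on the
torus.

In each period the contact point undergoes a rotation by `2 π θ` followed by a translation. If this
rotation is nontrivial, then it has a fixed point, and relative to that point the contact point is
a function on the torus. If it is trivial, then the translations add up to a linear drift.
-/

namespace ChaplyginSphere

/-! ### Analytic dependence of integrals and inverse functions on parameters -/

section PowerSeries

variable {G V : Type*} [NormedAddCommGroup G] [NormedSpace ℝ G] [NormedAddCommGroup V]
  [NormedSpace ℝ V] {F : G → V} {p : FormalMultilinearSeries ℝ G V} {y₀ : G} {R : ENNReal}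
  {L : ℝ → G →L[ℝ] G}

theorem norm_apply_le_of_opNorm_le_one {T : G →L[ℝ] G} (hT : ‖T‖ ≤ 1) (y : G) : ‖T y‖ ≤ ‖y‖ := by
  simpa only [one_mul] using T.le_of_opNorm_le hT y

theorem hasSum_integral_comp_contraction (hF : HasFPowerSeriesOnBall F p y₀ R)
    (hL : Continuous L) (hL1 : ∀ τ ∈ Set.uIoc (0 : ℝ) 1, ‖L τ‖ ≤ 1) {y : G}
    (hy : y ∈ Metric.eball (0 : G) R) :
    HasSum (fun n => ∫ τ in (0 : ℝ)..1, p n fun _ => L τ y)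
      (∫ τ in (0 : ℝ)..1, F (y₀ + L τ y)) := by
  rw [mem_eball_zero_iff] at hy
  have hsum : Summable fun n => ‖p n‖ * ‖y‖ ^ n :=
    p.summable_norm_mul_pow (r := ‖y‖₊) (hy.trans_le hF.r_le)
  refine intervalIntegral.hasSum_integral_of_dominated_convergence
    (fun n _ => ‖p n‖ * ‖y‖ ^ n) (fun n => ?_) (fun n => ?_) ?_ intervalIntegrable_const ?_
  · exact ((p n).cont.comp
      (continuous_pi fun _ => hL.clm_apply continuous_const)).aestronglyMeasurable
  · refine Filter.Eventually.of_forall fun τ hτ => ((p n).le_opNorm _).trans ?_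
    rw [Finset.prod_const, Finset.card_univ, Fintype.card_fin]
    gcongr
    exact norm_apply_le_of_opNorm_le_one (hL1 τ hτ) y
  · exact Filter.Eventually.of_forall fun _ _ => hsum
  · refine Filter.Eventually.of_forall fun τ hτ => hF.hasSum ?_
    rw [mem_eball_zero_iff]
    exact (enorm_le_iff_norm_le.2 (norm_apply_le_of_opNorm_le_one (hL1 τ hτ) y)).trans_lt hy

theorem hasFPowerSeriesOnBall_integral_comp_contraction [CompleteSpace V]
    (hF : HasFPowerSeriesOnBall F p y₀ R) (hL : Continuous L)
    (hL1 : ∀ τ ∈ Set.uIoc (0 : ℝ) 1, ‖L τ‖ ≤ 1) :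
    HasFPowerSeriesOnBall (fun y => ∫ τ in (0 : ℝ)..1, F (y₀ + L τ (y - y₀)))
      (fun n => ∫ τ in (0 : ℝ)..1, (p n).compContinuousLinearMap fun _ => L τ) y₀ R where
  r_pos := hF.r_pos
  r_le := by
    refine hF.r_le.trans (FormalMultilinearSeries.radius_le_of_le fun n => ?_)
    refine (intervalIntegral.norm_integral_le_of_norm_le_const (C := ‖p n‖) fun τ hτ => ?_).trans
      (by rw [sub_zero, abs_one, mul_one])
    exact ((p n).norm_compContinuousLinearMap_le _).trans (mul_le_of_le_one_right (norm_nonneg _)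
      (Finset.prod_le_one (fun _ _ => norm_nonneg _) fun _ _ => hL1 τ hτ))
  hasSum {y} hy := by
    have hcont : ∀ n, Continuous fun τ => (p n).compContinuousLinearMap fun _ => L τ := fun n =>
      ((p n).compContinuousLinearMapLRight (E := fun _ => G)).cont.comp (continuous_pi fun _ => hL)
    have happly : ∀ n,
        (∫ τ in (0 : ℝ)..1, (p n).compContinuousLinearMap fun _ => L τ) (fun _ => y) =
          ∫ τ in (0 : ℝ)..1, p n fun _ => L τ y := fun n =>
      (ContinuousLinearMap.intervalIntegral_comp_comm
        (ContinuousMultilinearMap.apply ℝ (fun _ : Fin n => G) V fun _ => y)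
        ((hcont n).intervalIntegrable 0 1)).symm
    simpa only [happly, add_sub_cancel_left] using hasSum_integral_comp_contraction hF hL hL1 hy

end PowerSeries

section Parametric

variable {Q V : Type*} [NormedAddCommGroup Q] [NormedSpace ℝ Q] [NormedAddCommGroup V]
  [NormedSpace ℝ V] {F : ℝ × Q → V} {E : Set Q}

theorem continuous_slice (hF : AnalyticOnNhd ℝ F (Set.univ ×ˢ E)) {ε : Q} (hε : ε ∈ E) :
    Continuous fun s => F (s, ε) :=
  continuous_iff_continuousAt.2 fun s =>
    (hF (s, ε) ⟨trivial, hε⟩).continuousAt.comp (f := fun s => (s, ε)) (by fun_prop)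

theorem analyticAt_integral_from_self [CompleteSpace V] {s₀ : ℝ} {ε₀ : Q}
    (hF : AnalyticAt ℝ F (s₀, ε₀)) :
    AnalyticAt ℝ (fun z : ℝ × Q => ∫ s in s₀..z.1, F (s, z.2)) (s₀, ε₀) := by
  obtain ⟨p, R, hp⟩ := hF
  let L : ℝ → (ℝ × Q) →L[ℝ] (ℝ × Q) := fun τ =>
    τ • (ContinuousLinearMap.inl ℝ ℝ Q ∘L ContinuousLinearMap.fst ℝ ℝ Q) +
      ContinuousLinearMap.inr ℝ ℝ Q ∘L ContinuousLinearMap.snd ℝ ℝ Q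
  have hLapply : ∀ τ z, L τ z = (τ * z.1, z.2) := fun τ z => by simp [L]
  have hL : Continuous L := by fun_prop
  have hL1 : ∀ τ ∈ Set.uIoc (0 : ℝ) 1, ‖L τ‖ ≤ 1 := by
    intro τ hτ
    rw [Set.uIoc_of_le zero_le_one] at hτ
    refine ContinuousLinearMap.opNorm_le_bound _ zero_le_one fun z => ?_
    rw [hLapply, one_mul, Prod.norm_def, Prod.norm_def, norm_mul, Real.norm_of_nonneg hτ.1.le]
    exact max_le_max (mul_le_of_le_one_left (norm_nonneg _) hτ.2) le_rfl
  have hscaled : AnalyticAt ℝ _ (s₀, ε₀) :=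
    ⟨_, R, hasFPowerSeriesOnBall_integral_comp_contraction hp hL hL1⟩
  have hlength : AnalyticAt ℝ (fun z : ℝ × Q => z.1 - s₀) (s₀, ε₀) :=
    analyticAt_fst.sub analyticAt_const
  refine (hlength.smul hscaled).congr (Filter.Eventually.of_forall fun z => ?_)
  have hsubst := intervalIntegral.smul_integral_comp_add_mul (a := 0) (b := 1)
    (fun s => F (s, z.2)) (z.1 - s₀) s₀
  rw [mul_zero, add_zero, mul_one, add_sub_cancel] at hsubst
  simp only [Pi.smul_apply', ← hsubst, hLapply, mul_comm, Prod.mk_add_mk, Prod.fst_sub,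
    Prod.snd_sub, add_sub_cancel]

theorem integral_slice_add (hF : AnalyticOnNhd ℝ F (Set.univ ×ˢ E)) {ε : Q} (hε : ε ∈ E)
    (a b c : ℝ) :
    (∫ s in a..b, F (s, ε)) + ∫ s in b..c, F (s, ε) = ∫ s in a..c, F (s, ε) :=
  intervalIntegral.integral_add_adjacent_intervals
    ((continuous_slice hF hε).intervalIntegrable _ _)
    ((continuous_slice hF hε).intervalIntegrable _ _)

variable [CompleteSpace V]

-- The set of `b` for which the claim holds is open and closed, by additivity of the integral.
theorem analyticOnNhd_integral_slice (hE : IsOpen E) (hF : AnalyticOnNhd ℝ F (Set.univ ×ˢ E))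
    (a b : ℝ) : AnalyticOnNhd ℝ (fun ε => ∫ s in a..b, F (s, ε)) E := by
  intro ε₀ hε₀
  have hE₀ : ∀ᶠ ε in nhds ε₀, ε ∈ E := hE.mem_nhds hε₀
  let S : Set ℝ := {b | AnalyticAt ℝ (fun ε => ∫ s in a..b, F (s, ε)) ε₀}
  have hshort : ∀ b, ∀ᶠ c in nhds b, AnalyticAt ℝ (fun ε => ∫ s in b..c, F (s, ε)) ε₀ := by
    intro b
    have hpair : Filter.Tendsto (fun c : ℝ => (c, ε₀)) (nhds b) (nhds (b, ε₀)) :=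
      Continuous.tendsto (by fun_prop) b
    filter_upwards [hpair.eventually (analyticAt_integral_from_self
      (hF (b, ε₀) ⟨trivial, hε₀⟩)).eventually_analyticAt] with c hc
    exact hc.comp_of_eq (f := fun ε => (c, ε)) (analyticAt_const.prod analyticAt_id) rfl
  have hiff : ∀ b, ∀ᶠ c in nhds b, (c ∈ S ↔ b ∈ S) := by
    intro b
    filter_upwards [hshort b] with c hbc
    constructor <;> intro hmem
    · exact (AnalyticAt.sub hmem hbc).congr
        (hE₀.mono fun ε hε => sub_eq_of_eq_add (integral_slice_add hF hε a b c).symm)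
    · exact (AnalyticAt.add hmem hbc).congr
        (hE₀.mono fun ε hε => integral_slice_add hF hε a b c)
  have hclopen : IsClopen S := by
    refine ⟨isOpen_compl_iff.1 (isOpen_iff_mem_nhds.2 fun b hb => ?_),
      isOpen_iff_mem_nhds.2 fun b hb => ?_⟩
    · filter_upwards [hiff b] with c hc using fun h => hb (hc.1 h)
    · filter_upwards [hiff b] with c hc using hc.2 hb
  have ha : a ∈ S := by
    simpa only [S, Set.mem_ofPred_eq, intervalIntegral.integral_same] using analyticAt_const
  exact (hclopen.eq_univ ⟨a, ha⟩).ge (Set.mem_univ b)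

theorem analyticOnNhd_primitive (hE : IsOpen E) (hF : AnalyticOnNhd ℝ F (Set.univ ×ˢ E)) :
    AnalyticOnNhd ℝ (fun z : ℝ × Q => ∫ s in (0 : ℝ)..z.1, F (s, z.2)) (Set.univ ×ˢ E) := by
  rintro ⟨s₀, ε₀⟩ hz₀
  have hE₀ : ∀ᶠ z in nhds (s₀, ε₀), z.2 ∈ E := continuousAt_snd.eventually (hE.mem_nhds hz₀.2)
  have hfixed : AnalyticAt ℝ (fun z : ℝ × Q => ∫ s in (0 : ℝ)..s₀, F (s, z.2)) (s₀, ε₀) :=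
    (analyticOnNhd_integral_slice hE hF 0 s₀ ε₀ hz₀.2).comp_of_eq analyticAt_snd rfl
  exact (AnalyticAt.add hfixed (analyticAt_integral_from_self (hF _ hz₀))).congr
    (hE₀.mono fun z hz => integral_slice_add hF hz 0 s₀ z.1)

theorem analyticOnNhd_inverse_slice [CompleteSpace Q] (hE : IsOpen E) {X Y : ℝ × Q → ℝ}
    (hX : AnalyticOnNhd ℝ X (Set.univ ×ˢ E))
    (hYX : ∀ s, ∀ ε ∈ E, Y (X (s, ε), ε) = s) (hXY : ∀ x, ∀ ε ∈ E, X (Y (x, ε), ε) = x)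
    (hX' : ∀ s, ∀ ε ∈ E, deriv (fun s => X (s, ε)) s ≠ 0) :
    AnalyticOnNhd ℝ Y (Set.univ ×ˢ E) := by
  rintro ⟨x₀, ε₀⟩ ⟨-, hε₀⟩
  let w₀ : (ℝ × Q) × ℝ := ((x₀, ε₀), Y (x₀, ε₀))
  let f : (ℝ × Q) × ℝ → ℝ := fun w => X (w.2, w.1.2) - w.1.1
  have hf : AnalyticAt ℝ f w₀ :=
    ((hX (Y (x₀, ε₀), ε₀) ⟨trivial, hε₀⟩).comp_of_eq (f := fun w : (ℝ × Q) × ℝ => (w.2, w.1.2))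
      (analyticAt_snd.prod (analyticAt_snd.comp analyticAt_fst)) rfl).sub
      (analyticAt_fst.comp analyticAt_fst)
  have hf₀ : f w₀ = 0 := sub_eq_zero.2 (hXY x₀ ε₀ hε₀)
  have hpartial : fderiv ℝ f w₀ (0, 1) = deriv (fun s => X (s, ε₀)) (Y (x₀, ε₀)) := by
    have hline : HasDerivAt (fun s : ℝ => ((x₀, ε₀), s)) ((0 : ℝ × Q), (1 : ℝ)) (Y (x₀, ε₀)) :=
      (hasDerivAt_const _ _).prodMk (hasDerivAt_id _)
    have hcomp := (hf.differentiableAt.hasFDerivAt.comp_hasDerivAt (Y (x₀, ε₀)) hline).deriv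
    rw [← hcomp]
    exact deriv_sub_const (f := fun s => X (s, ε₀)) x₀
  have hinv : (fderiv ℝ f w₀ ∘L .inr ℝ (ℝ × Q) ℝ).IsInvertible := by
    refine ⟨ContinuousLinearEquiv.unitsEquivAut ℝ (Units.mk0 _ (hX' (Y (x₀, ε₀)) ε₀ hε₀)), ?_⟩
    ext
    simpa using hpartial.symm
  have hfc : ContDiffAt ℝ ⊤ f w₀ := hf.contDiffAt
  let ψ := hfc.implicitFunction (by simp) hinv
  have hψ : AnalyticAt ℝ ψ (x₀, ε₀) :=
    (hfc.contDiffAt_implicitFunction (by simp) hinv).analyticAt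
  have hE₀ : ∀ᶠ z in nhds (x₀, ε₀), z.2 ∈ E := continuousAt_snd.eventually (hE.mem_nhds hε₀)
  refine hψ.congr ?_
  filter_upwards [hE₀, hfc.eventually_apply_implicitFunction (by simp) hinv] with z hz hsolve
  have hXψ : X (ψ z, z.2) = z.1 := sub_eq_zero.1 (hsolve.trans hf₀)
  rw [← hYX (ψ z) z.2 hz, hXψ]

theorem hasDerivAt_primitive (hF : AnalyticOnNhd ℝ F (Set.univ ×ˢ E)) {ε : Q} (hε : ε ∈ E)
    (s : ℝ) : HasDerivAt (fun s => ∫ s' in (0 : ℝ)..s, F (s', ε)) (F (s, ε)) s :=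
  (continuous_slice hF hε).integral_hasStrictDerivAt 0 s |>.hasDerivAt

end Parametric

section Phase

theorem add_int_of_add_one {X : ℝ → ℝ} (hX1 : ∀ s, X (s + 1) = X s + 1) (s : ℝ) (n : ℤ) :
    X (s + n) = X s + n := by
  have hper : Function.Periodic (fun s => X s - s) 1 := fun s => by
    simp only [hX1]
    ring
  have hn := hper.int_mul n s
  rw [mul_one] at hn
  linarith

theorem surjective_of_add_one {X : ℝ → ℝ} (hX : Continuous X)
    (hX1 : ∀ s, X (s + 1) = X s + 1) : Function.Surjective X := by
  intro y
  refine mem_range_of_exists_le_of_exists_ge hX ⟨0 + ⌊y - X 0⌋, ?_⟩ ⟨0 + ⌈y - X 0⌉, ?_⟩ <;>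
    rw [add_int_of_add_one hX1]
  · linarith [Int.floor_le (y - X 0)]
  · linarith [Int.le_ceil (y - X 0)]

theorem integral_add_one {f : ℝ → ℝ} (hf : Continuous f) (hper : Function.Periodic f 1) (s : ℝ) :
    ∫ s' in (0 : ℝ)..(s + 1), f s' = (∫ s' in (0 : ℝ)..s, f s') + ∫ s' in (0 : ℝ)..1, f s' := by
  rw [← intervalIntegral.integral_add_adjacent_intervals (hf.intervalIntegrable 0 s)
    (hf.intervalIntegrable s (s + 1)), hper.intervalIntegral_add_eq s 0, zero_add]

theorem mul_pos_of_continuous_of_ne_zero {f : ℝ → ℝ} (hf : Continuous f) (h0 : ∀ s, f s ≠ 0)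
    (s t : ℝ) : 0 < f s * f t := by
  by_contra! hle
  obtain ⟨x, hx⟩ : (0 : ℝ) ∈ Set.range f := by
    rcases mul_nonpos_iff.1 hle with ⟨hs, ht⟩ | ⟨hs, ht⟩
    · exact mem_range_of_exists_le_of_exists_ge hf ⟨t, ht⟩ ⟨s, hs⟩
    · exact mem_range_of_exists_le_of_exists_ge hf ⟨s, hs⟩ ⟨t, ht⟩
  exact h0 x hx

/-- The signed time that the motion `ds/dt = 1 / k s` takes to go once around the circle `ℝ/ℤ`. -/
noncomputable def turnTime (k : ℝ → ℝ) : ℝ := ∫ s in (0 : ℝ)..1, k s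

/-- The phase at `s` of the motion `ds/dt = 1 / k s` on the circle `ℝ/ℤ`: the time elapsed since
the passage at `0`, as a fraction of the time of one turn. -/
noncomputable def phase (k : ℝ → ℝ) (s : ℝ) : ℝ := (∫ s' in (0 : ℝ)..s, k s') * (turnTime k)⁻¹

/-- The position at which the motion `ds/dt = 1 / k s` has a given phase. -/
noncomputable def positionAt (k : ℝ → ℝ) : ℝ → ℝ := Function.invFun (phase k)

variable {k : ℝ → ℝ}

theorem turnTime_ne_zero (hk : Continuous k) (h0 : ∀ s, k s ≠ 0) : turnTime k ≠ 0 := by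
  have hpos : 0 < ∫ s in (0 : ℝ)..1, k 0 * k s :=
    intervalIntegral.intervalIntegral_pos_of_pos ((hk.const_mul (k 0)).intervalIntegrable 0 1)
      (mul_pos_of_continuous_of_ne_zero hk h0 0) zero_lt_one
  rw [intervalIntegral.integral_const_mul] at hpos
  exact right_ne_zero_of_mul hpos.ne'

theorem hasStrictDerivAt_phase (hk : Continuous k) (s : ℝ) :
    HasStrictDerivAt (phase k) (k s * (turnTime k)⁻¹) s :=
  (hk.integral_hasStrictDerivAt 0 s).mul_const _

theorem hasDerivAt_phase (hk : Continuous k) (s : ℝ) :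
    HasDerivAt (phase k) (k s * (turnTime k)⁻¹) s :=
  (hasStrictDerivAt_phase hk s).hasDerivAt

theorem phase_add_one (hk : Continuous k) (h0 : ∀ s, k s ≠ 0) (hper : Function.Periodic k 1)
    (s : ℝ) : phase k (s + 1) = phase k s + 1 := by
  rw [phase, integral_add_one hk hper, add_mul]
  exact congrArg _ (mul_inv_cancel₀ (turnTime_ne_zero hk h0))

theorem phase_injective (hk : Continuous k) (h0 : ∀ s, k s ≠ 0) :
    Function.Injective (phase k) := by
  have hd : Differentiable ℝ (phase k) := fun s => (hasDerivAt_phase hk s).differentiableAt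
  intro s t hst
  by_contra hne
  wlog hlt : s < t generalizing s t
  · exact this hst.symm (Ne.symm hne) (lt_of_le_of_ne (not_lt.1 hlt) (Ne.symm hne))
  obtain ⟨r, -, hr⟩ := exists_deriv_eq_zero hlt hd.continuous.continuousOn hst
  rw [(hasDerivAt_phase hk r).deriv] at hr
  exact mul_ne_zero (h0 r) (inv_ne_zero (turnTime_ne_zero hk h0)) hr

theorem phase_bijective (hk : Continuous k) (h0 : ∀ s, k s ≠ 0) (hper : Function.Periodic k 1) :
    Function.Bijective (phase k) :=
  ⟨phase_injective hk h0, surjective_of_add_one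
    (continuous_iff_continuousAt.2 fun s => (hasDerivAt_phase hk s).continuousAt)
    (phase_add_one hk h0 hper)⟩

theorem positionAt_phase (hk : Continuous k) (h0 : ∀ s, k s ≠ 0) (s : ℝ) :
    positionAt k (phase k s) = s :=
  Function.leftInverse_invFun (phase_injective hk h0) s

theorem phase_positionAt (hk : Continuous k) (h0 : ∀ s, k s ≠ 0) (hper : Function.Periodic k 1)
    (x : ℝ) : phase k (positionAt k x) = x :=
  Function.rightInverse_invFun (phase_bijective hk h0 hper).2 x

theorem positionAt_bijective (hk : Continuous k) (h0 : ∀ s, k s ≠ 0)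
    (hper : Function.Periodic k 1) : Function.Bijective (positionAt k) :=
  ⟨Function.LeftInverse.injective (phase_positionAt hk h0 hper),
    Function.RightInverse.surjective (positionAt_phase hk h0)⟩

theorem positionAt_add_one (hk : Continuous k) (h0 : ∀ s, k s ≠ 0) (hper : Function.Periodic k 1)
    (x : ℝ) : positionAt k (x + 1) = positionAt k x + 1 :=
  phase_injective hk h0 <| by simp only [phase_add_one hk h0 hper, phase_positionAt hk h0 hper]

theorem hasDerivAt_positionAt (hk : Continuous k) (h0 : ∀ s, k s ≠ 0)
    (hper : Function.Periodic k 1) (x : ℝ) :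
    HasDerivAt (positionAt k) (turnTime k * (k (positionAt k x))⁻¹) x := by
  have hne : k (positionAt k x) * (turnTime k)⁻¹ ≠ 0 :=
    mul_ne_zero (h0 _) (inv_ne_zero (turnTime_ne_zero hk h0))
  have hinv := ((hasStrictDerivAt_phase hk (positionAt k x)).to_local_left_inverse hne
    (Filter.Eventually.of_forall (positionAt_phase hk h0))).hasDerivAt
  rwa [phase_positionAt hk h0 hper, _root_.mul_inv_rev, inv_inv] at hinv

variable {Q : Type*} [NormedAddCommGroup Q] [NormedSpace ℝ Q] {E : Set Q} {k : ℝ × Q → ℝ}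

theorem analyticOnNhd_turnTime (hE : IsOpen E) (hk : AnalyticOnNhd ℝ k (Set.univ ×ˢ E)) :
    AnalyticOnNhd ℝ (fun ε => turnTime fun s => k (s, ε)) E :=
  analyticOnNhd_integral_slice hE hk 0 1

theorem analyticOnNhd_positionAt [CompleteSpace Q] (hE : IsOpen E)
    (hk : AnalyticOnNhd ℝ k (Set.univ ×ˢ E)) (h0 : ∀ s, ∀ ε ∈ E, k (s, ε) ≠ 0)
    (hper : ∀ s ε, k (s + 1, ε) = k (s, ε)) :
    AnalyticOnNhd ℝ (fun z : ℝ × Q => positionAt (fun s => k (s, z.2)) z.1) (Set.univ ×ˢ E) := by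
  have hphase : AnalyticOnNhd ℝ (fun z : ℝ × Q => phase (fun s => k (s, z.2)) z.1)
      (Set.univ ×ˢ E) := fun z hz =>
    (analyticOnNhd_primitive hE hk z hz).fun_mul <|
      ((analyticOnNhd_turnTime hE hk z.2 hz.2).comp_of_eq analyticAt_snd rfl).fun_inv
        (turnTime_ne_zero (continuous_slice hk hz.2) fun s => h0 s z.2 hz.2)
  refine analyticOnNhd_inverse_slice hE hphase
    (fun s ε hε => positionAt_phase (continuous_slice hk hε) (fun s => h0 s ε hε) s)
    (fun x ε hε => phase_positionAt (continuous_slice hk hε) (fun s => h0 s ε hε)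
      (fun s => hper s ε) x) fun s ε hε => ?_
  rw [(hasDerivAt_phase (continuous_slice hk hε) s).deriv]
  exact mul_ne_zero (h0 s ε hε)
    (inv_ne_zero (turnTime_ne_zero (continuous_slice hk hε) fun s => h0 s ε hε))

end Phase

/-! ### Bilinear operations in coordinates -/

section Calculus

section Bilinear

variable {F G H X : Type*} [NormedAddCommGroup F] [NormedSpace ℝ F] [FiniteDimensional ℝ F]
  [NormedAddCommGroup G] [NormedSpace ℝ G] [FiniteDimensional ℝ G]
  [NormedAddCommGroup H] [NormedSpace ℝ H] [NormedAddCommGroup X] [NormedSpace ℝ X]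

theorem analyticAt_bilin (B : F →ₗ[ℝ] G →ₗ[ℝ] H) {a : X → F} {b : X → G} {x : X}
    (ha : AnalyticAt ℝ a x) (hb : AnalyticAt ℝ b x) :
    AnalyticAt ℝ (fun x => B (a x) (b x)) x :=
  (B.toContinuousBilinearMap.analyticAt_bilinear (a x, b x)).comp_of_eq (ha.prod hb) rfl

theorem hasDerivAt_bilin (B : F →ₗ[ℝ] G →ₗ[ℝ] H) {a : ℝ → F} {b : ℝ → G} {a' : F} {b' : G}
    {t : ℝ} (ha : HasDerivAt a a' t) (hb : HasDerivAt b b' t) :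
    HasDerivAt (fun t => B (a t) (b t)) (B a' (b t) + B (a t) b') t :=
  (ContinuousLinearMap.hasDerivAt_of_bilinear (B := B.toContinuousBilinearMap)
    (fun _ => ha) fun _ => hb).congr_deriv (add_comm _ _)

end Bilinear

variable {l m n : ℕ} {X : Type*} [NormedAddCommGroup X] [NormedSpace ℝ X] {x : X} {t : ℝ}

theorem hasDerivAt_matrix_iff {A : ℝ → Matrix (Fin m) (Fin n) ℝ} {A' : Matrix (Fin m) (Fin n) ℝ} :
    HasDerivAt A A' t ↔ ∀ i j, HasDerivAt (fun t => A t i j) (A' i j) t :=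
  (hasDerivAt_pi (φ := fun t i => A t i) (φ' := fun i => A' i)).trans
    (forall_congr' fun _ => hasDerivAt_pi)

theorem analyticAt_matrix_iff {A : X → Matrix (Fin m) (Fin n) ℝ} :
    AnalyticAt ℝ A x ↔ ∀ i j, AnalyticAt ℝ (fun x => A x i j) x :=
  (analyticAt_pi_iff (f := fun i x => A x i)).trans (forall_congr' fun _ => analyticAt_pi_iff)

theorem analyticAt_dot {a b : X → Fin n → ℝ} (ha : AnalyticAt ℝ a x) (hb : AnalyticAt ℝ b x) :
    AnalyticAt ℝ (fun x => a x ⬝ᵥ b x) x :=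
  analyticAt_bilin (dotProductBilin ℝ ℝ) ha hb

theorem hasDerivAt_dot {a b : ℝ → Fin n → ℝ} {a' b' : Fin n → ℝ} (ha : HasDerivAt a a' t)
    (hb : HasDerivAt b b' t) :
    HasDerivAt (fun t => a t ⬝ᵥ b t) (a' ⬝ᵥ b t + a t ⬝ᵥ b') t :=
  hasDerivAt_bilin (dotProductBilin ℝ ℝ) ha hb

theorem analyticAt_cross {a b : X → Vec} (ha : AnalyticAt ℝ a x) (hb : AnalyticAt ℝ b x) :
    AnalyticAt ℝ (fun x => a x ⨯₃ b x) x :=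
  analyticAt_bilin crossProduct ha hb

theorem hasDerivAt_cross {a b : ℝ → Vec} {a' b' : Vec} (ha : HasDerivAt a a' t)
    (hb : HasDerivAt b b' t) :
    HasDerivAt (fun t => a t ⨯₃ b t) (a' ⨯₃ b t + a t ⨯₃ b') t :=
  hasDerivAt_bilin crossProduct ha hb

variable {A : X → Matrix (Fin l) (Fin m) ℝ} {B : X → Matrix (Fin m) (Fin n) ℝ} {b : X → Fin m → ℝ}

theorem analyticAt_mul (hA : AnalyticAt ℝ A x) (hB : AnalyticAt ℝ B x) :
    AnalyticAt ℝ (fun x => A x * B x) x :=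
  analyticAt_bilin (mulLinearMap ℝ) hA hB

theorem analyticAt_mulVec (hA : AnalyticAt ℝ A x) (hb : AnalyticAt ℝ b x) :
    AnalyticAt ℝ (fun x => A x *ᵥ b x) x :=
  analyticAt_bilin (mulVecBilin ℝ ℝ) hA hb

theorem analyticAt_const_mulVec (A : Matrix (Fin l) (Fin m) ℝ) (hb : AnalyticAt ℝ b x) :
    AnalyticAt ℝ (fun x => A *ᵥ b x) x :=
  analyticAt_mulVec analyticAt_const hb

variable {A : ℝ → Matrix (Fin l) (Fin m) ℝ} {A' : Matrix (Fin l) (Fin m) ℝ}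
  {B : ℝ → Matrix (Fin m) (Fin n) ℝ} {B' : Matrix (Fin m) (Fin n) ℝ}
  {b : ℝ → Fin m → ℝ} {b' : Fin m → ℝ}

theorem hasDerivAt_mul (hA : HasDerivAt A A' t) (hB : HasDerivAt B B' t) :
    HasDerivAt (fun t => A t * B t) (A' * B t + A t * B') t :=
  hasDerivAt_bilin (mulLinearMap ℝ) hA hB

theorem hasDerivAt_mulVec (hA : HasDerivAt A A' t) (hb : HasDerivAt b b' t) :
    HasDerivAt (fun t => A t *ᵥ b t) (A' *ᵥ b t + A t *ᵥ b') t :=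
  hasDerivAt_bilin (mulVecBilin ℝ ℝ) hA hb

theorem hasDerivAt_const_mulVec (A : Matrix (Fin l) (Fin m) ℝ) (hb : HasDerivAt b b' t) :
    HasDerivAt (fun t => A *ᵥ b t) (A *ᵥ b') t :=
  (hasDerivAt_mulVec (hasDerivAt_const t A) hb).congr_deriv
    (by rw [zero_mulVec, zero_add])

theorem hasDerivAt_transpose (hA : HasDerivAt A A' t) :
    HasDerivAt (fun t => (A t)ᵀ) A'ᵀ t := by
  rw [hasDerivAt_matrix_iff] at *
  exact fun i j => hA j i

theorem hasDerivAt_vert {A : ℝ → Mat} {A' : Mat} (hA : HasDerivAt A A' t) :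
    HasDerivAt (fun t => vert (A t)) (vert A') t :=
  (hasDerivAt_mulVec (hasDerivAt_transpose hA) (hasDerivAt_const t e₃)).congr_deriv
    (by rw [mulVec_zero, add_zero, vert])

theorem continuous_vert : Continuous vert :=
  continuous_id.matrix_transpose.matrix_mulVec continuous_const

end Calculus

/-! ### Rotations -/

section Rotations

theorem hat_transpose (a : Vec) : (hat a)ᵀ = -hat a := by
  ext i j
  fin_cases i <;> fin_cases j <;> simp [hat]

theorem hat_add (a b : Vec) : hat (a + b) = hat a + hat b := by
  ext i j
  fin_cases i <;> fin_cases j <;> simp [hat] <;> ring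

theorem hat_smul (c : ℝ) (a : Vec) : hat (c • a) = c • hat a := by
  ext i j
  fin_cases i <;> fin_cases j <;> simp [hat]

theorem hat_eq_zero {a : Vec} (h : hat a = 0) : a = 0 := by
  ext i
  fin_cases i
  · simpa [hat] using congrFun₂ h 2 1
  · simpa [hat] using congrFun₂ h 0 2
  · simpa [hat] using congrFun₂ h 1 0

theorem mul_transpose_of_mem {A : Mat} (hA : A ∈ SO3) : A * Aᵀ = 1 := mul_eq_one_comm.1 hA.1

theorem transpose_mem_SO3 {A : Mat} (hA : A ∈ SO3) : Aᵀ ∈ SO3 :=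
  ⟨by rw [transpose_transpose, mul_transpose_of_mem hA], by rw [det_transpose, hA.2]⟩

theorem mul_mem_SO3 {A B : Mat} (hA : A ∈ SO3) (hB : B ∈ SO3) : A * B ∈ SO3 :=
  ⟨by rw [transpose_mul, Matrix.mul_assoc, ← Matrix.mul_assoc Aᵀ, hA.1, Matrix.one_mul, hB.1],
    by rw [det_mul, hA.2, hB.2, one_mul]⟩

theorem mulVec_transpose_mulVec {A : Mat} (hA : A ∈ SO3) (z : Vec) : A *ᵥ (Aᵀ *ᵥ z) = z := by
  rw [mulVec_mulVec, mul_transpose_of_mem hA, one_mulVec]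

theorem transpose_mulVec_mulVec {A : Mat} (hA : A ∈ SO3) (z : Vec) : Aᵀ *ᵥ (A *ᵥ z) = z := by
  rw [mulVec_mulVec, hA.1, one_mulVec]

theorem mulVec_dot {m n : Type*} [Fintype m] [Fintype n] (A : Matrix m n ℝ) (x : n → ℝ)
    (y : m → ℝ) : (A *ᵥ x) ⬝ᵥ y = x ⬝ᵥ (Aᵀ *ᵥ y) := by
  rw [dotProduct_transpose_mulVec, dotProduct_comm]

theorem dot_mulVec_mulVec {A : Mat} (hA : A ∈ SO3) (x y : Vec) :
    (A *ᵥ x) ⬝ᵥ (A *ᵥ y) = x ⬝ᵥ y := by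
  rw [mulVec_dot, transpose_mulVec_mulVec hA]

theorem adjugate_transpose_mulVec_cross {R : Type*} [CommRing R] (A : Matrix (Fin 3) (Fin 3) R)
    (x y : Fin 3 → R) : (adjugate A)ᵀ *ᵥ (x ⨯₃ y) = (A *ᵥ x) ⨯₃ (A *ᵥ y) := by
  ext i
  fin_cases i <;>
    simp [adjugate_fin_three, cross_apply, mulVec, dotProduct, Fin.sum_univ_three] <;> ring

theorem adjugate_of_mem {A : Mat} (hA : A ∈ SO3) : adjugate A = Aᵀ :=
  left_inv_eq_right_inv (by rw [adjugate_mul, hA.2, one_smul]) (mul_transpose_of_mem hA)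

theorem mulVec_cross {A : Mat} (hA : A ∈ SO3) (x y : Vec) :
    A *ᵥ (x ⨯₃ y) = (A *ᵥ x) ⨯₃ (A *ᵥ y) := by
  rw [← adjugate_transpose_mulVec_cross, adjugate_of_mem hA, transpose_transpose]

theorem hat_mulVec_mul {A : Mat} (hA : A ∈ SO3) (ω : Vec) : hat (A *ᵥ ω) * A = A * hat ω :=
  ext_of_mulVec_single fun i => by
    rw [← mulVec_mulVec, ← mulVec_mulVec, hat_mulVec, hat_mulVec, mulVec_cross hA]

theorem mulVec_vert {A : Mat} (hA : A ∈ SO3) : A *ᵥ vert A = e₃ := mulVec_transpose_mulVec hA e₃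

theorem hat_e₃_mul {A : Mat} (hA : A ∈ SO3) : hat e₃ * A = A * hat (vert A) := by
  rw [← hat_mulVec_mul hA, mulVec_vert hA]

theorem e₃_dot_e₃ : e₃ ⬝ᵥ e₃ = 1 := by simp [e₃]

theorem vert_dot_vert {A : Mat} (hA : A ∈ SO3) : vert A ⬝ᵥ vert A = 1 := by
  rw [vert, dot_mulVec_mulVec (transpose_mem_SO3 hA), e₃_dot_e₃]

theorem vert_mul_hat (A : Mat) (ω : Vec) : vert (A * hat ω) = vert A ⨯₃ ω := by
  rw [vert, transpose_mul, ← mulVec_mulVec, hat_transpose, neg_mulVec, hat_mulVec,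
    ← cross_anticomm, neg_neg, vert]

theorem cross_dot_cross_self {R : Type*} [CommRing R] (a b : Fin 3 → R) :
    (a ⨯₃ b) ⬝ᵥ (a ⨯₃ b) = (a ⬝ᵥ a) * (b ⬝ᵥ b) - (a ⬝ᵥ b) ^ 2 := by
  rw [cross_dot_cross, dotProduct_comm b a]
  ring

theorem dot_self_nonneg {n : Type*} [Fintype n] (a : n → ℝ) : 0 ≤ a ⬝ᵥ a :=
  Finset.sum_nonneg fun i _ => mul_self_nonneg (a i)

/-- The rotation about the vertical axis by the angle `2 π y`. The angle is measured in full
turns, so that `ℤ` is the group of periods of `rotVertical`. -/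
noncomputable def rotVertical (y : ℝ) : Mat :=
  !![Real.cos (2 * Real.pi * y), -Real.sin (2 * Real.pi * y), 0;
    Real.sin (2 * Real.pi * y), Real.cos (2 * Real.pi * y), 0; 0, 0, 1]

theorem rotVertical_add (x y : ℝ) : rotVertical (x + y) = rotVertical x * rotVertical y := by
  ext i j
  fin_cases i <;> fin_cases j <;>
    simp [rotVertical, Matrix.mul_apply, Fin.sum_univ_three, mul_add, Real.cos_add, Real.sin_add]
      <;> ring

theorem rotVertical_transpose (y : ℝ) : (rotVertical y)ᵀ = rotVertical (-y) := by
  ext i j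
  fin_cases i <;> fin_cases j <;> simp [rotVertical]

theorem rotVertical_zero : rotVertical 0 = 1 := by
  ext i j
  fin_cases i <;> fin_cases j <;> simp [rotVertical]

theorem rotVertical_mem_SO3 (y : ℝ) : rotVertical y ∈ SO3 := by
  refine ⟨by rw [rotVertical_transpose, ← rotVertical_add, neg_add_cancel, rotVertical_zero], ?_⟩
  simp [rotVertical, det_fin_three, ← sq]

theorem cos_two_pi_mul_eq_one_iff {y : ℝ} :
    Real.cos (2 * Real.pi * y) = 1 ↔ ∃ n : ℤ, y = n := by
  have hπ : 2 * Real.pi ≠ 0 := Real.two_pi_pos.ne'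
  rw [Real.cos_eq_one_iff]
  refine exists_congr fun n => ?_
  rw [mul_comm (n : ℝ), mul_right_inj' hπ, eq_comm]

theorem rotVertical_eq_one_iff {y : ℝ} : rotVertical y = 1 ↔ ∃ n : ℤ, y = n := by
  rw [← cos_two_pi_mul_eq_one_iff]
  refine ⟨fun h => by simpa [rotVertical] using congrFun₂ h 0 0, fun hcos => ?_⟩
  have hsin : Real.sin (2 * Real.pi * y) = 0 := by
    have hsq := Real.sin_sq_add_cos_sq (2 * Real.pi * y)
    rw [hcos] at hsq
    exact pow_eq_zero_iff two_ne_zero |>.1 (by linarith)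
  ext i j
  fin_cases i <;> fin_cases j <;> simp [rotVertical, hcos, hsin]

theorem rotVertical_eq_iff {x y : ℝ} :
    rotVertical x = rotVertical y ↔ ∃ n : ℤ, x = y + n := by
  have hunit : IsUnit (rotVertical y) :=
    IsUnit.of_mul_eq_one _ (mul_transpose_of_mem (rotVertical_mem_SO3 y))
  rw [← sub_add_cancel x y, rotVertical_add, hunit.mul_eq_right, rotVertical_eq_one_iff,
    sub_add_cancel]
  exact exists_congr fun n => sub_eq_iff_eq_add'

theorem rotVertical_transpose_mulVec_e₃ (y : ℝ) : (rotVertical y)ᵀ *ᵥ e₃ = e₃ := by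
  ext i
  fin_cases i <;> simp [rotVertical, e₃, mulVec, dotProduct, Fin.sum_univ_three]

theorem vert_rotVertical_mul (y : ℝ) (A : Mat) : vert (rotVertical y * A) = vert A := by
  rw [vert, transpose_mul, ← mulVec_mulVec, rotVertical_transpose_mulVec_e₃, vert]

theorem hasDerivAt_rotVertical {y : ℝ → ℝ} {y' t : ℝ} (hy : HasDerivAt y y' t) :
    HasDerivAt (fun t => rotVertical (y t))
      ((2 * Real.pi * y') • (hat e₃ * rotVertical (y t))) t := by
  have hcos := (hy.const_mul (2 * Real.pi)).cos
  have hsin := (hy.const_mul (2 * Real.pi)).sin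
  have hconst (c : ℝ) := hasDerivAt_const t c
  rw [hasDerivAt_matrix_iff]
  intro i j
  fin_cases i <;> fin_cases j
  · exact hcos.congr_deriv (by simp [hat, e₃, rotVertical, mul_comm])
  · exact hsin.neg.congr_deriv (by simp [hat, e₃, rotVertical, mul_comm])
  · exact (hconst 0).congr_deriv (by simp [hat, e₃, rotVertical])
  · exact hsin.congr_deriv (by simp [hat, e₃, rotVertical, mul_comm])
  · exact hcos.congr_deriv (by simp [hat, e₃, rotVertical, mul_comm])
  · exact (hconst 0).congr_deriv (by simp [hat, e₃, rotVertical])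
  · exact (hconst 0).congr_deriv (by simp [hat, e₃, rotVertical])
  · exact (hconst 0).congr_deriv (by simp [hat, e₃, rotVertical])
  · exact (hconst 1).congr_deriv (by simp [hat, e₃, rotVertical])

theorem analyticAt_rotVertical {X : Type*} [NormedAddCommGroup X] [NormedSpace ℝ X] {y : X → ℝ}
    {x : X} (hy : AnalyticAt ℝ y x) : AnalyticAt ℝ (fun x => rotVertical (y x)) x := by
  have hangle : AnalyticAt ℝ (fun x => 2 * Real.pi * y x) x := analyticAt_const.mul hy
  have hcos : AnalyticAt ℝ (fun x => Real.cos (2 * Real.pi * y x)) x :=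
    Real.analyticAt_cos.comp_of_eq hangle rfl
  have hsin : AnalyticAt ℝ (fun x => Real.sin (2 * Real.pi * y x)) x :=
    Real.analyticAt_sin.comp_of_eq hangle rfl
  rw [analyticAt_matrix_iff]
  intro i j
  fin_cases i <;> fin_cases j
  exacts [hcos, hsin.neg, analyticAt_const, hsin, hcos, analyticAt_const, analyticAt_const,
    analyticAt_const, analyticAt_const]

theorem exists_eq_cos_sin {x y : ℝ} (h : x ^ 2 + y ^ 2 = 1) :
    ∃ φ : ℝ, x = Real.cos φ ∧ y = Real.sin φ := by
  have hnorm : ‖(⟨x, y⟩ : ℂ)‖ = 1 := by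
    rw [Complex.norm_eq_sqrt_sq_add_sq, h, Real.sqrt_one]
  have hne : (⟨x, y⟩ : ℂ) ≠ 0 := norm_ne_zero_iff.1 (by rw [hnorm]; exact one_ne_zero)
  exact ⟨Complex.arg ⟨x, y⟩, by rw [Complex.cos_arg hne, hnorm, div_one],
    by rw [Complex.sin_arg, hnorm, div_one]⟩

theorem eq_of_vert_eq_e₃ {A : Mat} (hA : A ∈ SO3) (h : vert A = e₃) :
    A = !![A 0 0, -A 1 0, 0; A 1 0, A 0 0, 0; 0, 0, 1] := by
  have hrow (j : Fin 3) : A 2 j = e₃ j := by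
    simpa [vert, e₃, mulVec, dotProduct, Fin.sum_univ_three] using congrFun h j
  have hcol (i : Fin 3) : A i 2 = e₃ i := by
    have hfix : A *ᵥ e₃ = e₃ := by
      rw [← h, mulVec_vert hA, h]
    simpa [e₃, mulVec, dotProduct, Fin.sum_univ_three] using congrFun hfix i
  have hadj := adjugate_of_mem hA
  have h₀₀ : A 1 1 = A 0 0 := by
    simpa [adjugate_fin_three, hrow, hcol, e₃] using congrFun₂ hadj 0 0
  have h₀₁ : A 0 1 = -A 1 0 := by
    simpa [adjugate_fin_three, hrow, hcol, e₃, neg_eq_iff_eq_neg] using congrFun₂ hadj 0 1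
  ext i j
  fin_cases i <;> fin_cases j <;> simp [hrow, hcol, h₀₀, h₀₁, e₃]

theorem exists_eq_rotVertical {A : Mat} (hA : A ∈ SO3) (h : vert A = e₃) :
    ∃ y, A = rotVertical y := by
  have hA_eq := eq_of_vert_eq_e₃ hA h
  have hcircle : (A 0 0) ^ 2 + (A 1 0) ^ 2 = 1 := by
    have hdet := hA.2
    rw [hA_eq, det_fin_three] at hdet
    simpa [sq] using hdet
  obtain ⟨φ, hcos, hsin⟩ := exists_eq_cos_sin hcircle
  refine ⟨φ / (2 * Real.pi), ?_⟩
  rw [rotVertical, mul_div_cancel₀ _ Real.two_pi_pos.ne', ← hcos, ← hsin]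
  exact hA_eq

end Rotations

/-! ### Level sets with vertical moment -/

/-- `B` is the inverse of `I + ρ` for an inertia tensor `I`. The field `lt_one`, a
consequence of the positivity of `I`, makes `I_{ρ,u} = I + ρ - ρ u uᵀ` invertible for all unit
vectors `u`. -/
structure IsInertiaInverse (I : Mat) (ρ : ℝ) (B : Mat) : Prop where
  inv : (I + ρ • (1 : Mat)) * B = 1
  symm : Bᵀ = B
  lt_one : ∀ u : Vec, u ⬝ᵥ u = 1 → ρ * (u ⬝ᵥ (B *ᵥ u)) < 1

/-- The value of the quadratic form of `B` on the level set with vertical moment `ε.1` and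
energy `ε.2`. -/
noncomputable def levelValue (ρ : ℝ) (ε : ℝ × ℝ) : ℝ := 2 * ε.2 / (ε.1 ^ 2 + 2 * ρ * ε.2)

/-- The factor in `ω = κ B u` on the level set with vertical moment `ε.1` and energy `ε.2`. -/
noncomputable def levelFactor (ρ : ℝ) (ε : ℝ × ℝ) : ℝ := (ε.1 ^ 2 + 2 * ρ * ε.2) / ε.1

section LevelSets

variable {I : Mat} {ρ : ℝ} {B : Mat} {u ω ω' : Vec}

theorem inertiaAt_mulVec (I : Mat) (ρ : ℝ) (u ω : Vec) :
    inertiaAt I ρ u *ᵥ ω = I *ᵥ ω + ρ • ω - (ρ * (u ⬝ᵥ ω)) • u := by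
  rw [inertiaAt, sub_mulVec, add_mulVec, smul_mulVec, smul_mulVec, one_mulVec, vecMulVec_mulVec,
    op_smul_eq_smul, smul_smul]

theorem energy_eq_of_inertiaAt (hu : u ⬝ᵥ u = 1) :
    energy I ρ u ω = 1 / 2 * ((inertiaAt I ρ u *ᵥ ω) ⬝ᵥ ω) := by
  rw [energy, cross_dot_cross_self, hu, inertiaAt_mulVec, sub_dotProduct, add_dotProduct,
    smul_dotProduct, smul_dotProduct, smul_eq_mul, smul_eq_mul]
  ring

theorem moment_eq_iff {A : Mat} (hA : A ∈ SO3) {j : ℝ} :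
    moment I ρ A ω = j • e₃ ↔ inertiaAt I ρ (vert A) *ᵥ ω = j • vert A := by
  refine ⟨fun h => ?_, fun h => by rw [moment, h, mulVec_smul, mulVec_vert hA]⟩
  rw [← transpose_mulVec_mulVec hA (inertiaAt I ρ (vert A) *ᵥ ω), ← moment, h, mulVec_smul, vert]

theorem dynamicalEq_iff :
    DynamicalEq I ρ u ω ω' ↔ inertiaAt I ρ u *ᵥ ω' = (I *ᵥ ω) ⨯₃ ω := by
  rw [DynamicalEq, inertiaAt_mulVec, smul_sub, smul_smul, sub_eq_iff_eq_add, sub_eq_iff_eq_add,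
    ← eq_sub_iff_add_eq, sub_add_eq_add_sub, add_comm]

namespace IsInertiaInverse

theorem add_mulVec_mulVec (hB : IsInertiaInverse I ρ B) (z : Vec) :
    I *ᵥ (B *ᵥ z) + ρ • (B *ᵥ z) = z := by
  rw [← one_mulVec (B *ᵥ z), ← smul_mulVec, one_mulVec, ← add_mulVec, mulVec_mulVec, hB.inv,
    one_mulVec]

theorem mulVec_add_smul (hB : IsInertiaInverse I ρ B) (z : Vec) :
    B *ᵥ (I *ᵥ z + ρ • z) = z := by
  have hsum : I *ᵥ z + ρ • z = (I + ρ • (1 : Mat)) *ᵥ z := by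
    rw [add_mulVec, smul_mulVec, one_mulVec]
  rw [hsum, mulVec_mulVec, mul_eq_one_comm.1 hB.inv, one_mulVec]

theorem dot_comm (hB : IsInertiaInverse I ρ B) (x y : Vec) :
    (B *ᵥ x) ⬝ᵥ y = x ⬝ᵥ (B *ᵥ y) := by
  rw [mulVec_dot, hB.symm]

theorem inertiaAt_mulVec_eq_iff (hB : IsInertiaInverse I ρ B) (hu : u ⬝ᵥ u = 1) (j : ℝ) :
    inertiaAt I ρ u *ᵥ ω = j • u ↔ ω = (j / (1 - ρ * (u ⬝ᵥ (B *ᵥ u)))) • (B *ᵥ u) := by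
  have hne : 1 - ρ * (u ⬝ᵥ (B *ᵥ u)) ≠ 0 := (sub_pos.2 (hB.lt_one u hu)).ne'
  rw [inertiaAt_mulVec]
  constructor
  · intro h
    have hω : ω = (j + ρ * (u ⬝ᵥ ω)) • (B *ᵥ u) := by
      rw [← mulVec_smul, add_smul, ← h, sub_add_cancel, hB.mulVec_add_smul]
    have hdot : u ⬝ᵥ ω = (j + ρ * (u ⬝ᵥ ω)) * (u ⬝ᵥ (B *ᵥ u)) := by
      rw [← smul_eq_mul, ← dotProduct_smul, ← hω]
    have hcoeff : j + ρ * (u ⬝ᵥ ω) = j / (1 - ρ * (u ⬝ᵥ (B *ᵥ u))) := by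
      rw [eq_div_iff hne]
      linear_combination ρ * hdot
    rwa [hcoeff] at hω
  · rintro rfl
    rw [mulVec_smul, smul_comm ρ, ← smul_add, hB.add_mulVec_mulVec, ← sub_smul, dotProduct_smul,
      smul_eq_mul]
    congr 1
    field_simp

theorem energy_eq (hB : IsInertiaInverse I ρ B) (hu : u ⬝ᵥ u = 1) {j : ℝ}
    (h : inertiaAt I ρ u *ᵥ ω = j • u) :
    energy I ρ u ω = 1 / 2 * j ^ 2 * (u ⬝ᵥ (B *ᵥ u)) / (1 - ρ * (u ⬝ᵥ (B *ᵥ u))) := by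
  rw [energy_eq_of_inertiaAt hu, h, (hB.inertiaAt_mulVec_eq_iff hu j).1 h, smul_dotProduct,
    dotProduct_smul, smul_eq_mul, smul_eq_mul]
  ring

theorem pos_of_mem_levelSet (hB : IsInertiaInverse I ρ B) {ε : ℝ × ℝ} (hε : ε.1 ≠ 0)
    {z : Mat × Vec} (hz : z ∈ levelSet I ρ (ε.1 • e₃) ε.2) : 0 < ε.1 ^ 2 + 2 * ρ * ε.2 := by
  obtain ⟨hA, hmoment, henergy⟩ := hz
  have hu := vert_dot_vert hA
  have hlt := sub_pos.2 (hB.lt_one _ hu)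
  rw [← henergy, hB.energy_eq hu ((moment_eq_iff hA).1 hmoment)]
  set g := vert z.1 ⬝ᵥ (B *ᵥ vert z.1)
  calc 0 < ε.1 ^ 2 / (1 - ρ * g) := by positivity
    _ = ε.1 ^ 2 + 2 * ρ * (1 / 2 * ε.1 ^ 2 * g / (1 - ρ * g)) := by
      field_simp
      ring

theorem mem_levelSet_iff (hB : IsInertiaInverse I ρ B) {ε : ℝ × ℝ} (hε : ε.1 ≠ 0)
    (hD : 0 < ε.1 ^ 2 + 2 * ρ * ε.2) {z : Mat × Vec} (hA : z.1 ∈ SO3) :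
    z ∈ levelSet I ρ (ε.1 • e₃) ε.2 ↔ vert z.1 ⬝ᵥ (B *ᵥ vert z.1) = levelValue ρ ε ∧
      z.2 = levelFactor ρ ε • (B *ᵥ vert z.1) := by
  have hu := vert_dot_vert hA
  have hlt := sub_pos.2 (hB.lt_one _ hu)
  have hmoment := (moment_eq_iff (I := I) (ρ := ρ) (ω := z.2) (j := ε.1) hA).trans
    (hB.inertiaAt_mulVec_eq_iff hu ε.1)
  have henergy := fun h => hB.energy_eq hu ((moment_eq_iff (ω := z.2) (j := ε.1) hA).1 h)
  set g := vert z.1 ⬝ᵥ (B *ᵥ vert z.1)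
  have hvalue : 1 / 2 * ε.1 ^ 2 * g / (1 - ρ * g) = ε.2 ↔ g = levelValue ρ ε := by
    rw [levelValue, div_eq_iff hlt.ne', eq_div_iff hD.ne']
    constructor <;> intro h
    · linear_combination 2 * h
    · linear_combination (1 / 2) * h
  have hfactor (h : g = levelValue ρ ε) : ε.1 / (1 - ρ * g) = levelFactor ρ ε := by
    rw [levelValue, eq_div_iff hD.ne'] at h
    rw [levelFactor, div_eq_div_iff hlt.ne' hε]
    linear_combination ρ * h
  constructor
  · rintro ⟨-, hm, hT⟩
    have hg : g = levelValue ρ ε := by rwa [henergy hm, hvalue] at hT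
    exact ⟨hg, hfactor hg ▸ hmoment.1 hm⟩
  · rintro ⟨hg, hω⟩
    have hm := hmoment.2 ((hfactor hg).symm ▸ hω)
    exact ⟨hA, hm, by rwa [henergy hm, hvalue]⟩

theorem dynamicalEq (hB : IsInertiaInverse I ρ B) {κ : ℝ} (hω : ω = κ • (B *ᵥ u)) :
    DynamicalEq I ρ u ω (κ • (B *ᵥ (u ⨯₃ ω))) := by
  have horth : u ⬝ᵥ (κ • (B *ᵥ (u ⨯₃ ω))) = 0 := by
    rw [dotProduct_smul, ← hB.dot_comm, ← smul_dotProduct, ← hω, dot_cross_self]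
  have hIω : I *ᵥ ω = κ • u - ρ • ω := by
    rw [hω, mulVec_smul, smul_comm ρ, ← smul_sub, eq_sub_of_add_eq (hB.add_mulVec_mulVec u)]
  rw [dynamicalEq_iff, inertiaAt_mulVec, horth, mul_zero, zero_smul, sub_zero, mulVec_smul,
    smul_comm ρ, ← smul_add, hB.add_mulVec_mulVec, hIω, LinearMap.map_sub₂, LinearMap.map_smul₂,
    LinearMap.map_smul₂, cross_self, smul_zero, sub_zero]

end IsInertiaInverse

end LevelSets

/-! ### Conservation laws and uniqueness of solutions -/

section Solutions

theorem eq_of_hasDerivAt_zero {V : Type*} [NormedAddCommGroup V] [NormedSpace ℝ V] {f : ℝ → V}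
    (hf : ∀ t, HasDerivAt f 0 t) (s t : ℝ) : f s = f t :=
  is_const_of_deriv_eq_zero (fun t => (hf t).differentiableAt) (fun t => (hf t).deriv) s t

theorem eq_of_hasDerivAt_of_mem_compact {V : Type*} [NormedAddCommGroup V] [NormedSpace ℝ V]
    {v : V → V} (hv : LocallyLipschitz v) {s : Set V} (hs : IsCompact s) {f g : ℝ → V}
    (hf : ∀ t, HasDerivAt f (v (f t)) t) (hfs : ∀ t, f t ∈ s)
    (hg : ∀ t, HasDerivAt g (v (g t)) t) (hgs : ∀ t, g t ∈ s) (h0 : f 0 = g 0) : f = g := by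
  obtain ⟨L, hL⟩ := hv.locallyLipschitzOn.exists_lipschitzOnWith_of_compact hs
  exact ODE_solution_unique_univ (fun _ => hL) (fun t => ⟨hf t, hfs t⟩)
    (fun t => ⟨hg t, hgs t⟩) h0

theorem eq_zero_of_hasDerivAt_cross {d ω : ℝ → Vec} (hd : ∀ t, HasDerivAt d (d t ⨯₃ ω t) t)
    (h0 : d 0 = 0) (t : ℝ) : d t = 0 := by
  have hsq (t : ℝ) : HasDerivAt (fun t => d t ⬝ᵥ d t) 0 t :=
    (hasDerivAt_dot (hd t) (hd t)).congr_deriv (by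
      rw [dotProduct_comm, dot_self_cross, add_zero])
  refine dotProduct_self_eq_zero.1 ?_
  rw [eq_of_hasDerivAt_zero hsq t 0, h0, dotProduct_zero]

section Prod

variable {V W : Type*} [NormedAddCommGroup V] [NormedSpace ℝ V] [NormedAddCommGroup W]
  [NormedSpace ℝ W] {γ : ℝ → V × W} {v : V} {w : W} {t : ℝ}

theorem hasDerivAt_prod_fst (h : HasDerivAt γ (v, w) t) : HasDerivAt (fun t => (γ t).1) v t :=
  (ContinuousLinearMap.fst ℝ V W).hasFDerivAt.comp_hasDerivAt t h

theorem hasDerivAt_prod_snd (h : HasDerivAt γ (v, w) t) : HasDerivAt (fun t => (γ t).2) w t :=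
  (ContinuousLinearMap.snd ℝ V W).hasFDerivAt.comp_hasDerivAt t h

end Prod

variable {I : Mat} {ρ m r : ℝ} {B : Mat}

theorem setOf_dot_self_eq_one_subset_closedBall {n : ℕ} :
    {u : Fin n → ℝ | u ⬝ᵥ u = 1} ⊆ Metric.closedBall 0 1 := by
  intro u hu
  rw [mem_closedBall_zero_iff, pi_norm_le_iff_of_nonneg zero_le_one]
  intro i
  rw [Real.norm_eq_abs, ← sq_le_one_iff_abs_le_one, ← show u ⬝ᵥ u = 1 from hu, sq]
  exact Finset.single_le_sum (f := fun i => u i * u i) (fun i _ => mul_self_nonneg _)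
    (Finset.mem_univ i)

namespace IsReducedSolution

variable {γ : ℝ → Vec × Vec}

theorem hasDerivAt_fst (hγ : IsReducedSolution I ρ γ) (t : ℝ) :
    HasDerivAt (fun t => (γ t).1) ((γ t).1 ⨯₃ (γ t).2) t := by
  obtain ⟨-, ω', h, -⟩ := hγ t
  exact hasDerivAt_prod_fst h

theorem hasDerivAt_inertiaAt_mulVec (hγ : IsReducedSolution I ρ γ) (t : ℝ) :
    HasDerivAt (fun t => inertiaAt I ρ (γ t).1 *ᵥ (γ t).2)
      ((inertiaAt I ρ (γ t).1 *ᵥ (γ t).2) ⨯₃ (γ t).2) t := by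
  obtain ⟨-, ω', h, hdyn⟩ := hγ t
  have hu := hγ.hasDerivAt_fst t
  have hω := hasDerivAt_prod_snd h
  have horth : ((γ t).1 ⨯₃ (γ t).2) ⬝ᵥ (γ t).2 = 0 := by
    rw [dotProduct_comm, dot_cross_self]
  rw [dynamicalEq_iff, inertiaAt_mulVec] at hdyn
  simp only [inertiaAt_mulVec]
  refine (((hasDerivAt_const_mulVec I hω).add (hω.const_smul ρ)).sub
    (((hasDerivAt_dot hu hω).const_mul ρ).smul hu)).congr_deriv ?_
  rw [horth, zero_add, add_comm (_ • ((γ t).1 ⨯₃ (γ t).2)), ← sub_sub, hdyn, LinearMap.map_sub₂,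
    LinearMap.map_add₂, LinearMap.map_smul₂, LinearMap.map_smul₂, cross_self, smul_zero, add_zero]

theorem inertiaAt_mulVec_eq (hγ : IsReducedSolution I ρ γ) {j : ℝ}
    (h0 : inertiaAt I ρ (γ 0).1 *ᵥ (γ 0).2 = j • (γ 0).1) (t : ℝ) :
    inertiaAt I ρ (γ t).1 *ᵥ (γ t).2 = j • (γ t).1 := by
  refine sub_eq_zero.1 (eq_zero_of_hasDerivAt_cross
    (d := fun t => inertiaAt I ρ (γ t).1 *ᵥ (γ t).2 - j • (γ t).1) (ω := fun t => (γ t).2)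
    (fun t => ?_) (sub_eq_zero.2 h0) t)
  exact ((hγ.hasDerivAt_inertiaAt_mulVec t).sub
    ((hγ.hasDerivAt_fst t).const_smul j)).congr_deriv
    (by rw [LinearMap.map_sub₂, LinearMap.map_smul₂])

end IsReducedSolution

theorem IsInertiaInverse.eq_of_isReducedSolution (hB : IsInertiaInverse I ρ B)
    {γ : ℝ → Vec × Vec} (hγ : IsReducedSolution I ρ γ) {j : ℝ}
    (h0 : inertiaAt I ρ (γ 0).1 *ᵥ (γ 0).2 = j • (γ 0).1) (t : ℝ) :
    (γ t).2 = (j / (1 - ρ * ((γ 0).1 ⬝ᵥ (B *ᵥ (γ 0).1)))) • (B *ᵥ (γ t).1) := by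
  have hω (t : ℝ) := (hB.inertiaAt_mulVec_eq_iff (hγ t).1 j).1 (hγ.inertiaAt_mulVec_eq h0 t)
  have hform (t : ℝ) : HasDerivAt (fun t => (γ t).1 ⬝ᵥ (B *ᵥ (γ t).1)) 0 t := by
    have hu := hγ.hasDerivAt_fst t
    refine (hasDerivAt_dot hu (hasDerivAt_const_mulVec B hu)).congr_deriv ?_
    rw [← hB.dot_comm (γ t).1, dotProduct_comm (B *ᵥ (γ t).1), ← two_mul, hω t, map_smul,
      smul_dotProduct, dotProduct_comm (_ ⨯₃ _), dot_cross_self, smul_zero, mul_zero]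
  rw [hω t, eq_of_hasDerivAt_zero hform t 0]

theorem IsInertiaInverse.isReducedSolution_unique (hB : IsInertiaInverse I ρ B)
    {γ₁ γ₂ : ℝ → Vec × Vec} (h₁ : IsReducedSolution I ρ γ₁) (h₂ : IsReducedSolution I ρ γ₂) {j : ℝ}
    (h0 : inertiaAt I ρ (γ₁ 0).1 *ᵥ (γ₁ 0).2 = j • (γ₁ 0).1) (h : γ₁ 0 = γ₂ 0) : γ₁ = γ₂ := by
  set κ := j / (1 - ρ * ((γ₁ 0).1 ⬝ᵥ (B *ᵥ (γ₁ 0).1))) with hκ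
  have hω₁ : ∀ t, (γ₁ t).2 = κ • (B *ᵥ (γ₁ t).1) := hB.eq_of_isReducedSolution h₁ h0
  have hω₂ : ∀ t, (γ₂ t).2 = κ • (B *ᵥ (γ₂ t).1) := by
    rw [hκ, h]
    exact hB.eq_of_isReducedSolution h₂ (h ▸ h0)
  have hfield : ContDiff ℝ 1 fun u : Vec => u ⨯₃ (κ • (B *ᵥ u)) :=
    contDiff_iff_contDiffAt.2 fun u => (analyticAt_cross analyticAt_id
      (analyticAt_const.fun_smul (analyticAt_const_mulVec B analyticAt_id))).contDiffAt
  have hu : (fun t => (γ₁ t).1) = fun t => (γ₂ t).1 :=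
    eq_of_hasDerivAt_of_mem_compact hfield.locallyLipschitz (isCompact_closedBall 0 1)
      (fun t => by rw [← hω₁]; exact h₁.hasDerivAt_fst t)
      (fun t => setOf_dot_self_eq_one_subset_closedBall (h₁ t).1)
      (fun t => by rw [← hω₂]; exact h₂.hasDerivAt_fst t)
      (fun t => setOf_dot_self_eq_one_subset_closedBall (h₂ t).1) (congrArg Prod.fst h)
  funext t
  have hut : (γ₁ t).1 = (γ₂ t).1 := congrFun hu t
  exact Prod.ext hut (by rw [hω₁, hω₂, hut])

theorem IsRotSolution.reduce {γ : ℝ → Mat × Vec} (hγ : IsRotSolution I ρ γ) :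
    IsReducedSolution I ρ fun t => reduce (γ t) := by
  intro t
  obtain ⟨hA, ω', h, hdyn⟩ := hγ t
  refine ⟨vert_dot_vert hA, ω', ?_, hdyn⟩
  exact ((hasDerivAt_vert (hasDerivAt_prod_fst h)).prodMk (hasDerivAt_prod_snd h)).congr_deriv
    (by rw [vert_mul_hat]; rfl)

theorem IsInertiaInverse.isRotSolution_unique (hB : IsInertiaInverse I ρ B)
    {γ₁ γ₂ : ℝ → Mat × Vec} (h₁ : IsRotSolution I ρ γ₁) (h₂ : IsRotSolution I ρ γ₂) {j : ℝ}
    (h0 : moment I ρ (γ₁ 0).1 (γ₁ 0).2 = j • e₃) (h : γ₁ 0 = γ₂ 0) : γ₁ = γ₂ := by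
  have hreduce := hB.isReducedSolution_unique h₁.reduce h₂.reduce
    ((moment_eq_iff (h₁ 0).1).1 h0) (by rw [h])
  have hω (t : ℝ) : (γ₁ t).2 = (γ₂ t).2 :=
    congrArg Prod.snd (a₁ := reduce (γ₁ t)) (a₂ := reduce (γ₂ t)) (congrFun hreduce t)
  have hquot (t : ℝ) : HasDerivAt (fun t => (γ₁ t).1 * ((γ₂ t).1)ᵀ) 0 t := by
    obtain ⟨-, ω₁, hd₁, -⟩ := h₁ t
    obtain ⟨-, ω₂, hd₂, -⟩ := h₂ t
    refine (hasDerivAt_mul (hasDerivAt_prod_fst hd₁)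
      (hasDerivAt_transpose (hasDerivAt_prod_fst hd₂))).congr_deriv ?_
    rw [hω t, transpose_mul, hat_transpose, neg_mul, mul_neg, Matrix.mul_assoc, add_neg_cancel]
  funext t
  refine Prod.ext ?_ (hω t)
  have hone : (γ₁ t).1 * ((γ₂ t).1)ᵀ = 1 := by
    rw [eq_of_hasDerivAt_zero hquot t 0, h, mul_transpose_of_mem (h₂ 0).1]
  calc (γ₁ t).1 = (γ₁ t).1 * (((γ₂ t).1)ᵀ * (γ₂ t).1) := by rw [(h₂ t).1.1, Matrix.mul_one]
    _ = (γ₂ t).1 := by rw [← Matrix.mul_assoc, hone, Matrix.one_mul]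

theorem IsFullSolution.isRotSolution {γ : ℝ → Mat × Vec × Plane} (hγ : IsFullSolution I m r γ) :
    IsRotSolution I (m * r ^ 2) fun t => ((γ t).1, (γ t).2.1) := by
  intro t
  obtain ⟨hA, ω', h, hdyn⟩ := hγ t
  exact ⟨hA, ω', (hasDerivAt_prod_fst h).prodMk (hasDerivAt_prod_fst (hasDerivAt_prod_snd h)),
    hdyn⟩

theorem IsFullSolution.hasDerivAt_position {γ : ℝ → Mat × Vec × Plane}
    (hγ : IsFullSolution I m r γ) (t : ℝ) :
    HasDerivAt (fun t => (γ t).2.2) (contactVelocity r (γ t).1 (γ t).2.1) t := by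
  obtain ⟨-, ω', h, -⟩ := hγ t
  exact hasDerivAt_prod_snd (hasDerivAt_prod_snd h)

theorem IsInertiaInverse.isFullSolution_unique (hB : IsInertiaInverse I (m * r ^ 2) B)
    {γ₁ γ₂ : ℝ → Mat × Vec × Plane} (h₁ : IsFullSolution I m r γ₁) (h₂ : IsFullSolution I m r γ₂)
    {j : ℝ} (h0 : moment I (m * r ^ 2) (γ₁ 0).1 (γ₁ 0).2.1 = j • e₃) (h : γ₁ 0 = γ₂ 0) :
    γ₁ = γ₂ := by
  have hrot := hB.isRotSolution_unique h₁.isRotSolution h₂.isRotSolution h0 (by rw [h])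
  have hA (t : ℝ) : (γ₁ t).1 = (γ₂ t).1 := (Prod.mk.inj (congrFun hrot t)).1
  have hω (t : ℝ) : (γ₁ t).2.1 = (γ₂ t).2.1 := (Prod.mk.inj (congrFun hrot t)).2
  have hdiff (t : ℝ) : HasDerivAt (fun t => (γ₁ t).2.2 - (γ₂ t).2.2) 0 t :=
    ((h₁.hasDerivAt_position t).sub (h₂.hasDerivAt_position t)).congr_deriv (by
      rw [hA, hω, sub_self])
  funext t
  refine Prod.ext (hA t) (Prod.ext (hω t) (sub_eq_zero.1 ?_))
  rw [eq_of_hasDerivAt_zero hdiff t 0, h, sub_self]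

theorem IsFullSolution.exists_drift {γ : ℝ → Mat × Vec × Plane} (hγ : IsFullSolution I m r γ)
    {P : ℝ} (hP : P ≠ 0) (hper : Function.Periodic (fun t => ((γ t).1, (γ t).2.1)) P) :
    ∃ (w : Plane) (q : ℝ → Plane), Function.Periodic q P ∧ ∀ t, (γ t).2.2 = t • w + q t := by
  have hincr (t : ℝ) : HasDerivAt (fun t => (γ (t + P)).2.2 - (γ t).2.2) 0 t := by
    obtain ⟨hA, hω⟩ := Prod.mk.inj (hper t)
    exact (((hγ.hasDerivAt_position (t + P)).comp_add_const t P).sub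
      (hγ.hasDerivAt_position t)).congr_deriv (by rw [hA, hω, sub_self])
  let w : Plane := P⁻¹ • ((γ (0 + P)).2.2 - (γ 0).2.2)
  refine ⟨w, fun t => (γ t).2.2 - t • w, fun t => ?_, fun t => (add_sub_cancel _ _).symm⟩
  have hw : (γ (t + P)).2.2 = (γ t).2.2 + P • w := by
    rw [smul_inv_smul₀ hP, ← eq_of_hasDerivAt_zero hincr t 0, add_sub_cancel]
  simp only [hw, add_smul, add_sub_add_right_eq_sub]

end Solutions

/-! ### Tori of rotated trajectories -/

/-- The action on states `(A, ω)` of the rotation by the angle `2 π y` about the vertical axis. -/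
noncomputable def rotState (y : ℝ) (z : Mat × Vec) : Mat × Vec := (rotVertical y * z.1, z.2)

/-- The vertical component of the moment, together with the energy. -/
noncomputable def momentEnergy (I : Mat) (ρ : ℝ) (z : Mat × Vec) : ℝ × ℝ :=
  (moment I ρ z.1 z.2 2, energy I ρ (vert z.1) z.2)

section States

variable {I : Mat} {ρ : ℝ}

theorem rotState_add (x y : ℝ) (z : Mat × Vec) :
    rotState (x + y) z = rotState x (rotState y z) := by
  rw [rotState, rotVertical_add, Matrix.mul_assoc, rotState, rotState]

theorem rotState_zero (z : Mat × Vec) : rotState 0 z = z := by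
  rw [rotState, rotVertical_zero, Matrix.one_mul]

theorem vert_rotState (y : ℝ) (z : Mat × Vec) : vert (rotState y z).1 = vert z.1 :=
  vert_rotVertical_mul y z.1

theorem rotState_eq_iff {z : Mat × Vec} (hz : z.1 ∈ SO3) {x y : ℝ} :
    rotState x z = rotState y z ↔ ∃ n : ℤ, x = y + n := by
  have hunit : IsUnit z.1 := IsUnit.of_mul_eq_one _ (mul_transpose_of_mem hz)
  rw [rotState, rotState, Prod.mk.injEq, and_iff_left rfl, hunit.mul_left_inj, rotVertical_eq_iff]

theorem rotState_mem_levelSet {j T : ℝ} {z : Mat × Vec} (hz : z ∈ levelSet I ρ (j • e₃) T)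
    (y : ℝ) : rotState y z ∈ levelSet I ρ (j • e₃) T := by
  obtain ⟨hA, hmoment, henergy⟩ := hz
  have hRA : (rotState y z).1 ∈ SO3 := mul_mem_SO3 (rotVertical_mem_SO3 y) hA
  refine ⟨hRA, (moment_eq_iff hRA).2 ?_, ?_⟩
  · rw [vert_rotState]
    exact (moment_eq_iff hA).1 hmoment
  · rw [vert_rotState]
    exact henergy

theorem exists_eq_rotState_of_vert_eq {B : Mat} (hB : IsInertiaInverse I ρ B) {j T : ℝ}
    {z z' : Mat × Vec} (hz : z ∈ levelSet I ρ (j • e₃) T) (hz' : z' ∈ levelSet I ρ (j • e₃) T)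
    (hvert : vert z.1 = vert z'.1) : ∃ y, z = rotState y z' := by
  have hfix : vert (z.1 * z'.1ᵀ) = e₃ := by
    rw [vert, transpose_mul, transpose_transpose, ← mulVec_mulVec, ← vert, hvert, mulVec_vert hz'.1]
  obtain ⟨y, hy⟩ := exists_eq_rotVertical (mul_mem_SO3 hz.1 (transpose_mem_SO3 hz'.1)) hfix
  have homega {z : Mat × Vec} (hz : z ∈ levelSet I ρ (j • e₃) T) :=
    (hB.inertiaAt_mulVec_eq_iff (vert_dot_vert hz.1) j).1 ((moment_eq_iff hz.1).1 hz.2.1)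
  refine ⟨y, Prod.ext ?_ ?_⟩
  · rw [rotState, ← hy, Matrix.mul_assoc, hz'.1.1, Matrix.mul_one]
  · rw [rotState, homega hz, homega hz', hvert]

theorem apply_add_int_of_apply_add_one {X : Type*} {R : ℝ → X → X}
    (hadd : ∀ a b x, R (a + b) x = R a (R b x)) (hzero : ∀ x, R 0 x = x) {f : ℝ → X} {a : ℝ}
    (hf : ∀ s, f (s + 1) = R a (f s)) (s : ℝ) (n : ℤ) : f (s + n) = R (a * n) (f s) := by
  have hper : Function.Periodic (fun s => R (-(a * s)) (f s)) 1 := fun s => by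
    simp only [hf, ← hadd]
    ring_nf
  have hn : R (-(a * (s + n))) (f (s + n)) = R (-(a * s)) (f s) := by
    simpa only [mul_one] using hper.int_mul n s
  calc f (s + n) = R (a * (s + n)) (R (-(a * (s + n))) (f (s + n))) := by
        rw [← hadd, add_neg_cancel, hzero]
    _ = R (a * n) (f s) := by
        rw [hn, ← hadd]
        ring_nf

section Analytic

variable {X V W : Type*} [NormedAddCommGroup X] [NormedSpace ℝ X] [NormedAddCommGroup V]
  [NormedSpace ℝ V] [NormedAddCommGroup W] [NormedSpace ℝ W] {x : X}

theorem analyticAt_prod_fst {f : X → V × W} (hf : AnalyticAt ℝ f x) :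
    AnalyticAt ℝ (fun x => (f x).1) x :=
  analyticAt_fst.comp_of_eq hf rfl

theorem analyticAt_prod_snd {f : X → V × W} (hf : AnalyticAt ℝ f x) :
    AnalyticAt ℝ (fun x => (f x).2) x :=
  analyticAt_snd.comp_of_eq hf rfl

theorem analyticAt_apply {n : ℕ} {f : X → Fin n → ℝ} (hf : AnalyticAt ℝ f x) (i : Fin n) :
    AnalyticAt ℝ (fun x => f x i) x :=
  (analyticAt_pi_iff (f := fun i x => f x i)).1 hf i

theorem analyticAt_vert {A : X → Mat} (hA : AnalyticAt ℝ A x) :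
    AnalyticAt ℝ (fun x => vert (A x)) x := by
  refine analyticAt_mulVec ?_ analyticAt_const
  rw [analyticAt_matrix_iff] at hA ⊢
  exact fun i j => hA j i

end Analytic

theorem analyticAt_momentEnergy (I : Mat) (ρ : ℝ) (z : Mat × Vec) :
    AnalyticAt ℝ (momentEnergy I ρ) z := by
  have hA : AnalyticAt ℝ (fun z : Mat × Vec => z.1) z := analyticAt_fst
  have hω : AnalyticAt ℝ (fun z : Mat × Vec => z.2) z := analyticAt_snd
  have hu := analyticAt_vert hA
  have hcross := analyticAt_cross hu hω
  have hmoment : AnalyticAt ℝ (fun z : Mat × Vec => moment I ρ z.1 z.2) z := by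
    simp only [moment, inertiaAt_mulVec]
    exact analyticAt_mulVec hA (((analyticAt_const_mulVec I hω).fun_add
      (analyticAt_const.fun_smul hω)).fun_sub
      ((analyticAt_const.fun_mul (analyticAt_dot hu hω)).fun_smul hu))
  exact (analyticAt_apply hmoment 2).prod
    ((analyticAt_const.fun_mul (analyticAt_dot (analyticAt_const_mulVec I hω) hω)).add
      (analyticAt_const.fun_mul (analyticAt_dot hcross hcross)))

theorem continuous_momentEnergy (I : Mat) (ρ : ℝ) : Continuous (momentEnergy I ρ) :=
  continuous_iff_continuousAt.2 fun z => (analyticAt_momentEnergy I ρ z).continuousAt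

theorem momentEnergy_of_mem_levelSet {ε : ℝ × ℝ} {z : Mat × Vec}
    (hz : z ∈ levelSet I ρ (ε.1 • e₃) ε.2) : momentEnergy I ρ z = ε := by
  obtain ⟨-, hmoment, henergy⟩ := hz
  exact Prod.ext (by simp [momentEnergy, hmoment, e₃]) henergy

theorem mem_levelSet_of_mem_verticalRot {z : Mat × Vec} (hz : z ∈ verticalRot I ρ) :
    z ∈ levelSet I ρ ((momentEnergy I ρ z).1 • e₃) (momentEnergy I ρ z).2 := by
  obtain ⟨hA, h, hmoment⟩ := hz
  exact ⟨hA, by simp [momentEnergy, hmoment, e₃], rfl⟩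

theorem mem_verticalRot_of_mem_levelSet {j T : ℝ} {z : Mat × Vec}
    (hz : z ∈ levelSet I ρ (j • e₃) T) : z ∈ verticalRot I ρ := ⟨hz.1, j, hz.2.1⟩

theorem hasDerivAt_rotVertical_mul {y : ℝ → ℝ} {y' b t : ℝ} {A : ℝ → Mat} {ω : Vec}
    (hy : HasDerivAt y y' t) (hA : HasDerivAt A (b • (A t * hat ω)) t) (hAt : A t ∈ SO3) :
    HasDerivAt (fun t => rotVertical (y t) * A t)
      (rotVertical (y t) * A t * hat ((2 * Real.pi * y') • vert (A t) + b • ω)) t := by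
  refine (hasDerivAt_mul (hasDerivAt_rotVertical hy) hA).congr_deriv ?_
  rw [Matrix.smul_mul, Matrix.mul_assoc (hat e₃),
    hat_e₃_mul (mul_mem_SO3 (rotVertical_mem_SO3 _) hAt), vert_rotVertical_mul, Matrix.mul_smul,
    ← Matrix.mul_assoc, hat_add, hat_smul, hat_smul, Matrix.mul_add, Matrix.mul_smul,
    Matrix.mul_smul]

theorem eq_zero_of_mul_hat_eq_zero {A : Mat} (hA : A ∈ SO3) {a : Vec} (h : A * hat a = 0) :
    a = 0 :=
  hat_eq_zero (by rw [← Matrix.one_mul (hat a), ← hA.1, Matrix.mul_assoc, h, Matrix.mul_zero])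

theorem eq_zero_of_smul_add_smul_eq_zero {a b : ℝ} {x y : Vec} (hxy : x ⨯₃ y ≠ 0)
    (h : a • x + b • y = 0) : a = 0 ∧ b = 0 := by
  constructor
  · have hcross : a • (x ⨯₃ y) = 0 := by
      simpa only [LinearMap.map_add₂, LinearMap.map_smul₂, cross_self, smul_zero, add_zero,
        LinearMap.map_zero₂] using congrArg (· ⨯₃ y) h
    exact (smul_eq_zero.1 hcross).resolve_right hxy
  · have hcross : b • (x ⨯₃ y) = 0 := by
      simpa only [map_add, map_smul, cross_self, smul_zero, zero_add, map_zero] using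
        congrArg (x ⨯₃ ·) h
    exact (smul_eq_zero.1 hcross).resolve_right hxy

theorem snd_eq_zero_of_fderiv_eq_zero {X Q S : Type*} [NormedAddCommGroup X] [NormedSpace ℝ X]
    [NormedAddCommGroup Q] [NormedSpace ℝ Q] [NormedAddCommGroup S] [NormedSpace ℝ S]
    {f : X × Q → S} {g : S → Q} {z v : X × Q} (hf : DifferentiableAt ℝ f z)
    (hg : DifferentiableAt ℝ g (f z)) (hgf : g ∘ f =ᶠ[nhds z] Prod.snd)
    (hv : fderiv ℝ f z v = 0) : v.2 = 0 := by
  have hcomp := (hg.hasFDerivAt.comp z hf.hasFDerivAt).unique (hasFDerivAt_snd.congr_of_eventuallyEq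
    hgf)
  calc v.2 = ContinuousLinearMap.snd ℝ X Q v := rfl
    _ = 0 := by rw [← hcomp, ContinuousLinearMap.comp_apply, hv, map_zero]

theorem hasDerivAt_add_smul {X : Type*} [NormedAddCommGroup X] [NormedSpace ℝ X] (x v : X)
    (t : ℝ) : HasDerivAt (fun t : ℝ => x + t • v) v t := by
  simpa using ((hasDerivAt_id t).smul_const v).const_add x

end States

/-- An analytic family of trajectories `x ↦ G (x, ε)` of the rotational motion, parametrized
uniformly with period one up to a rotation by `2 π θ ε` about the vertical axis. The velocity of
the parameter is `1 / K ε`, and `U` singles out a component of the level sets. -/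
structure IsTrajectoryFamily (I : Mat) (ρ : ℝ) (E : Set (ℝ × ℝ)) (G : ℝ × (ℝ × ℝ) → Mat × Vec)
    (θ K : ℝ × ℝ → ℝ) (U : Set Vec) : Prop where
  isOpen_param : IsOpen E
  isOpen_region : IsOpen U
  analytic : AnalyticOnNhd ℝ G (Set.univ ×ˢ E)
  analytic_angle : AnalyticOnNhd ℝ θ E
  analytic_period : AnalyticOnNhd ℝ K E
  period_ne_zero : ∀ ε ∈ E, K ε ≠ 0
  mem_levelSet : ∀ x, ∀ ε ∈ E, G (x, ε) ∈ levelSet I ρ (ε.1 • e₃) ε.2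
  add_one : ∀ x, ∀ ε ∈ E, G (x + 1, ε) = rotState (θ ε) (G (x, ε))
  velocity : ∀ x, ∀ ε ∈ E, ∃ ω' : Vec,
    HasDerivAt (fun x => G (x, ε)) (K ε • ((G (x, ε)).1 * hat (G (x, ε)).2), K ε • ω') x ∧
      DynamicalEq I ρ (vert (G (x, ε)).1) (G (x, ε)).2 ω'
  injective : ∀ ε ∈ E, ∀ x y, vert (G (x, ε)).1 = vert (G (y, ε)).1 → ∃ n : ℤ, x = y + n
  mem_region : ∀ x, ∀ ε ∈ E, vert (G (x, ε)).1 ∈ U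
  surjective : ∀ ε ∈ E, ∀ z ∈ levelSet I ρ (ε.1 • e₃) ε.2, vert z.1 ∈ U →
    ∃ x, vert z.1 = vert (G (x, ε)).1
  cross_ne_zero : ∀ x, ∀ ε ∈ E, vert (G (x, ε)).1 ⨯₃ (G (x, ε)).2 ≠ 0

/-- The rotation about the vertical axis at the point `z` of the tori. Subtracting `θ z.2 * z.1 1`
cancels the rotation picked up in a period, so that the tori close up. -/
noncomputable def torusAngle (θ : ℝ × ℝ → ℝ) (z : (Fin 2 → ℝ) × (ℝ × ℝ)) : ℝ :=
  z.1 0 - θ z.2 * z.1 1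

/-- The tori swept out by the rotations of a family of trajectories about the vertical axis. -/
noncomputable def rotTorus (G : ℝ × (ℝ × ℝ) → Mat × Vec) (θ : ℝ × ℝ → ℝ) :
    (Fin 2 → ℝ) × (ℝ × ℝ) → Mat × Vec :=
  fun z => rotState (torusAngle θ z) (G (z.1 1, z.2))

/-- The frequencies of the motion on the tori `rotTorus G θ`. -/
noncomputable def torusFrequency (θ K : ℝ × ℝ → ℝ) : ℝ × ℝ → Fin 2 → ℝ :=
  fun ε => ![θ ε * (K ε)⁻¹, (K ε)⁻¹]

section Torus

variable {I : Mat} {ρ : ℝ} {B : Mat} {E : Set (ℝ × ℝ)} {G : ℝ × (ℝ × ℝ) → Mat × Vec}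
  {θ K : ℝ × ℝ → ℝ} {U : Set Vec} {ε : ℝ × ℝ}

theorem analyticAt_torusAngle {z : (Fin 2 → ℝ) × (ℝ × ℝ)} (hθ : AnalyticAt ℝ θ z.2) :
    AnalyticAt ℝ (torusAngle θ) z :=
  (analyticAt_apply analyticAt_fst 0).sub
    ((hθ.comp_of_eq analyticAt_snd rfl).mul (analyticAt_apply analyticAt_fst 1))

theorem torusAngle_line (θ K : ℝ × ℝ → ℝ) (x : Fin 2 → ℝ) (ε : ℝ × ℝ) (t : ℝ) :
    torusAngle θ (x + t • torusFrequency θ K ε, ε) = torusAngle θ (x, ε) := by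
  simp only [torusAngle, torusFrequency, Pi.add_apply, Pi.smul_apply, smul_eq_mul, cons_val_zero,
    cons_val_one]
  ring

theorem rotTorus_line (G : ℝ × (ℝ × ℝ) → Mat × Vec) (θ K : ℝ × ℝ → ℝ) (x : Fin 2 → ℝ) (ε : ℝ × ℝ)
    (t : ℝ) : rotTorus G θ (x + t • torusFrequency θ K ε, ε) =
      rotState (torusAngle θ (x, ε)) (G (x 1 + t * (K ε)⁻¹, ε)) := by
  rw [rotTorus, torusAngle_line]
  rfl

theorem vert_rotTorus (z : (Fin 2 → ℝ) × (ℝ × ℝ)) :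
    vert (rotTorus G θ z).1 = vert (G (z.1 1, z.2)).1 :=
  vert_rotState _ _

namespace IsTrajectoryFamily

theorem mono (h : IsTrajectoryFamily I ρ E G θ K U) {E' : Set (ℝ × ℝ)} (hE' : IsOpen E')
    (hsub : E' ⊆ E) : IsTrajectoryFamily I ρ E' G θ K U where
  isOpen_param := hE'
  isOpen_region := h.isOpen_region
  analytic := h.analytic.mono (Set.prod_mono le_rfl hsub)
  analytic_angle := h.analytic_angle.mono hsub
  analytic_period := h.analytic_period.mono hsub
  period_ne_zero ε hε := h.period_ne_zero ε (hsub hε)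
  mem_levelSet x ε hε := h.mem_levelSet x ε (hsub hε)
  add_one x ε hε := h.add_one x ε (hsub hε)
  velocity x ε hε := h.velocity x ε (hsub hε)
  injective ε hε := h.injective ε (hsub hε)
  mem_region x ε hε := h.mem_region x ε (hsub hε)
  surjective ε hε := h.surjective ε (hsub hε)
  cross_ne_zero x ε hε := h.cross_ne_zero x ε (hsub hε)

theorem add_int (h : IsTrajectoryFamily I ρ E G θ K U) (x : ℝ) (hε : ε ∈ E) (n : ℤ) :
    G (x + n, ε) = rotState (θ ε * n) (G (x, ε)) :=
  apply_add_int_of_apply_add_one rotState_add rotState_zero (f := fun x => G (x, ε))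
    (fun x => h.add_one x ε hε) x n

theorem rotTorus_mem_levelSet (h : IsTrajectoryFamily I ρ E G θ K U) (x : Fin 2 → ℝ)
    (hε : ε ∈ E) : rotTorus G θ (x, ε) ∈ levelSet I ρ (ε.1 • e₃) ε.2 :=
  rotState_mem_levelSet (h.mem_levelSet (x 1) ε hε) _

theorem momentEnergy_rotTorus (h : IsTrajectoryFamily I ρ E G θ K U) (x : Fin 2 → ℝ)
    (hε : ε ∈ E) : momentEnergy I ρ (rotTorus G θ (x, ε)) = ε :=
  momentEnergy_of_mem_levelSet (h.rotTorus_mem_levelSet x hε)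

theorem rotTorus_eq_of_apply_one (h : IsTrajectoryFamily I ρ E G θ K U) {x y : Fin 2 → ℝ}
    (hε : ε ∈ E) {n : ℤ} (hn : x 1 = y 1 + n) :
    rotTorus G θ (x, ε) = rotState (torusAngle θ (y, ε) + (x 0 - y 0)) (G (y 1, ε)) := by
  simp only [rotTorus, hn, h.add_int (y 1) hε n, ← rotState_add, torusAngle]
  ring_nf

theorem rotTorus_eq_iff (h : IsTrajectoryFamily I ρ E G θ K U) (x y : Fin 2 → ℝ) {δ : ℝ × ℝ}
    (hε : ε ∈ E) (hδ : δ ∈ E) : rotTorus G θ (x, ε) = rotTorus G θ (y, δ) ↔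
      ε = δ ∧ ∃ k : Fin 2 → ℤ, ∀ i, x i = y i + k i := by
  constructor
  · intro heq
    obtain rfl : ε = δ := by
      rw [← h.momentEnergy_rotTorus x hε, heq, h.momentEnergy_rotTorus y hδ]
    have hvert : vert (G (x 1, ε)).1 = vert (G (y 1, ε)).1 := by
      rw [← vert_rotTorus (θ := θ) (x, ε), heq, vert_rotTorus]
    obtain ⟨n, hn⟩ := h.injective ε hε _ _ hvert
    rw [h.rotTorus_eq_of_apply_one hε hn, rotTorus,
      rotState_eq_iff (h.mem_levelSet (y 1) ε hε).1] at heq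
    obtain ⟨m, hm⟩ := heq
    exact ⟨rfl, ![m, n], Fin.forall_fin_two.2 ⟨sub_eq_iff_eq_add'.1 (add_left_cancel hm), hn⟩⟩
  · rintro ⟨rfl, k, hk⟩
    rw [h.rotTorus_eq_of_apply_one hε (hk 1), rotTorus,
      rotState_eq_iff (h.mem_levelSet (y 1) ε hε).1]
    exact ⟨k 0, by rw [hk 0, add_sub_cancel_left]⟩

theorem analytic_rotTorus (h : IsTrajectoryFamily I ρ E G θ K U) :
    AnalyticOnNhd ℝ (rotTorus G θ) (Set.univ ×ˢ E) := by
  rintro ⟨x, ε⟩ ⟨-, hε⟩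
  have hG : AnalyticAt ℝ (fun z : (Fin 2 → ℝ) × (ℝ × ℝ) => G (z.1 1, z.2)) (x, ε) :=
    (h.analytic (x 1, ε) ⟨trivial, hε⟩).comp_of_eq
      ((analyticAt_apply analyticAt_fst 1).prod analyticAt_snd) rfl
  exact (analyticAt_mul (analyticAt_rotVertical (analyticAt_torusAngle (h.analytic_angle ε hε)))
    (analyticAt_prod_fst hG)).prod (analyticAt_prod_snd hG)

theorem exists_hasDerivAt_rotTorus (h : IsTrajectoryFamily I ρ E G θ K U) (hε : ε ∈ E)
    {y : ℝ → Fin 2 → ℝ} {v : Fin 2 → ℝ} {t : ℝ} (hy : HasDerivAt y v t) {z : Mat × Vec}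
    (hz : z = rotTorus G θ (y t, ε)) : ∃ ω' : Vec, DynamicalEq I ρ (vert z.1) z.2 ω' ∧
      HasDerivAt (fun t => rotTorus G θ (y t, ε))
        (z.1 * hat ((2 * Real.pi * (v 0 - θ ε * v 1)) • vert z.1 + (v 1 * K ε) • z.2),
          (v 1 * K ε) • ω') t := by
  subst hz
  rw [hasDerivAt_pi] at hy
  obtain ⟨ω', hvel, hdyn⟩ := h.velocity (y t 1) ε hε
  have hG : HasDerivAt (fun t => G (y t 1, ε)) ((v 1 * K ε) • ((G (y t 1, ε)).1 *
      hat (G (y t 1, ε)).2), (v 1 * K ε) • ω') t :=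
    (HasDerivAt.scomp t (g₁ := fun x => G (x, ε)) (h := fun t => y t 1) hvel (hy 1)).congr_deriv
      (by simp only [Prod.smul_mk, mul_smul])
  have hangle : HasDerivAt (fun t => torusAngle θ (y t, ε)) (v 0 - θ ε * v 1) t :=
    (hy 0).sub ((hy 1).const_mul (θ ε))
  rw [vert_rotTorus]
  exact ⟨ω', hdyn, (hasDerivAt_rotVertical_mul hangle (hasDerivAt_prod_fst hG)
    (h.mem_levelSet _ ε hε).1).prodMk (hasDerivAt_prod_snd hG)⟩

theorem immersion_rotTorus (h : IsTrajectoryFamily I ρ E G θ K U) (x : Fin 2 → ℝ) (hε : ε ∈ E) :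
    Function.Injective (fderiv ℝ (rotTorus G θ) (x, ε)) := by
  rw [injective_iff_map_eq_zero]
  rintro ⟨v, δ⟩ hker
  have hdiff := (h.analytic_rotTorus (x, ε) ⟨trivial, hε⟩).differentiableAt
  obtain rfl : δ = 0 := by
    refine snd_eq_zero_of_fderiv_eq_zero hdiff
      (analyticAt_momentEnergy I ρ _).differentiableAt ?_ hker
    filter_upwards [continuousAt_snd.eventually (h.isOpen_param.mem_nhds hε)] with z hz
    exact h.momentEnergy_rotTorus z.1 hz
  have hline := hasDerivAt_add_smul x v 0
  have hzero : HasDerivAt (fun t : ℝ => rotTorus G θ (x + t • v, ε)) (0, 0) 0 :=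
    (hdiff.hasFDerivAt.comp_hasDerivAt_of_eq 0 (hline.prodMk (hasDerivAt_const _ ε))
      (by simp)).congr_deriv hker
  obtain ⟨ω', -, hderiv⟩ := h.exists_hasDerivAt_rotTorus hε hline rfl
  have hspin := eq_zero_of_mul_hat_eq_zero (h.rotTorus_mem_levelSet _ hε).1
    (Prod.mk.inj (hderiv.unique hzero)).1
  obtain ⟨hangle, htime⟩ := eq_zero_of_smul_add_smul_eq_zero
    (by rw [vert_rotTorus]; exact h.cross_ne_zero _ ε hε) hspin
  have hv₁ : v 1 = 0 := (mul_eq_zero.1 htime).resolve_right (h.period_ne_zero ε hε)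
  have hv₀ : v 0 = 0 := by
    rw [hv₁, mul_zero, sub_zero] at hangle
    exact (mul_eq_zero.1 hangle).resolve_left Real.two_pi_pos.ne'
  exact Prod.ext (funext (Fin.forall_fin_two.2 ⟨hv₀, hv₁⟩)) rfl

theorem isRotSolution (h : IsTrajectoryFamily I ρ E G θ K U) (x : Fin 2 → ℝ) (hε : ε ∈ E) :
    IsRotSolution I ρ fun t => rotTorus G θ (x + t • torusFrequency θ K ε, ε) := by
  intro t
  obtain ⟨ω', hdyn, hderiv⟩ :=
    h.exists_hasDerivAt_rotTorus hε (hasDerivAt_add_smul x (torusFrequency θ K ε) t) rfl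
  refine ⟨(h.rotTorus_mem_levelSet _ hε).1, ω', hderiv.congr_deriv ?_, hdyn⟩
  have hslope : torusFrequency θ K ε 0 - θ ε * torusFrequency θ K ε 1 = 0 := sub_self _
  have hspeed : torusFrequency θ K ε 1 * K ε = 1 := inv_mul_cancel₀ (h.period_ne_zero ε hε)
  rw [hslope, hspeed, mul_zero, zero_smul, zero_add, one_smul, one_smul]

theorem exists_rotTorus_eq (hB : IsInertiaInverse I ρ B) (h : IsTrajectoryFamily I ρ E G θ K U)
    (hε : ε ∈ E) {z : Mat × Vec} (hz : z ∈ levelSet I ρ (ε.1 • e₃) ε.2) (hzU : vert z.1 ∈ U) :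
    ∃ x, rotTorus G θ (x, ε) = z := by
  obtain ⟨s, hs⟩ := h.surjective ε hε z hz hzU
  obtain ⟨y, hy⟩ := exists_eq_rotState_of_vert_eq hB hz (h.mem_levelSet s ε hε) hs
  exact ⟨![y + θ ε * s, s], by simp [hy, rotTorus, torusAngle]⟩

theorem image_rotTorus (hB : IsInertiaInverse I ρ B) (h : IsTrajectoryFamily I ρ E G θ K U) :
    rotTorus G θ '' (Set.univ ×ˢ E) =
      {z | momentEnergy I ρ z ∈ E ∧ vert z.1 ∈ U} ∩ verticalRot I ρ := by
  ext z
  constructor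
  · rintro ⟨⟨x, ε⟩, ⟨-, hε⟩, rfl⟩
    refine ⟨⟨?_, ?_⟩, mem_verticalRot_of_mem_levelSet (h.rotTorus_mem_levelSet x hε)⟩
    · rwa [h.momentEnergy_rotTorus x hε]
    · rw [vert_rotTorus]
      exact h.mem_region _ ε hε
  · rintro ⟨⟨hz, hzU⟩, hzV⟩
    obtain ⟨x, hx⟩ := h.exists_rotTorus_eq hB hz (mem_levelSet_of_mem_verticalRot hzV) hzU
    exact ⟨(x, _), ⟨trivial, hz⟩, hx⟩

theorem isOpen_momentEnergy_region (h : IsTrajectoryFamily I ρ E G θ K U) :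
    IsOpen {z : Mat × Vec | momentEnergy I ρ z ∈ E ∧ vert z.1 ∈ U} :=
  (h.isOpen_param.preimage (continuous_momentEnergy I ρ)).inter
    (h.isOpen_region.preimage (continuous_vert.comp continuous_fst))

theorem analytic_torusFrequency (h : IsTrajectoryFamily I ρ E G θ K U) :
    AnalyticOnNhd ℝ (torusFrequency θ K) E := by
  intro ε hε
  have hK := (h.analytic_period ε hε).fun_inv (h.period_ne_zero ε hε)
  exact AnalyticAt.pi (f := fun i ε => torusFrequency θ K ε i)
    (Fin.forall_fin_two.2 ⟨(h.analytic_angle ε hε).mul hK, hK⟩)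

theorem isQuasiperiodicFamily_rot (hB : IsInertiaInverse I ρ B)
    (h : IsTrajectoryFamily I ρ E G θ K U) :
    IsQuasiperiodicFamily (verticalRot I ρ) (IsRotSolution I ρ) E (rotTorus G θ)
      (torusFrequency θ K) where
  isOpen_param := h.isOpen_param
  analytic_map := h.analytic_rotTorus
  analytic_freq := h.analytic_torusFrequency
  eq_iff x y _ hε _ hδ := h.rotTorus_eq_iff x y hε hδ
  immersion x _ hε := h.immersion_rotTorus x hε
  isOpen_image := ⟨_, h.isOpen_momentEnergy_region, h.image_rotTorus hB⟩
  motion x _ hε := h.isRotSolution x hε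

end IsTrajectoryFamily

end Torus

/-! ### Motion of the contact point -/

/-- The rotation of the horizontal plane by the angle `2 π y`. -/
noncomputable def rotPlane (y : ℝ) : Matrix (Fin 2) (Fin 2) ℝ :=
  !![Real.cos (2 * Real.pi * y), -Real.sin (2 * Real.pi * y);
    Real.sin (2 * Real.pi * y), Real.cos (2 * Real.pi * y)]

/-- The solution `b` of the linear equation `b + W = rotPlane y *ᵥ b`, which exists unless `y` is an
integer. -/
noncomputable def rotationOffset (y : ℝ) (W : Plane) : Plane :=
  (2 - 2 * Real.cos (2 * Real.pi * y))⁻¹ • ((rotPlane (-y) - 1) *ᵥ W)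

section Plane

theorem rotPlane_add (x y : ℝ) : rotPlane (x + y) = rotPlane x * rotPlane y := by
  simp only [rotPlane, mul_add, Real.cos_add, Real.sin_add, mul_fin_two]
  ring_nf

theorem rotPlane_add_mulVec (x y : ℝ) (p : Plane) :
    rotPlane (x + y) *ᵥ p = rotPlane x *ᵥ (rotPlane y *ᵥ p) := by
  rw [rotPlane_add, mulVec_mulVec]

theorem rotPlane_int (n : ℤ) : rotPlane n = 1 := by
  have hcos : Real.cos (2 * Real.pi * n) = 1 := cos_two_pi_mul_eq_one_iff.2 ⟨n, rfl⟩
  have hsin : Real.sin (2 * Real.pi * n) = 0 :=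
    Real.sin_eq_zero_iff.2 ⟨2 * n, by push_cast; ring⟩
  rw [rotPlane, hcos, hsin, neg_zero, one_fin_two]

theorem rotPlane_zero : rotPlane 0 = 1 := by
  simpa using rotPlane_int 0

theorem rotPlane_sub_one_mul (y : ℝ) :
    (rotPlane y - 1) * (rotPlane (-y) - 1) =
      (2 - 2 * Real.cos (2 * Real.pi * y)) • (1 : Matrix (Fin 2) (Fin 2) ℝ) := by
  have hinv : rotPlane y * rotPlane (-y) = 1 := by
    rw [← rotPlane_add, add_neg_cancel, rotPlane_zero]
  have hsum : rotPlane y + rotPlane (-y) =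
      (2 * Real.cos (2 * Real.pi * y)) • (1 : Matrix (Fin 2) (Fin 2) ℝ) := by
    ext i j
    fin_cases i <;> fin_cases j <;> simp [rotPlane, two_mul]
  calc (rotPlane y - 1) * (rotPlane (-y) - 1)
      = rotPlane y * rotPlane (-y) - (rotPlane y + rotPlane (-y)) + 1 := by noncomm_ring
    _ = (2 - 2 * Real.cos (2 * Real.pi * y)) • (1 : Matrix (Fin 2) (Fin 2) ℝ) := by
        rw [hinv, hsum, sub_smul, two_smul]
        abel

theorem rotationOffset_add {y : ℝ} (hy : Real.cos (2 * Real.pi * y) ≠ 1) (W : Plane) :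
    rotationOffset y W + W = rotPlane y *ᵥ rotationOffset y W := by
  have hne : 2 - 2 * Real.cos (2 * Real.pi * y) ≠ 0 := fun h => hy (by linarith)
  have hsolve : (rotPlane y - 1) *ᵥ rotationOffset y W = W := by
    rw [rotationOffset, mulVec_smul, mulVec_mulVec, rotPlane_sub_one_mul, smul_mulVec, one_mulVec,
      inv_smul_smul₀ hne]
  rw [sub_mulVec, one_mulVec, sub_eq_iff_eq_add'] at hsolve
  exact hsolve.symm

theorem contactVelocity_eq (r : ℝ) (A : Mat) (ω : Vec) :
    contactVelocity r A ω = ![r * (A *ᵥ ω) 1, -(r * (A *ᵥ ω) 0)] := by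
  ext i
  fin_cases i <;> simp [contactVelocity, cross_apply, e₃]

theorem contactVelocity_rotVertical_mul (r y : ℝ) (A : Mat) (ω : Vec) :
    contactVelocity r (rotVertical y * A) ω = rotPlane y *ᵥ contactVelocity r A ω := by
  rw [contactVelocity_eq, contactVelocity_eq, ← mulVec_mulVec]
  generalize A *ᵥ ω = x
  ext i
  fin_cases i <;>
    simp [rotPlane, rotVertical, mulVec, dotProduct, Fin.sum_univ_three] <;> ring

variable {X : Type*} [NormedAddCommGroup X] [NormedSpace ℝ X] {x : X}

theorem analyticAt_rotPlane {y : X → ℝ} (hy : AnalyticAt ℝ y x) :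
    AnalyticAt ℝ (fun x => rotPlane (y x)) x := by
  have hangle : AnalyticAt ℝ (fun x => 2 * Real.pi * y x) x := analyticAt_const.mul hy
  have hcos : AnalyticAt ℝ (fun x => Real.cos (2 * Real.pi * y x)) x :=
    Real.analyticAt_cos.comp_of_eq hangle rfl
  have hsin : AnalyticAt ℝ (fun x => Real.sin (2 * Real.pi * y x)) x :=
    Real.analyticAt_sin.comp_of_eq hangle rfl
  rw [analyticAt_matrix_iff]
  exact Fin.forall_fin_two.2
    ⟨Fin.forall_fin_two.2 ⟨hcos, hsin.neg⟩, Fin.forall_fin_two.2 ⟨hsin, hcos⟩⟩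

theorem analyticAt_rotationOffset {y : X → ℝ} {W : X → Plane} (hy : AnalyticAt ℝ y x)
    (hW : AnalyticAt ℝ W x) (hne : Real.cos (2 * Real.pi * y x) ≠ 1) :
    AnalyticAt ℝ (fun x => rotationOffset (y x) (W x)) x := by
  have hcos : AnalyticAt ℝ (fun x => Real.cos (2 * Real.pi * y x)) x :=
    Real.analyticAt_cos.comp_of_eq (analyticAt_const.mul hy) rfl
  exact ((analyticAt_const.fun_sub (analyticAt_const.fun_mul hcos)).fun_inv
    fun h => hne (by linarith)).fun_smul
      (analyticAt_mulVec ((analyticAt_rotPlane hy.neg).sub analyticAt_const) hW)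

theorem analyticAt_contactVelocity (r : ℝ) {A : X → Mat} {ω : X → Vec} (hA : AnalyticAt ℝ A x)
    (hω : AnalyticAt ℝ ω x) : AnalyticAt ℝ (fun x => contactVelocity r (A x) (ω x)) x := by
  have hAω := analyticAt_mulVec hA hω
  simp only [contactVelocity_eq]
  exact AnalyticAt.pi (f := fun i x => (![r * (A x *ᵥ ω x) 1, -(r * (A x *ᵥ ω x) 0)] : Plane) i)
    (Fin.forall_fin_two.2 ⟨analyticAt_const.mul (analyticAt_apply hAω 1),
      (analyticAt_const.mul (analyticAt_apply hAω 0)).neg⟩)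

end Plane

section Translates

variable {n : ℕ} {Φ : (Fin n → ℝ) × (ℝ × ℝ) → Mat × Vec × Plane} {x : Fin n → ℝ} {ε : ℝ × ℝ}

theorem analyticAt_translates (hΦ : AnalyticAt ℝ Φ (x, ε)) (c : Plane) :
    AnalyticAt ℝ (translates Φ) (x, ε, c) :=
  (hΦ.comp_of_eq (f := fun z : (Fin n → ℝ) × ((ℝ × ℝ) × Plane) => (z.1, z.2.1))
    (analyticAt_fst.prod (analyticAt_prod_fst analyticAt_snd)) rfl).add
      (analyticAt_const.prod (analyticAt_const.prod (analyticAt_prod_snd analyticAt_snd)))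

theorem fderiv_translates_apply (hΦ : DifferentiableAt ℝ Φ (x, ε)) (c : Plane) (dx : Fin n → ℝ)
    (dε : ℝ × ℝ) (dc : Plane) : fderiv ℝ (translates Φ) (x, ε, c) (dx, dε, dc) =
      fderiv ℝ Φ (x, ε) (dx, dε) + (0, 0, dc) := by
  have hproj : HasFDerivAt (fun z : (Fin n → ℝ) × ((ℝ × ℝ) × Plane) => (z.1, z.2.1))
      ((ContinuousLinearMap.fst ℝ _ _).prod
        ((ContinuousLinearMap.fst ℝ _ _).comp (ContinuousLinearMap.snd ℝ _ _))) (x, ε, c) :=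
    hasFDerivAt_fst.prodMk (hasFDerivAt_fst.comp _ hasFDerivAt_snd)
  have htranslation : HasFDerivAt
      (fun z : (Fin n → ℝ) × ((ℝ × ℝ) × Plane) => ((0, 0, z.2.2) : Mat × Vec × Plane))
      (ContinuousLinearMap.prod 0 (ContinuousLinearMap.prod 0
        ((ContinuousLinearMap.snd ℝ _ _).comp (ContinuousLinearMap.snd ℝ _ _)))) (x, ε, c) :=
    (hasFDerivAt_const _ _).prodMk ((hasFDerivAt_const _ _).prodMk
      (hasFDerivAt_snd.comp _ hasFDerivAt_snd))
  have hsum : HasFDerivAt (translates Φ) _ (x, ε, c) :=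
    (HasFDerivAt.comp (x, ε, c) (g := Φ) hΦ.hasFDerivAt hproj).add htranslation
  rw [hsum.fderiv]
  rfl

end Translates

/-- The tori swept out by the rotations of a family of trajectories with contact points `σ`. -/
noncomputable def fullTorus (G : ℝ × (ℝ × ℝ) → Mat × Vec) (θ : ℝ × ℝ → ℝ)
    (σ : ℝ × (ℝ × ℝ) → Plane) : (Fin 2 → ℝ) × (ℝ × ℝ) → Mat × Vec × Plane :=
  fun z => ((rotTorus G θ z).1, (rotTorus G θ z).2, rotPlane (torusAngle θ z) *ᵥ σ (z.1 1, z.2))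

/-- `σ` describes the motion of the contact point along a family of trajectories, rotated together
with the trajectory after one period. -/
structure IsContactFamily (r : ℝ) (E : Set (ℝ × ℝ)) (G : ℝ × (ℝ × ℝ) → Mat × Vec)
    (θ K : ℝ × ℝ → ℝ) (σ : ℝ × (ℝ × ℝ) → Plane) : Prop where
  analytic : AnalyticOnNhd ℝ σ (Set.univ ×ˢ E)
  add_one : ∀ x, ∀ ε ∈ E, σ (x + 1, ε) = rotPlane (θ ε) *ᵥ σ (x, ε)
  velocity : ∀ x, ∀ ε ∈ E, HasDerivAt (fun x => σ (x, ε))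
    (K ε • contactVelocity r (G (x, ε)).1 (G (x, ε)).2) x

section Contact

variable {I : Mat} {ρ m r : ℝ} {B : Mat} {E : Set (ℝ × ℝ)} {G : ℝ × (ℝ × ℝ) → Mat × Vec}
  {θ K : ℝ × ℝ → ℝ} {σ : ℝ × (ℝ × ℝ) → Plane} {U : Set Vec} {ε : ℝ × ℝ}

theorem fst_translates_fullTorus (x : Fin 2 → ℝ) (ε : ℝ × ℝ) (c : Plane) :
    ((translates (fullTorus G θ σ) (x, ε, c)).1, (translates (fullTorus G θ σ) (x, ε, c)).2.1) =
      rotTorus G θ (x, ε) := by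
  simp [translates, fullTorus]

theorem snd_translates_fullTorus (x : Fin 2 → ℝ) (ε : ℝ × ℝ) (c : Plane) :
    (translates (fullTorus G θ σ) (x, ε, c)).2.2 =
      rotPlane (torusAngle θ (x, ε)) *ᵥ σ (x 1, ε) + c :=
  rfl

theorem IsTrajectoryFamily.exists_isContactFamily (h : IsTrajectoryFamily I ρ E G θ K U) (r : ℝ)
    (hθ : ∀ ε ∈ E, Real.cos (2 * Real.pi * θ ε) ≠ 1) : ∃ σ, IsContactFamily r E G θ K σ := by
  let w : ℝ × (ℝ × ℝ) → Plane := fun z => K z.2 • contactVelocity r (G z).1 (G z).2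
  have hw : AnalyticOnNhd ℝ w (Set.univ ×ˢ E) := fun z hz =>
    ((h.analytic_period z.2 hz.2).comp_of_eq analyticAt_snd rfl).fun_smul
      (analyticAt_contactVelocity r (analyticAt_prod_fst (h.analytic z hz))
        (analyticAt_prod_snd (h.analytic z hz)))
  have hw_add_one : ∀ x, ∀ ε ∈ E, w (x + 1, ε) = rotPlane (θ ε) *ᵥ w (x, ε) := fun x ε hε => by
    simp only [w, h.add_one x ε hε, rotState, contactVelocity_rotVertical_mul, mulVec_smul]
  let drift : ℝ × (ℝ × ℝ) → Plane := fun z => ∫ s in (0 : ℝ)..z.1, w (s, z.2)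
  have hdrift : AnalyticOnNhd ℝ drift (Set.univ ×ˢ E) := analyticOnNhd_primitive h.isOpen_param hw
  let offset : ℝ × ℝ → Plane := fun ε => rotationOffset (θ ε) (drift (1, ε))
  have hoffset : AnalyticOnNhd ℝ offset E := fun ε hε =>
    analyticAt_rotationOffset (h.analytic_angle ε hε)
      ((hdrift (1, ε) ⟨trivial, hε⟩).comp_of_eq (f := fun ε => ((1 : ℝ), ε))
        (analyticAt_const.prod analyticAt_id) rfl) (hθ ε hε)
  have hvel : ∀ x, ∀ ε ∈ E, HasDerivAt (fun x => offset ε + drift (x, ε)) (w (x, ε)) x :=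
    fun x ε hε => (hasDerivAt_primitive hw hε x).const_add (offset ε)
  refine ⟨fun z => offset z.2 + drift z, fun z hz =>
    ((hoffset z.2 hz.2).comp_of_eq analyticAt_snd rfl).fun_add (hdrift z hz), ?_, hvel⟩
  intro x ε hε
  have hconst : ∀ x, HasDerivAt (fun x => (offset ε + drift (x + 1, ε)) -
      rotPlane (θ ε) *ᵥ (offset ε + drift (x, ε))) 0 x := fun x =>
    (((hvel (x + 1) ε hε).comp_add_const x 1).sub
      (hasDerivAt_const_mulVec (rotPlane (θ ε)) (hvel x ε hε))).congr_deriv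
        (by rw [hw_add_one x ε hε, sub_self])
  have hdrift_zero : drift (0, ε) = 0 := intervalIntegral.integral_same
  have hinit : offset ε + drift (0 + 1, ε) = rotPlane (θ ε) *ᵥ (offset ε + drift (0, ε)) := by
    rw [hdrift_zero, add_zero, zero_add]
    exact rotationOffset_add (hθ ε hε) (drift (1, ε))
  exact sub_eq_zero.1 ((eq_of_hasDerivAt_zero hconst x 0).trans (sub_eq_zero.2 hinit))

theorem IsTrajectoryFamily.exists_translates_eq (hB : IsInertiaInverse I ρ B)
    (h : IsTrajectoryFamily I ρ E G θ K U) (hε : ε ∈ E) {z : Mat × Vec × Plane}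
    (hz : (z.1, z.2.1) ∈ levelSet I ρ (ε.1 • e₃) ε.2) (hzU : vert z.1 ∈ U) :
    ∃ x c, translates (fullTorus G θ σ) (x, ε, c) = z := by
  obtain ⟨x, hx⟩ := h.exists_rotTorus_eq hB hε hz hzU
  exact ⟨x, z.2.2 - rotPlane (torusAngle θ (x, ε)) *ᵥ σ (x 1, ε),
    Prod.ext (by simp [translates, fullTorus, hx]) (Prod.ext (by simp [translates, fullTorus, hx])
      (add_sub_cancel _ _))⟩

theorem IsTrajectoryFamily.image_translates (hB : IsInertiaInverse I ρ B)
    (h : IsTrajectoryFamily I ρ E G θ K U) :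
    translates (fullTorus G θ σ) '' (Set.univ ×ˢ (E ×ˢ Set.univ)) =
      (fun z : Mat × Vec × Plane => (z.1, z.2.1)) ⁻¹'
        {z | momentEnergy I ρ z ∈ E ∧ vert z.1 ∈ U} ∩ verticalFull I ρ := by
  ext z
  constructor
  · rintro ⟨⟨x, ε, c⟩, ⟨-, hε, -⟩, rfl⟩
    have hmem : rotTorus G θ (x, ε) ∈ rotTorus G θ '' (Set.univ ×ˢ E) := ⟨_, ⟨trivial, hε⟩, rfl⟩
    rwa [h.image_rotTorus hB, ← fst_translates_fullTorus (σ := σ) x ε c] at hmem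
  · rintro ⟨⟨hz, hzU⟩, hzV⟩
    obtain ⟨x, c, hx⟩ := h.exists_translates_eq hB (σ := σ) hz
      (mem_levelSet_of_mem_verticalRot hzV) hzU
    exact ⟨(x, _, c), ⟨trivial, hz, trivial⟩, hx⟩

namespace IsContactFamily

theorem add_int (hσ : IsContactFamily r E G θ K σ) (x : ℝ) (hε : ε ∈ E) (n : ℤ) :
    σ (x + n, ε) = rotPlane (θ ε * n) *ᵥ σ (x, ε) :=
  apply_add_int_of_apply_add_one (R := fun y p => rotPlane y *ᵥ p) rotPlane_add_mulVec
    (fun p => by rw [rotPlane_zero, one_mulVec]) (f := fun x => σ (x, ε))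
    (fun x => hσ.add_one x ε hε) x n

theorem rotPlane_mulVec_eq (hσ : IsContactFamily r E G θ K σ) {x y : Fin 2 → ℝ} (hε : ε ∈ E)
    (hxy : ∃ k : Fin 2 → ℤ, ∀ i, x i = y i + k i) :
    rotPlane (torusAngle θ (x, ε)) *ᵥ σ (x 1, ε) =
      rotPlane (torusAngle θ (y, ε)) *ᵥ σ (y 1, ε) := by
  obtain ⟨k, hk⟩ := hxy
  have hangle : torusAngle θ (x, ε) + θ ε * k 1 = torusAngle θ (y, ε) + k 0 := by
    simp only [torusAngle, hk]
    ring
  rw [hk 1, hσ.add_int (y 1) hε, ← rotPlane_add_mulVec, hangle, rotPlane_add, rotPlane_int,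
    Matrix.mul_one]

theorem analytic_fullTorus (hσ : IsContactFamily r E G θ K σ)
    (h : IsTrajectoryFamily I ρ E G θ K U) :
    AnalyticOnNhd ℝ (fullTorus G θ σ) (Set.univ ×ˢ E) := by
  rintro ⟨x, ε⟩ ⟨-, hε⟩
  have hrot := h.analytic_rotTorus (x, ε) ⟨trivial, hε⟩
  have hcontact : AnalyticAt ℝ (fun z : (Fin 2 → ℝ) × (ℝ × ℝ) => σ (z.1 1, z.2)) (x, ε) :=
    (hσ.analytic (x 1, ε) ⟨trivial, hε⟩).comp_of_eq
      ((analyticAt_apply analyticAt_fst 1).prod analyticAt_snd) rfl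
  exact (analyticAt_prod_fst hrot).prod ((analyticAt_prod_snd hrot).prod
    (analyticAt_mulVec (analyticAt_rotPlane (analyticAt_torusAngle (h.analytic_angle ε hε)))
      hcontact))

theorem translates_eq_iff (hσ : IsContactFamily r E G θ K σ)
    (h : IsTrajectoryFamily I ρ E G θ K U) (x y : Fin 2 → ℝ) {ε δ : (ℝ × ℝ) × Plane}
    (hε : ε.1 ∈ E) (hδ : δ.1 ∈ E) :
    translates (fullTorus G θ σ) (x, ε) = translates (fullTorus G θ σ) (y, δ) ↔
      ε = δ ∧ ∃ k : Fin 2 → ℤ, ∀ i, x i = y i + k i := by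
  obtain ⟨ε, c⟩ := ε
  obtain ⟨δ, d⟩ := δ
  rw [Prod.ext_iff, Prod.ext_iff, ← and_assoc, ← Prod.mk.injEq, fst_translates_fullTorus,
    fst_translates_fullTorus, snd_translates_fullTorus, snd_translates_fullTorus,
    h.rotTorus_eq_iff x y hε hδ, Prod.mk.injEq, ← Prod.ext_iff]
  constructor
  · rintro ⟨⟨rfl, hxy⟩, hcontact⟩
    rw [hσ.rotPlane_mulVec_eq hε hxy] at hcontact
    exact ⟨Prod.ext rfl (add_left_cancel hcontact), hxy⟩
  · rintro ⟨heq, hxy⟩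
    obtain ⟨rfl, rfl⟩ := Prod.mk.inj heq
    exact ⟨⟨rfl, hxy⟩, by rw [hσ.rotPlane_mulVec_eq hε hxy]⟩

theorem immersion_translates (hσ : IsContactFamily r E G θ K σ)
    (h : IsTrajectoryFamily I ρ E G θ K U) (x : Fin 2 → ℝ) {ε : (ℝ × ℝ) × Plane} (hε : ε.1 ∈ E) :
    Function.Injective (fderiv ℝ (translates (fullTorus G θ σ)) (x, ε)) := by
  obtain ⟨ε, c⟩ := ε
  rw [injective_iff_map_eq_zero]
  rintro ⟨dx, dε, dc⟩ hker
  have hfull := (hσ.analytic_fullTorus h (x, ε) ⟨trivial, hε⟩).differentiableAt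
  have hrot : HasFDerivAt (rotTorus G θ) _ (x, ε) :=
    (hasFDerivAt_fst (𝕜 := ℝ).comp (x, ε) hfull.hasFDerivAt).prodMk
      ((hasFDerivAt_fst (𝕜 := ℝ).comp _ hasFDerivAt_snd).comp (x, ε) hfull.hasFDerivAt)
  rw [fderiv_translates_apply hfull] at hker
  obtain ⟨hA, hωp⟩ := Prod.mk.inj hker
  obtain ⟨hω, hp⟩ := Prod.mk.inj hωp
  have hzero : ((dx, dε) : (Fin 2 → ℝ) × (ℝ × ℝ)) = 0 := by
    refine (injective_iff_map_eq_zero _).1 (h.immersion_rotTorus x hε) _ ?_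
    rw [hrot.fderiv]
    exact Prod.ext ((add_zero _).symm.trans hA) ((add_zero _).symm.trans hω)
  obtain ⟨rfl, rfl⟩ := Prod.mk.inj hzero
  have hc : (fderiv ℝ (fullTorus G θ σ) (x, ε) 0).2.2 + dc = 0 := hp
  rw [map_zero] at hc
  obtain rfl : dc = 0 := (zero_add dc).symm.trans hc
  rfl

theorem isFullSolution (hσ : IsContactFamily r E G θ K σ)
    (h : IsTrajectoryFamily I (m * r ^ 2) E G θ K U) (x : Fin 2 → ℝ) {ε : (ℝ × ℝ) × Plane}
    (hε : ε.1 ∈ E) : IsFullSolution I m r fun t =>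
      translates (fullTorus G θ σ) (x + t • torusFrequency θ K ε.1, ε) := by
  obtain ⟨ε, c⟩ := ε
  intro t
  obtain ⟨hA, ω', hderiv, hdyn⟩ := h.isRotSolution x hε t
  have htime : HasDerivAt (fun t : ℝ => x 1 + t * (K ε)⁻¹) (K ε)⁻¹ t :=
    hasDerivAt_add_smul (x 1) (K ε)⁻¹ t
  have hpath : HasDerivAt (fun t : ℝ => σ (x 1 + t * (K ε)⁻¹, ε))
      (contactVelocity r (G (x 1 + t * (K ε)⁻¹, ε)).1 (G (x 1 + t * (K ε)⁻¹, ε)).2) t :=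
    ((hσ.velocity _ ε hε).scomp t htime).congr_deriv (inv_smul_smul₀ (h.period_ne_zero ε hε) _)
  have hcontact : HasDerivAt (fun t : ℝ =>
      (translates (fullTorus G θ σ) (x + t • torusFrequency θ K ε, ε, c)).2.2)
      (contactVelocity r (rotTorus G θ (x + t • torusFrequency θ K ε, ε)).1
        (rotTorus G θ (x + t • torusFrequency θ K ε, ε)).2) t := by
    simp only [snd_translates_fullTorus, torusAngle_line]
    rw [rotTorus_line, rotState, contactVelocity_rotVertical_mul]
    exact (hasDerivAt_const_mulVec _ hpath).add_const c
  simp only [← fst_translates_fullTorus (σ := σ) _ ε c] at hA hderiv hdyn hcontact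
  exact ⟨hA, ω', (hasDerivAt_prod_fst hderiv).prodMk ((hasDerivAt_prod_snd hderiv).prodMk hcontact),
    hdyn⟩

theorem isQuasiperiodicFamily_full (hB : IsInertiaInverse I (m * r ^ 2) B)
    (hσ : IsContactFamily r E G θ K σ) (h : IsTrajectoryFamily I (m * r ^ 2) E G θ K U) :
    IsQuasiperiodicFamily (verticalFull I (m * r ^ 2)) (IsFullSolution I m r) (E ×ˢ Set.univ)
      (translates (fullTorus G θ σ)) (fun δ => torusFrequency θ K δ.1) where
  isOpen_param := h.isOpen_param.prod isOpen_univ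
  analytic_map := by
    rintro ⟨x, ε, c⟩ ⟨-, hε, -⟩
    exact analyticAt_translates (hσ.analytic_fullTorus h (x, ε) ⟨trivial, hε⟩) c
  analytic_freq δ hδ := (h.analytic_torusFrequency δ.1 hδ.1).comp_of_eq analyticAt_fst rfl
  eq_iff x y _ hε _ hδ := hσ.translates_eq_iff h x y hε.1 hδ.1
  immersion x _ hε := hσ.immersion_translates h x hε.1
  isOpen_image :=
    ⟨_, h.isOpen_momentEnergy_region.preimage (by fun_prop), h.image_translates hB⟩
  motion x _ hε := hσ.isFullSolution h x hε.1

end IsContactFamily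

end Contact

/-! ### Lifting level curves to trajectories -/

/-- The matrix with rows `q`, `u × q`, `u`. For orthonormal `u`, `q` it is the rotation whose
inverse takes the vertical to `u` and the first unit vector to `q`. -/
def frameOf (u q : Vec) : Mat := Matrix.of ![q, u ⨯₃ q, u]

/-- The unit vector in the direction of `m`. -/
noncomputable def unitOf (m : Vec) : Vec := (√(m ⬝ᵥ m))⁻¹ • m

/-- The angular velocity about the vertical of the frame `levelFrame B u` relative to the body, when
`u` moves along a level curve with velocity `κ u × B u`. -/
noncomputable def frameRate (B : Mat) (κ : ℝ) (u : Vec) : ℝ :=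
  κ * ((B *ᵥ (u ⨯₃ (B *ᵥ u))) ⬝ᵥ (u ⨯₃ (B *ᵥ u))) *
    ((u ⨯₃ (B *ᵥ u)) ⬝ᵥ (u ⨯₃ (B *ᵥ u)))⁻¹

/-- The frame formed by `u` and the tangent direction at `u` of the level curve of `⟨u, B u⟩`. -/
noncomputable def levelFrame (B : Mat) (u : Vec) : Mat := frameOf u (unitOf (u ⨯₃ (B *ᵥ u)))

section Frame

variable {X : Type*} [NormedAddCommGroup X] [NormedSpace ℝ X] {x : X}

theorem vert_frameOf (u q : Vec) : vert (frameOf u q) = u := by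
  ext i
  simp [vert, frameOf, e₃, mulVec, dotProduct, Fin.sum_univ_three]

theorem frameOf_mem_SO3 {u q : Vec} (hu : u ⬝ᵥ u = 1) (hq : q ⬝ᵥ q = 1) (huq : u ⬝ᵥ q = 0) :
    frameOf u q ∈ SO3 := by
  have hqu : q ⬝ᵥ u = 0 := by rw [dotProduct_comm, huq]
  have hcross : (u ⨯₃ q) ⬝ᵥ (u ⨯₃ q) = 1 := by rw [cross_dot_cross_self, hu, hq, huq]; norm_num
  have hucross : (u ⨯₃ q) ⬝ᵥ u = 0 := by rw [dotProduct_comm, dot_self_cross]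
  have hqcross : (u ⨯₃ q) ⬝ᵥ q = 0 := by rw [dotProduct_comm, dot_cross_self]
  refine ⟨mul_eq_one_comm.1 ?_, ?_⟩
  · ext i j
    change (![q, u ⨯₃ q, u] i) ⬝ᵥ (![q, u ⨯₃ q, u] j) = _
    fin_cases i <;> fin_cases j <;> simp [hu, hq, huq, hqu, hcross, hucross, hqcross]
  · change det ![q, u ⨯₃ q, u] = 1
    rw [← triple_product_eq_det, cross_cross_eq_smul_sub_smul, hu, hqu, one_smul, zero_smul,
      sub_zero, hq]

theorem analyticAt_frameOf {u q : X → Vec} (hu : AnalyticAt ℝ u x) (hq : AnalyticAt ℝ q x) :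
    AnalyticAt ℝ (fun x => frameOf (u x) (q x)) x := by
  rw [analyticAt_matrix_iff]
  intro i j
  fin_cases i
  · exact analyticAt_apply hq j
  · exact analyticAt_apply (analyticAt_cross hu hq) j
  · exact analyticAt_apply hu j

theorem cross_cross_add_cross_cross {R : Type*} [CommRing R] (u q w : Fin 3 → R) :
    (u ⨯₃ w) ⨯₃ q + u ⨯₃ (q ⨯₃ w) = (u ⨯₃ q) ⨯₃ w := by
  ext i
  fin_cases i <;> simp [cross_apply] <;> ring

theorem mul_hat_row (S : Mat) (w : Vec) (i : Fin 3) : (S * hat w) i = S i ⨯₃ w := by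
  ext j
  fin_cases j <;> simp [hat, Matrix.mul_apply, cross_apply, Fin.sum_univ_three] <;> ring

theorem hasDerivAt_frameOf {u q : ℝ → Vec} {w : Vec} {s : ℝ} (hu : HasDerivAt u (u s ⨯₃ w) s)
    (hq : HasDerivAt q (q s ⨯₃ w) s) :
    HasDerivAt (fun s => frameOf (u s) (q s)) (frameOf (u s) (q s) * hat w) s := by
  have hcross : HasDerivAt (fun s => u s ⨯₃ q s) ((u s ⨯₃ q s) ⨯₃ w) s :=
    (hasDerivAt_cross hu hq).congr_deriv (cross_cross_add_cross_cross (u s) (q s) w)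
  rw [hasDerivAt_pi] at hu hq hcross
  rw [hasDerivAt_matrix_iff]
  intro i j
  rw [mul_hat_row]
  fin_cases i
  · exact hq j
  · exact hcross j
  · exact hu j

theorem dot_self_pos {m : Vec} (hm : m ≠ 0) : 0 < m ⬝ᵥ m :=
  (dot_self_nonneg m).lt_of_ne' (mt dotProduct_self_eq_zero.1 hm)

theorem unitOf_dot_unitOf {m : Vec} (hm : m ≠ 0) : unitOf m ⬝ᵥ unitOf m = 1 := by
  have hpos := dot_self_pos hm
  rw [unitOf, smul_dotProduct, dotProduct_smul, smul_eq_mul, smul_eq_mul, ← mul_assoc, ← mul_inv,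
    Real.mul_self_sqrt hpos.le, inv_mul_cancel₀ hpos.ne']

theorem dot_unitOf_cross (u v : Vec) : u ⬝ᵥ unitOf (u ⨯₃ v) = 0 := by
  rw [unitOf, dotProduct_smul, dot_self_cross, smul_zero]

theorem analyticAt_sqrt {f : X → ℝ} (hf : AnalyticAt ℝ f x) (hx : 0 < f x) :
    AnalyticAt ℝ (fun x => √(f x)) x :=
  ((Real.contDiffAt_sqrt (n := ⊤) hx.ne').analyticAt).comp_of_eq hf rfl

theorem analyticAt_unitOf {m : X → Vec} (hm : AnalyticAt ℝ m x) (hx : m x ≠ 0) :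
    AnalyticAt ℝ (fun x => unitOf (m x)) x :=
  ((analyticAt_sqrt (analyticAt_dot hm hm) (dot_self_pos hx)).fun_inv
    (Real.sqrt_pos.2 (dot_self_pos hx)).ne').fun_smul hm

theorem hasDerivAt_unitOf {m : ℝ → Vec} {w : Vec} {a s : ℝ}
    (hm : HasDerivAt m (m s ⨯₃ w + a • m s) s) (h0 : m s ≠ 0) :
    HasDerivAt (fun s => unitOf (m s)) (unitOf (m s) ⨯₃ w) s := by
  have hpos := dot_self_pos h0
  have hsq : HasDerivAt (fun s => m s ⬝ᵥ m s) (2 * (a * (m s ⬝ᵥ m s))) s := by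
    refine (hasDerivAt_dot hm hm).congr_deriv ?_
    rw [dotProduct_comm, ← two_mul, dotProduct_add, dot_self_cross, dotProduct_smul, zero_add,
      smul_eq_mul]
  have hnorm : HasDerivAt (fun s => (√(m s ⬝ᵥ m s))⁻¹) (-a * (√(m s ⬝ᵥ m s))⁻¹) s := by
    refine ((hsq.sqrt hpos.ne').fun_inv (Real.sqrt_pos.2 hpos).ne').congr_deriv ?_
    have hN : √(m s ⬝ᵥ m s) ≠ 0 := (Real.sqrt_pos.2 hpos).ne'
    field_simp
    rw [Real.sq_sqrt hpos.le]
  refine (hnorm.smul hm).congr_deriv ?_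
  rw [unitOf, LinearMap.map_smul₂, smul_add, smul_smul, mul_comm _ a, neg_mul, neg_smul,
    add_neg_cancel_right]

theorem dot_self_smul_cross {R : Type*} [CommRing R] {u m x : Fin 3 → R} (h : u ⬝ᵥ m = 0) :
    (m ⬝ᵥ m) • (u ⨯₃ x) = (m ⬝ᵥ (u ⨯₃ x)) • m + (x ⬝ᵥ m) • (u ⨯₃ m) := by
  simp only [dotProduct, Fin.sum_univ_three] at h
  ext i
  fin_cases i <;> simp only [cross_apply, dotProduct, Fin.sum_univ_three, Pi.add_apply,
    Pi.smul_apply, smul_eq_mul, cons_val, Fin.zero_eta, Fin.mk_one, Fin.reduceFinMk]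
  · linear_combination (m 1 * x 2 - m 2 * x 1) * h
  · linear_combination (m 2 * x 0 - m 0 * x 2) * h
  · linear_combination (m 0 * x 1 - m 1 * x 0) * h

theorem vert_levelFrame (B : Mat) (u : Vec) : vert (levelFrame B u) = u := vert_frameOf _ _

theorem levelFrame_mem_SO3 {B : Mat} {u : Vec} (hu : u ⬝ᵥ u = 1) (h : u ⨯₃ (B *ᵥ u) ≠ 0) :
    levelFrame B u ∈ SO3 :=
  frameOf_mem_SO3 hu (unitOf_dot_unitOf h) (dot_unitOf_cross _ _)

theorem analyticAt_frameRate (B : Mat) {κ : X → ℝ} {u : X → Vec} (hκ : AnalyticAt ℝ κ x)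
    (hu : AnalyticAt ℝ u x) (h0 : u x ⨯₃ (B *ᵥ u x) ≠ 0) :
    AnalyticAt ℝ (fun x => frameRate B (κ x) (u x)) x := by
  have hm := analyticAt_cross hu (analyticAt_const_mulVec B hu)
  exact (hκ.fun_mul (analyticAt_dot (analyticAt_const_mulVec B hm) hm)).fun_mul
    ((analyticAt_dot hm hm).fun_inv (dot_self_pos h0).ne')

theorem analyticAt_levelFrame (B : Mat) {u : X → Vec} (hu : AnalyticAt ℝ u x)
    (h0 : u x ⨯₃ (B *ᵥ u x) ≠ 0) : AnalyticAt ℝ (fun x => levelFrame B (u x)) x :=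
  analyticAt_frameOf hu (analyticAt_unitOf (analyticAt_cross hu (analyticAt_const_mulVec B hu)) h0)

theorem hasDerivAt_levelFrame {B : Mat} {u : ℝ → Vec} {κ k s : ℝ}
    (hu : HasDerivAt u (k • (u s ⨯₃ (κ • (B *ᵥ u s)))) s) (h0 : u s ⨯₃ (B *ᵥ u s) ≠ 0) :
    HasDerivAt (fun s => levelFrame B (u s))
      (k • (levelFrame B (u s) * hat (κ • (B *ᵥ u s) - frameRate B κ (u s) • u s))) s := by
  rw [← Matrix.mul_smul, ← hat_smul]
  have hm := hasDerivAt_cross hu (hasDerivAt_const_mulVec B hu)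
  refine hasDerivAt_frameOf (hu.congr_deriv ?_) (hasDerivAt_unitOf
    (a := k * κ * (u s ⨯₃ (B *ᵥ u s)) ⬝ᵥ (u s ⨯₃ (B *ᵥ (u s ⨯₃ (B *ᵥ u s)))) *
      ((u s ⨯₃ (B *ᵥ u s)) ⬝ᵥ (u s ⨯₃ (B *ᵥ u s)))⁻¹) (hm.congr_deriv ?_) h0)
  · simp only [map_smul, map_sub, cross_self, smul_zero, sub_zero]
  set m := u s ⨯₃ (B *ᵥ u s) with hmdef
  have hcross : u s ⨯₃ (B *ᵥ m) = (m ⬝ᵥ m)⁻¹ • ((m ⬝ᵥ (u s ⨯₃ (B *ᵥ m))) • m +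
      ((B *ᵥ m) ⬝ᵥ m) • (u s ⨯₃ m)) := by
    rw [← dot_self_smul_cross (dot_self_cross _ _), inv_smul_smul₀ (dot_self_pos h0).ne']
  simp only [← hmdef, frameRate, map_smul, map_sub, mulVec_smul, LinearMap.smul_apply]
  generalize m ⬝ᵥ (u s ⨯₃ (B *ᵥ m)) = a at hcross ⊢
  rw [hcross, ← cross_anticomm (u s) m]
  module

end Frame

/-- An analytic family of closed curves `s ↦ V (s, ε)` which parametrize the part in `U` of the
level curves on the sphere; `1 / k` is the velocity of the parameter `s`. -/
structure IsLevelCurve (ρ : ℝ) (B : Mat) (E : Set (ℝ × ℝ)) (V : ℝ × (ℝ × ℝ) → Vec)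
    (k : ℝ × (ℝ × ℝ) → ℝ) (U : Set Vec) : Prop where
  isOpen_param : IsOpen E
  isOpen_region : IsOpen U
  moment_ne_zero : ∀ ε ∈ E, ε.1 ≠ 0
  denom_pos : ∀ ε ∈ E, 0 < ε.1 ^ 2 + 2 * ρ * ε.2
  analytic : AnalyticOnNhd ℝ V (Set.univ ×ˢ E)
  analytic_slowness : AnalyticOnNhd ℝ k (Set.univ ×ˢ E)
  add_one : ∀ s ε, V (s + 1, ε) = V (s, ε)
  slowness_add_one : ∀ s ε, k (s + 1, ε) = k (s, ε)
  slowness_ne_zero : ∀ s, ∀ ε ∈ E, k (s, ε) ≠ 0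
  unit : ∀ s, ∀ ε ∈ E, V (s, ε) ⬝ᵥ V (s, ε) = 1
  level : ∀ s, ∀ ε ∈ E, V (s, ε) ⬝ᵥ (B *ᵥ V (s, ε)) = levelValue ρ ε
  velocity : ∀ s, ∀ ε ∈ E, HasDerivAt (fun s => V (s, ε))
    (k (s, ε) • (V (s, ε) ⨯₃ (levelFactor ρ ε • (B *ᵥ V (s, ε))))) s
  injective : ∀ ε ∈ E, ∀ s t, V (s, ε) = V (t, ε) → ∃ n : ℤ, s = t + n
  mem_region : ∀ s, ∀ ε ∈ E, V (s, ε) ∈ U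
  surjective : ∀ ε ∈ E, ∀ u : Vec, u ⬝ᵥ u = 1 → u ⬝ᵥ (B *ᵥ u) = levelValue ρ ε → u ∈ U →
    ∃ s, u = V (s, ε)
  cross_ne_zero : ∀ s, ∀ ε ∈ E, V (s, ε) ⨯₃ (B *ᵥ V (s, ε)) ≠ 0

/-- The derivative of `liftAngle` along a level curve. -/
noncomputable def liftRate (ρ : ℝ) (B : Mat) (V : ℝ × (ℝ × ℝ) → Vec) (k : ℝ × (ℝ × ℝ) → ℝ)
    (z : ℝ × (ℝ × ℝ)) : ℝ :=
  k z * frameRate B (levelFactor ρ z.2) (V z) * (2 * Real.pi)⁻¹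

/-- The rotation about the vertical, in turns, of the moving sphere relative to `levelFrame`. -/
noncomputable def liftAngle (ρ : ℝ) (B : Mat) (V : ℝ × (ℝ × ℝ) → Vec) (k : ℝ × (ℝ × ℝ) → ℝ)
    (z : ℝ × (ℝ × ℝ)) : ℝ :=
  ∫ s in (0 : ℝ)..z.1, liftRate ρ B V k (s, z.2)

/-- The lift of the level curves `V` to the rotational phase space. -/
noncomputable def levelLift (ρ : ℝ) (B : Mat) (V : ℝ × (ℝ × ℝ) → Vec) (k : ℝ × (ℝ × ℝ) → ℝ)
    (z : ℝ × (ℝ × ℝ)) : Mat × Vec :=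
  rotState (liftAngle ρ B V k z) (levelFrame B (V z), levelFactor ρ z.2 • (B *ᵥ V z))

section Lift

variable {I : Mat} {ρ : ℝ} {B : Mat} {E : Set (ℝ × ℝ)} {V : ℝ × (ℝ × ℝ) → Vec}
  {k : ℝ × (ℝ × ℝ) → ℝ} {U : Set Vec} {ε : ℝ × ℝ}

theorem analyticAt_levelFactor (ρ : ℝ) (hε : ε.1 ≠ 0) : AnalyticAt ℝ (levelFactor ρ) ε :=
  ((analyticAt_fst.fun_pow 2).fun_add (analyticAt_const.fun_mul analyticAt_snd)).fun_div
    analyticAt_fst hε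

theorem vert_levelLift (z : ℝ × (ℝ × ℝ)) : vert (levelLift ρ B V k z).1 = V z := by
  rw [levelLift, vert_rotState, vert_levelFrame]

namespace IsLevelCurve

theorem analyticAt_levelFactor_snd (hV : IsLevelCurve ρ B E V k U) {z : ℝ × (ℝ × ℝ)}
    (hz : z.2 ∈ E) : AnalyticAt ℝ (fun z : ℝ × (ℝ × ℝ) => levelFactor ρ z.2) z :=
  (analyticAt_levelFactor ρ (hV.moment_ne_zero z.2 hz)).comp_of_eq analyticAt_snd rfl

theorem analytic_liftRate (hV : IsLevelCurve ρ B E V k U) :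
    AnalyticOnNhd ℝ (liftRate ρ B V k) (Set.univ ×ˢ E) := fun z hz =>
  ((hV.analytic_slowness z hz).fun_mul (analyticAt_frameRate B (hV.analyticAt_levelFactor_snd hz.2)
    (hV.analytic z hz) (hV.cross_ne_zero z.1 z.2 hz.2))).fun_mul analyticAt_const

theorem analytic_liftAngle (hV : IsLevelCurve ρ B E V k U) :
    AnalyticOnNhd ℝ (liftAngle ρ B V k) (Set.univ ×ˢ E) :=
  analyticOnNhd_primitive hV.isOpen_param hV.analytic_liftRate

theorem liftAngle_add_one (hV : IsLevelCurve ρ B E V k U) (hε : ε ∈ E) (s : ℝ) :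
    liftAngle ρ B V k (s + 1, ε) = liftAngle ρ B V k (s, ε) + liftAngle ρ B V k (1, ε) :=
  integral_add_one (continuous_slice hV.analytic_liftRate hε)
    (fun s => by simp only [liftRate, hV.add_one, hV.slowness_add_one]) s

theorem analytic_levelLift (hV : IsLevelCurve ρ B E V k U) :
    AnalyticOnNhd ℝ (levelLift ρ B V k) (Set.univ ×ˢ E) := fun z hz =>
  (analyticAt_mul (analyticAt_rotVertical (hV.analytic_liftAngle z hz)) (analyticAt_levelFrame B
    (hV.analytic z hz) (hV.cross_ne_zero z.1 z.2 hz.2))).prod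
      ((hV.analyticAt_levelFactor_snd hz.2).fun_smul
        (analyticAt_const_mulVec B (hV.analytic z hz)))

theorem levelLift_add_one (hV : IsLevelCurve ρ B E V k U) (hε : ε ∈ E) (s : ℝ) :
    levelLift ρ B V k (s + 1, ε) =
      rotState (liftAngle ρ B V k (1, ε)) (levelLift ρ B V k (s, ε)) := by
  rw [levelLift, levelLift, hV.liftAngle_add_one hε, hV.add_one, add_comm, rotState_add]

theorem hasDerivAt_levelLift (hV : IsLevelCurve ρ B E V k U) (hε : ε ∈ E) (s : ℝ) :
    HasDerivAt (fun s => levelLift ρ B V k (s, ε))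
      (k (s, ε) • ((levelLift ρ B V k (s, ε)).1 * hat (levelLift ρ B V k (s, ε)).2),
        k (s, ε) • (levelFactor ρ ε • (B *ᵥ (V (s, ε) ⨯₃ (levelLift ρ B V k (s, ε)).2)))) s := by
  have hangle : HasDerivAt (fun s => liftAngle ρ B V k (s, ε)) (liftRate ρ B V k (s, ε)) s :=
    hasDerivAt_primitive hV.analytic_liftRate hε s
  have hattitude := hasDerivAt_rotVertical_mul hangle
    (hasDerivAt_levelFrame (hV.velocity s ε hε) (hV.cross_ne_zero s ε hε))
    (levelFrame_mem_SO3 (hV.unit s ε hε) (hV.cross_ne_zero s ε hε))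
  have hω := (hasDerivAt_const_mulVec B (hV.velocity s ε hε)).const_smul (levelFactor ρ ε)
  refine (hattitude.prodMk hω).congr_deriv (Prod.ext ?_ ?_)
  · have hrate : 2 * Real.pi * liftRate ρ B V k (s, ε) =
        k (s, ε) * frameRate B (levelFactor ρ ε) (V (s, ε)) := by
      rw [liftRate]
      field_simp
    rw [hrate, vert_levelFrame, smul_sub, smul_smul (k (s, ε)) (frameRate _ _ _),
      add_sub_cancel, hat_smul, Matrix.mul_smul]
    rfl
  · simp only [levelLift, rotState, mulVec_smul]
    rw [smul_comm]

theorem hasDerivAt_levelLift_positionAt (hV : IsLevelCurve ρ B E V k U) (hε : ε ∈ E) {x s : ℝ}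
    (hs : positionAt (fun s => k (s, ε)) x = s) :
    HasDerivAt (fun x => levelLift ρ B V k (positionAt (fun s => k (s, ε)) x, ε))
      ((turnTime fun s => k (s, ε)) • ((levelLift ρ B V k (s, ε)).1 *
          hat (levelLift ρ B V k (s, ε)).2),
        (turnTime fun s => k (s, ε)) • (levelFactor ρ ε •
          (B *ᵥ (V (s, ε) ⨯₃ (levelLift ρ B V k (s, ε)).2)))) x := by
  subst hs
  have h0 : ∀ s, k (s, ε) ≠ 0 := fun s => hV.slowness_ne_zero s ε hε
  refine ((hV.hasDerivAt_levelLift hε _).scomp x (hasDerivAt_positionAt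
    (continuous_slice hV.analytic_slowness hε) h0 (hV.slowness_add_one · ε) x)).congr_deriv ?_
  rw [Prod.smul_mk, smul_smul, smul_smul, inv_mul_cancel_right₀ (h0 _)]

theorem levelLift_mem_levelSet (hV : IsLevelCurve ρ B E V k U) (hB : IsInertiaInverse I ρ B)
    (hε : ε ∈ E) (s : ℝ) : levelLift ρ B V k (s, ε) ∈ levelSet I ρ (ε.1 • e₃) ε.2 := by
  refine rotState_mem_levelSet ((hB.mem_levelSet_iff (hV.moment_ne_zero ε hε)
    (hV.denom_pos ε hε) (levelFrame_mem_SO3 (hV.unit s ε hε) (hV.cross_ne_zero s ε hε))).2 ?_) _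
  rw [vert_levelFrame]
  exact ⟨hV.level s ε hε, rfl⟩

theorem isTrajectoryFamily (hV : IsLevelCurve ρ B E V k U) (hB : IsInertiaInverse I ρ B) :
    IsTrajectoryFamily I ρ E
      (fun z => levelLift ρ B V k (positionAt (fun s => k (s, z.2)) z.1, z.2))
      (fun ε => liftAngle ρ B V k (1, ε)) (fun ε => turnTime fun s => k (s, ε)) U := by
  have hk : ∀ ε ∈ E, Continuous fun s => k (s, ε) := fun ε hε =>
    continuous_slice hV.analytic_slowness hε
  have h0 : ∀ ε ∈ E, ∀ s, k (s, ε) ≠ 0 := fun ε hε s => hV.slowness_ne_zero s ε hε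
  have hper : ∀ ε, Function.Periodic (fun s => k (s, ε)) 1 := fun ε s => hV.slowness_add_one s ε
  have hadd_one : ∀ x, ∀ ε ∈ E, positionAt (fun s => k (s, ε)) (x + 1) =
      positionAt (fun s => k (s, ε)) x + 1 := fun x ε hε =>
    positionAt_add_one (hk ε hε) (h0 ε hε) (hper ε) x
  have hbij : ∀ ε ∈ E, Function.Bijective (positionAt fun s => k (s, ε)) := fun ε hε =>
    positionAt_bijective (hk ε hε) (h0 ε hε) (hper ε)
  refine ⟨hV.isOpen_param, hV.isOpen_region, fun z hz => ?_, fun ε hε => ?_,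
    analyticOnNhd_turnTime hV.isOpen_param hV.analytic_slowness,
    fun ε hε => turnTime_ne_zero (hk ε hε) (h0 ε hε),
    fun x ε hε => hV.levelLift_mem_levelSet hB hε _, fun x ε hε => ?_, fun x ε hε => ?_,
    fun ε hε x y hxy => ?_, fun x ε hε => ?_, fun ε hε z hz hzU => ?_, fun x ε hε => ?_⟩
  · exact (hV.analytic_levelLift (positionAt (fun s => k (s, z.2)) z.1, z.2)
      ⟨trivial, hz.2⟩).comp_of_eq
      ((analyticOnNhd_positionAt hV.isOpen_param hV.analytic_slowness hV.slowness_ne_zero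
        hV.slowness_add_one z hz).prod analyticAt_snd) rfl
  · exact (hV.analytic_liftAngle (1, ε) ⟨trivial, hε⟩).comp_of_eq (f := fun ε => ((1 : ℝ), ε))
      (analyticAt_const.prod analyticAt_id) rfl
  · simp only [hadd_one x ε hε, hV.levelLift_add_one hε]
  · refine ⟨_, hV.hasDerivAt_levelLift_positionAt hε rfl, ?_⟩
    rw [vert_levelLift]
    exact hB.dynamicalEq rfl
  · obtain ⟨n, hn⟩ := hV.injective ε hε _ _ ((vert_levelLift _).symm.trans (hxy.trans
      (vert_levelLift _)))
    exact ⟨n, (hbij ε hε).1 (hn.trans (add_int_of_add_one (hadd_one · ε hε) y n).symm)⟩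
  · exact (vert_levelLift (ρ := ρ) (B := B) (V := V) (k := k) _).symm ▸ hV.mem_region _ ε hε
  · obtain ⟨hlevel, -⟩ :=
      (hB.mem_levelSet_iff (hV.moment_ne_zero ε hε) (hV.denom_pos ε hε) hz.1).1 hz
    obtain ⟨s, hs⟩ := hV.surjective ε hε _ (vert_dot_vert hz.1) hlevel hzU
    obtain ⟨x, rfl⟩ := (hbij ε hε).2 s
    exact ⟨x, hs.trans (vert_levelLift _).symm⟩
  · rw [vert_levelLift, levelLift, rotState, map_smul]
    exact smul_ne_zero (div_ne_zero (hV.denom_pos ε hε).ne' (hV.moment_ne_zero ε hε))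
      (hV.cross_ne_zero _ ε hε)

end IsLevelCurve

end Lift

/-! ### Level curves of a diagonal quadratic form -/

/-- The level `c` of the form `∑ bᵢ vᵢ²` lies strictly between `b 2` and the other two entries of
`b`, which lie on the same side of it. Then its level set on the unit sphere consists of two closed
curves around the third axis. -/
def IsolatesThird (b : Vec) (c : ℝ) : Prop :=
  0 < (b 2 - c) * (c - b 0) ∧ 0 < (b 2 - c) * (c - b 1)

/-- The semiaxes of the projection of a level curve along the third axis. -/
noncomputable def levelRadius (b : Vec) (i : Fin 3) (c : ℝ) : ℝ := √((b 2 - c) / (b 2 - b i))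

/-- The third coordinate, up to its sign, of the points of a level curve. -/
noncomputable def levelHeight (b : Vec) (c s : ℝ) : ℝ :=
  √(1 - (levelRadius b 0 c * Real.cos (2 * Real.pi * s)) ^ 2 -
    (levelRadius b 1 c * Real.sin (2 * Real.pi * s)) ^ 2)

/-- The parametrization of the level curve `∑ bᵢ vᵢ² = c` of the unit sphere around the third axis,
on the side given by the sign `σ`. -/
noncomputable def levelPoint (b : Vec) (σ c s : ℝ) : Vec :=
  ![levelRadius b 0 c * Real.cos (2 * Real.pi * s), levelRadius b 1 c * Real.sin (2 * Real.pi * s),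
    σ * levelHeight b c s]

/-- The derivative of the time with respect to the parameter of a level curve, where the point `v`
moves with velocity `κ v × (b v)`. -/
noncomputable def levelSlowness (b : Vec) (σ κ c s : ℝ) : ℝ :=
  -(2 * Real.pi * levelRadius b 0 c) /
    (κ * (b 2 - b 1) * levelRadius b 1 c * σ * levelHeight b c s)

/-- The parameters for which the level sets are curves around the third axis. -/
def levelParam (ρ : ℝ) (b : Vec) : Set (ℝ × ℝ) :=
  {ε | ε.1 ≠ 0 ∧ 0 < ε.1 ^ 2 + 2 * ρ * ε.2 ∧ IsolatesThird b (levelValue ρ ε)}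

section LevelCurve

variable {b : Vec} {c : ℝ} {i : Fin 3}

theorem sub_ne_zero_of_mul_pos {a x y : ℝ} (h : 0 < (a - x) * (x - y)) : a - y ≠ 0 := by
  intro hay
  obtain rfl := sub_eq_zero.1 hay
  nlinarith [sq_nonneg (a - x)]

theorem div_sub_pos_of_mul_pos {a x y : ℝ} (h : 0 < (a - x) * (x - y)) : 0 < (a - x) / (a - y) := by
  rcases mul_pos_iff.1 h with ⟨hax, hxy⟩ | ⟨hax, hxy⟩
  · exact div_pos hax (by linarith)
  · exact div_pos_of_neg_of_neg hax (by linarith)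

theorem div_sub_lt_one_of_mul_pos {a x y : ℝ} (h : 0 < (a - x) * (x - y)) :
    (a - x) / (a - y) < 1 := by
  have hne := sub_ne_zero_of_mul_pos h
  have hsub : 1 - (a - x) / (a - y) = ((a - x) * (x - y) + (x - y) ^ 2) / (a - y) ^ 2 := by
    field_simp
    ring
  have hpos : 0 < ((a - x) * (x - y) + (x - y) ^ 2) / (a - y) ^ 2 := by positivity
  linarith

theorem levelRadius_pos (h : 0 < (b 2 - c) * (c - b i)) : 0 < levelRadius b i c :=
  Real.sqrt_pos.2 (div_sub_pos_of_mul_pos h)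

theorem levelRadius_sq_mul (h : 0 < (b 2 - c) * (c - b i)) :
    levelRadius b i c ^ 2 * (b 2 - b i) = b 2 - c := by
  rw [levelRadius, Real.sq_sqrt (div_sub_pos_of_mul_pos h).le,
    div_mul_cancel₀ _ (sub_ne_zero_of_mul_pos h)]

theorem levelRadius_sq_lt_one (h : 0 < (b 2 - c) * (c - b i)) : levelRadius b i c ^ 2 < 1 := by
  rw [levelRadius, Real.sq_sqrt (div_sub_pos_of_mul_pos h).le]
  exact div_sub_lt_one_of_mul_pos h

theorem sq_mul_cos_add_sq_mul_sin_lt_one {p q : ℝ} (hp : p ^ 2 < 1) (hq : q ^ 2 < 1) (φ : ℝ) :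
    (p * Real.cos φ) ^ 2 + (q * Real.sin φ) ^ 2 < 1 := by
  have hcs := Real.cos_sq_add_sin_sq φ
  rcases eq_or_ne (Real.cos φ) 0 with hcos | hcos
  · rw [hcos, zero_pow two_ne_zero, zero_add] at hcs
    rw [hcos, mul_zero, zero_pow two_ne_zero, zero_add, mul_pow, hcs, mul_one]
    exact hq
  · have hlt : p ^ 2 * Real.cos φ ^ 2 < Real.cos φ ^ 2 :=
      mul_lt_of_lt_one_left (by positivity) hp
    have hle : q ^ 2 * Real.sin φ ^ 2 ≤ Real.sin φ ^ 2 :=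
      mul_le_of_le_one_left (sq_nonneg _) hq.le
    rw [mul_pow, mul_pow, ← hcs]
    exact add_lt_add_of_lt_of_le hlt hle

theorem levelHeight_radicand_pos (h : IsolatesThird b c) (s : ℝ) :
    0 < 1 - (levelRadius b 0 c * Real.cos (2 * Real.pi * s)) ^ 2 -
      (levelRadius b 1 c * Real.sin (2 * Real.pi * s)) ^ 2 := by
  rw [sub_sub, sub_pos]
  exact sq_mul_cos_add_sq_mul_sin_lt_one (levelRadius_sq_lt_one h.1) (levelRadius_sq_lt_one h.2) _

theorem levelHeight_pos (h : IsolatesThird b c) (s : ℝ) : 0 < levelHeight b c s :=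
  Real.sqrt_pos.2 (levelHeight_radicand_pos h s)

theorem levelHeight_sq (h : IsolatesThird b c) (s : ℝ) :
    levelHeight b c s ^ 2 = 1 - (levelRadius b 0 c * Real.cos (2 * Real.pi * s)) ^ 2 -
      (levelRadius b 1 c * Real.sin (2 * Real.pi * s)) ^ 2 :=
  Real.sq_sqrt (levelHeight_radicand_pos h s).le

theorem levelPoint_add_one (b : Vec) (σ c s : ℝ) :
    levelPoint b σ c (s + 1) = levelPoint b σ c s := by
  simp only [levelPoint, levelHeight, mul_add, mul_one, Real.cos_add_two_pi, Real.sin_add_two_pi]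

theorem levelSlowness_add_one (b : Vec) (σ κ c s : ℝ) :
    levelSlowness b σ κ c (s + 1) = levelSlowness b σ κ c s := by
  simp only [levelSlowness, levelHeight, mul_add, mul_one, Real.cos_add_two_pi,
    Real.sin_add_two_pi]

theorem levelPoint_dot_self (h : IsolatesThird b c) {σ : ℝ} (hσ : σ ^ 2 = 1) (s : ℝ) :
    levelPoint b σ c s ⬝ᵥ levelPoint b σ c s = 1 := by
  have hheight := levelHeight_sq h s
  simp only [levelPoint, dotProduct, Fin.sum_univ_three, cons_val_zero, cons_val_one, cons_val]
  linear_combination hheight + levelHeight b c s ^ 2 * hσ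

theorem levelPoint_dot_diagonal_mulVec (h : IsolatesThird b c) {σ : ℝ} (hσ : σ ^ 2 = 1) (s : ℝ) :
    levelPoint b σ c s ⬝ᵥ (diagonal b *ᵥ levelPoint b σ c s) = c := by
  have hheight := levelHeight_sq h s
  have hr₀ := levelRadius_sq_mul h.1
  have hr₁ := levelRadius_sq_mul h.2
  have hcs := Real.sin_sq_add_cos_sq (2 * Real.pi * s)
  simp only [levelPoint, mulVec_diagonal, dotProduct, Fin.sum_univ_three, cons_val_zero,
    cons_val_one, cons_val]
  linear_combination b 2 * hheight + b 2 * levelHeight b c s ^ 2 * hσ -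
    Real.cos (2 * Real.pi * s) ^ 2 * hr₀ - Real.sin (2 * Real.pi * s) ^ 2 * hr₁ - (b 2 - c) * hcs

theorem hasDerivAt_two_pi_mul (s : ℝ) :
    HasDerivAt (fun s : ℝ => 2 * Real.pi * s) (2 * Real.pi) s := by
  simpa using (hasDerivAt_id s).const_mul (2 * Real.pi)

theorem hasDerivAt_levelHeight (h : IsolatesThird b c) (s : ℝ) :
    HasDerivAt (levelHeight b c) (2 * Real.pi * (levelRadius b 0 c ^ 2 - levelRadius b 1 c ^ 2) *
      Real.cos (2 * Real.pi * s) * Real.sin (2 * Real.pi * s) / levelHeight b c s) s := by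
  have hcos := (hasDerivAt_two_pi_mul s).cos.const_mul (levelRadius b 0 c)
  have hsin := (hasDerivAt_two_pi_mul s).sin.const_mul (levelRadius b 1 c)
  have hpos := levelHeight_pos h s
  refine ((((hcos.fun_pow 2).const_sub 1).sub (hsin.fun_pow 2)).sqrt
    (levelHeight_radicand_pos h s).ne').congr_deriv ?_
  change _ / (2 * levelHeight b c s) = _
  field_simp
  norm_num
  ring

theorem hasDerivAt_levelPoint (h : IsolatesThird b c) {σ κ : ℝ} (hσ : σ ^ 2 = 1) (hκ : κ ≠ 0)
    (s : ℝ) : HasDerivAt (levelPoint b σ c) (levelSlowness b σ κ c s •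
      (levelPoint b σ c s ⨯₃ (κ • (diagonal b *ᵥ levelPoint b σ c s)))) s := by
  have hpos := levelHeight_pos h s
  have hr₀ := levelRadius_sq_mul h.1
  have hr₁ := levelRadius_sq_mul h.2
  have hr₁_pos := levelRadius_pos h.2
  have hb₁ := sub_ne_zero_of_mul_pos h.2
  have hσ0 : σ ≠ 0 := by
    rintro rfl
    norm_num at hσ
  have hcoord : ∀ i, HasDerivAt (fun s => levelPoint b σ c s i) (![
      levelRadius b 0 c * (-Real.sin (2 * Real.pi * s) * (2 * Real.pi)),
      levelRadius b 1 c * (Real.cos (2 * Real.pi * s) * (2 * Real.pi)),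
      σ * (2 * Real.pi * (levelRadius b 0 c ^ 2 - levelRadius b 1 c ^ 2) *
        Real.cos (2 * Real.pi * s) * Real.sin (2 * Real.pi * s) / levelHeight b c s)] i) s := by
    intro i
    fin_cases i
    · exact (hasDerivAt_two_pi_mul s).cos.const_mul _
    · exact (hasDerivAt_two_pi_mul s).sin.const_mul _
    · exact (hasDerivAt_levelHeight h s).const_mul σ
  refine (hasDerivAt_pi.2 hcoord).congr_deriv ?_
  ext i
  fin_cases i <;> simp only [levelPoint, levelSlowness, mulVec_diagonal, cross_apply,
    Pi.smul_apply, smul_eq_mul, Fin.zero_eta, Fin.mk_one, Fin.reduceFinMk, cons_val_zero,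
    cons_val_one, cons_val] <;> field_simp
  · linear_combination Real.cos (2 * Real.pi * s) * (hr₁ - hr₀)
  · rw [hσ]
    linear_combination Real.cos (2 * Real.pi * s) * Real.sin (2 * Real.pi * s) * (hr₀ - hr₁)

theorem levelPoint_injective (h : IsolatesThird b c) {σ s t : ℝ}
    (hst : levelPoint b σ c s = levelPoint b σ c t) : ∃ n : ℤ, s = t + n := by
  have hcos : Real.cos (2 * Real.pi * s) = Real.cos (2 * Real.pi * t) :=
    mul_left_cancel₀ (levelRadius_pos h.1).ne' (congrFun hst 0)
  have hsin : Real.sin (2 * Real.pi * s) = Real.sin (2 * Real.pi * t) :=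
    mul_left_cancel₀ (levelRadius_pos h.2).ne' (congrFun hst 1)
  exact rotVertical_eq_iff.1 (by rw [rotVertical, rotVertical, hcos, hsin])

theorem div_levelRadius_sq (h : 0 < (b 2 - c) * (c - b i)) (x : ℝ) :
    (x / levelRadius b i c) ^ 2 = x ^ 2 * (b 2 - b i) / (b 2 - c) := by
  have hr := levelRadius_pos h
  have hb := sub_ne_zero_of_mul_pos h
  rw [← levelRadius_sq_mul h]
  field_simp

theorem exists_eq_levelPoint (h : IsolatesThird b c) {σ : ℝ} (hσ : σ ^ 2 = 1) {v : Vec}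
    (hv : v ⬝ᵥ v = 1) (hvc : v ⬝ᵥ (diagonal b *ᵥ v) = c) (hpos : 0 < σ * v 2) :
    ∃ s, v = levelPoint b σ c s := by
  have hr₀ := levelRadius_pos h.1
  have hr₁ := levelRadius_pos h.2
  have hne : b 2 - c ≠ 0 := left_ne_zero_of_mul h.1.ne'
  simp only [mulVec_diagonal, dotProduct, Fin.sum_univ_three] at hv hvc
  have hellipse : (v 0 / levelRadius b 0 c) ^ 2 + (v 1 / levelRadius b 1 c) ^ 2 = 1 := by
    rw [div_levelRadius_sq h.1, div_levelRadius_sq h.2, ← add_div, div_eq_one_iff_eq hne]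
    linear_combination b 2 * hv - hvc
  obtain ⟨φ, hcos, hsin⟩ := exists_eq_cos_sin hellipse
  have hφ : 2 * Real.pi * (φ / (2 * Real.pi)) = φ := mul_div_cancel₀ _ Real.two_pi_pos.ne'
  have hv₀ : v 0 = levelRadius b 0 c * Real.cos φ := by rw [← hcos, mul_div_cancel₀ _ hr₀.ne']
  have hv₁ : v 1 = levelRadius b 1 c * Real.sin φ := by rw [← hsin, mul_div_cancel₀ _ hr₁.ne']
  have hheight : levelHeight b c (φ / (2 * Real.pi)) = σ * v 2 := by
    refine (Real.sqrt_eq_iff_mul_self_eq (levelHeight_radicand_pos h _).le hpos.le).2 ?_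
    rw [hφ, ← hv₀, ← hv₁]
    linear_combination -hv - v 2 ^ 2 * hσ
  refine ⟨φ / (2 * Real.pi), ?_⟩
  rw [levelPoint, hφ, hheight, ← hv₀, ← hv₁, ← mul_assoc, ← sq, hσ, one_mul]
  ext i
  fin_cases i <;> rfl

theorem levelPoint_cross_ne_zero (h : IsolatesThird b c) {σ : ℝ} (hσ : σ ≠ 0) (s : ℝ) :
    levelPoint b σ c s ⨯₃ (diagonal b *ᵥ levelPoint b σ c s) ≠ 0 := by
  intro hcross
  have hpos := levelHeight_pos h s
  have hr₀ := levelRadius_pos h.1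
  have hr₁ := levelRadius_pos h.2
  have hb₀ := sub_ne_zero_of_mul_pos h.1
  have hb₁ := sub_ne_zero_of_mul_pos h.2
  have hcross₀ := congrFun hcross 0
  have hcross₁ := congrFun hcross 1
  simp only [levelPoint, mulVec_diagonal, cross_apply, cons_val_zero, cons_val_one, cons_val,
    Pi.zero_apply] at hcross₀ hcross₁
  have hsin : Real.sin (2 * Real.pi * s) = 0 := by
    have hprod : (b 2 - b 1) * levelRadius b 1 c * σ * levelHeight b c s *
      Real.sin (2 * Real.pi * s) = 0 := by linear_combination hcross₀
    exact (mul_eq_zero.1 hprod).resolve_left (by positivity)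
  have hcos : Real.cos (2 * Real.pi * s) = 0 := by
    have hprod : (b 2 - b 0) * levelRadius b 0 c * σ * levelHeight b c s *
      Real.cos (2 * Real.pi * s) = 0 := by linear_combination -hcross₁
    exact (mul_eq_zero.1 hprod).resolve_left (by positivity)
  have hcs := Real.sin_sq_add_cos_sq (2 * Real.pi * s)
  rw [hsin, hcos] at hcs
  norm_num at hcs

theorem levelSlowness_ne_zero (h : IsolatesThird b c) {σ κ : ℝ} (hσ : σ ≠ 0) (hκ : κ ≠ 0) (s : ℝ) :
    levelSlowness b σ κ c s ≠ 0 := by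
  have hpos := levelHeight_pos h s
  have hr₀ := levelRadius_pos h.1
  have hr₁ := levelRadius_pos h.2
  have hb₁ := sub_ne_zero_of_mul_pos h.2
  rw [levelSlowness, neg_div, neg_ne_zero]
  positivity

theorem analyticAt_levelValue {ρ : ℝ} {ε : ℝ × ℝ} (hD : ε.1 ^ 2 + 2 * ρ * ε.2 ≠ 0) :
    AnalyticAt ℝ (levelValue ρ) ε :=
  (analyticAt_const.fun_mul analyticAt_snd).fun_div
    ((analyticAt_fst.fun_pow 2).fun_add (analyticAt_const.fun_mul analyticAt_snd)) hD

theorem isOpen_levelParam (ρ : ℝ) (b : Vec) : IsOpen (levelParam ρ b) := by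
  refine isOpen_iff_mem_nhds.2 fun ε ⟨hε, hD, h₀, h₁⟩ => ?_
  have hvalue : ContinuousAt (levelValue ρ) ε := (analyticAt_levelValue hD.ne').continuousAt
  have hdenom : ContinuousAt (fun ε : ℝ × ℝ => ε.1 ^ 2 + 2 * ρ * ε.2) ε := by fun_prop
  exact (continuousAt_fst.eventually_ne hε).and ((hdenom.eventually (lt_mem_nhds hD)).and
    ((((continuousAt_const.sub hvalue).mul (hvalue.sub continuousAt_const)).eventually
      (lt_mem_nhds h₀)).and (((continuousAt_const.sub hvalue).mul
        (hvalue.sub continuousAt_const)).eventually (lt_mem_nhds h₁))))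

end LevelCurve

section LevelCurveAnalytic

variable {X : Type*} [NormedAddCommGroup X] [NormedSpace ℝ X] {b : Vec} {x : X} {c s κ : X → ℝ}

theorem analyticAt_levelRadius {i : Fin 3} (hc : AnalyticAt ℝ c x)
    (h : 0 < (b 2 - c x) * (c x - b i)) : AnalyticAt ℝ (fun x => levelRadius b i (c x)) x :=
  analyticAt_sqrt ((analyticAt_const.fun_sub hc).fun_div analyticAt_const
    (sub_ne_zero_of_mul_pos h)) (div_sub_pos_of_mul_pos h)

theorem analyticAt_cos_two_pi_mul (hs : AnalyticAt ℝ s x) :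
    AnalyticAt ℝ (fun x => Real.cos (2 * Real.pi * s x)) x :=
  Real.analyticAt_cos.comp_of_eq (analyticAt_const.fun_mul hs) rfl

theorem analyticAt_sin_two_pi_mul (hs : AnalyticAt ℝ s x) :
    AnalyticAt ℝ (fun x => Real.sin (2 * Real.pi * s x)) x :=
  Real.analyticAt_sin.comp_of_eq (analyticAt_const.fun_mul hs) rfl

theorem analyticAt_levelHeight (hc : AnalyticAt ℝ c x) (hs : AnalyticAt ℝ s x)
    (h : IsolatesThird b (c x)) : AnalyticAt ℝ (fun x => levelHeight b (c x) (s x)) x :=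
  analyticAt_sqrt ((analyticAt_const.fun_sub (((analyticAt_levelRadius hc h.1).fun_mul
    (analyticAt_cos_two_pi_mul hs)).fun_pow 2)).fun_sub (((analyticAt_levelRadius hc h.2).fun_mul
    (analyticAt_sin_two_pi_mul hs)).fun_pow 2)) (levelHeight_radicand_pos h _)

theorem analyticAt_levelPoint (σ : ℝ) (hc : AnalyticAt ℝ c x) (hs : AnalyticAt ℝ s x)
    (h : IsolatesThird b (c x)) : AnalyticAt ℝ (fun x => levelPoint b σ (c x) (s x)) x := by
  refine AnalyticAt.pi (f := fun i x => levelPoint b σ (c x) (s x) i) fun i => ?_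
  fin_cases i
  · exact (analyticAt_levelRadius hc h.1).fun_mul (analyticAt_cos_two_pi_mul hs)
  · exact (analyticAt_levelRadius hc h.2).fun_mul (analyticAt_sin_two_pi_mul hs)
  · exact analyticAt_const.fun_mul (analyticAt_levelHeight hc hs h)

theorem analyticAt_levelSlowness {σ : ℝ} (hσ : σ ≠ 0) (hκ : AnalyticAt ℝ κ x) (hκ0 : κ x ≠ 0)
    (hc : AnalyticAt ℝ c x) (hs : AnalyticAt ℝ s x) (h : IsolatesThird b (c x)) :
    AnalyticAt ℝ (fun x => levelSlowness b σ (κ x) (c x) (s x)) x :=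
  ((analyticAt_const.fun_mul (analyticAt_levelRadius hc h.1)).fun_neg).fun_div
    ((((hκ.fun_mul analyticAt_const).fun_mul (analyticAt_levelRadius hc h.2)).fun_mul
      analyticAt_const).fun_mul (analyticAt_levelHeight hc hs h))
    (mul_ne_zero (mul_ne_zero (mul_ne_zero (mul_ne_zero hκ0 (sub_ne_zero_of_mul_pos h.2))
      (levelRadius_pos h.2).ne') hσ) (levelHeight_pos h _).ne')

end LevelCurveAnalytic

theorem dot_conj_mulVec (F S : Mat) (u : Vec) :
    u ⬝ᵥ ((F * S * Fᵀ) *ᵥ u) = (Fᵀ *ᵥ u) ⬝ᵥ (S *ᵥ (Fᵀ *ᵥ u)) := by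
  rw [← mulVec_mulVec, ← mulVec_mulVec, mulVec_dot, transpose_transpose]

theorem conj_mulVec_mulVec {F : Mat} (hF : F ∈ SO3) (S : Mat) (v : Vec) :
    (F * S * Fᵀ) *ᵥ (F *ᵥ v) = F *ᵥ (S *ᵥ v) := by
  rw [← mulVec_mulVec, ← mulVec_mulVec, transpose_mulVec_mulVec hF]

theorem mulVec_injective {F : Mat} (hF : F ∈ SO3) : Function.Injective (F *ᵥ ·) :=
  Function.LeftInverse.injective (g := (Fᵀ *ᵥ ·)) (transpose_mulVec_mulVec hF)

section LevelCurve

variable {ρ : ℝ} {b : Vec} {F : Mat} {σ c : ℝ}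

theorem exists_eq_mulVec_levelPoint (hF : F ∈ SO3) (h : IsolatesThird b c) (hσ : σ ^ 2 = 1)
    {u : Vec} (hu : u ⬝ᵥ u = 1) (huc : u ⬝ᵥ ((F * diagonal b * Fᵀ) *ᵥ u) = c)
    (hpos : 0 < σ * (Fᵀ *ᵥ u) 2) : ∃ s, u = F *ᵥ levelPoint b σ c s := by
  rw [dot_conj_mulVec] at huc
  rw [← dot_mulVec_mulVec (transpose_mem_SO3 hF)] at hu
  obtain ⟨s, hs⟩ := exists_eq_levelPoint h hσ hu huc hpos
  exact ⟨s, by rw [← hs, mulVec_transpose_mulVec hF]⟩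

theorem transpose_mulVec_levelPoint_apply_two_pos (hF : F ∈ SO3) (h : IsolatesThird b c)
    (hσ : σ ^ 2 = 1) (s : ℝ) : 0 < σ * (Fᵀ *ᵥ (F *ᵥ levelPoint b σ c s)) 2 := by
  have hvalue : levelPoint b σ c s 2 = σ * levelHeight b c s := rfl
  rw [transpose_mulVec_mulVec hF, hvalue, ← mul_assoc, ← sq, hσ, one_mul]
  exact levelHeight_pos h s

theorem hasDerivAt_mulVec_levelPoint (hF : F ∈ SO3) (h : IsolatesThird b c) (hσ : σ ^ 2 = 1)
    {κ : ℝ} (hκ : κ ≠ 0) (s : ℝ) : HasDerivAt (fun s => F *ᵥ levelPoint b σ c s)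
      (levelSlowness b σ κ c s • ((F *ᵥ levelPoint b σ c s) ⨯₃
        (κ • ((F * diagonal b * Fᵀ) *ᵥ (F *ᵥ levelPoint b σ c s))))) s := by
  rw [conj_mulVec_mulVec hF, ← mulVec_smul, ← mulVec_cross hF, ← mulVec_smul]
  exact hasDerivAt_const_mulVec F (hasDerivAt_levelPoint h hσ hκ s)

theorem mulVec_levelPoint_cross_ne_zero (hF : F ∈ SO3) (h : IsolatesThird b c) (hσ : σ ≠ 0)
    (s : ℝ) : (F *ᵥ levelPoint b σ c s) ⨯₃
      ((F * diagonal b * Fᵀ) *ᵥ (F *ᵥ levelPoint b σ c s)) ≠ 0 := by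
  rw [conj_mulVec_mulVec hF, ← mulVec_cross hF]
  exact fun h0 => levelPoint_cross_ne_zero h hσ s (mulVec_injective hF (by simpa using h0))

theorem isLevelCurve (hF : F ∈ SO3) (hσ : σ ^ 2 = 1) :
    IsLevelCurve ρ (F * diagonal b * Fᵀ) (levelParam ρ b)
      (fun z => F *ᵥ levelPoint b σ (levelValue ρ z.2) z.1)
      (fun z => levelSlowness b σ (levelFactor ρ z.2) (levelValue ρ z.2) z.1)
      {u | 0 < σ * (Fᵀ *ᵥ u) 2} := by
  have hσ0 : σ ≠ 0 := by
    rintro rfl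
    norm_num at hσ
  have hκ : ∀ ε ∈ levelParam ρ b, levelFactor ρ ε ≠ 0 := fun ε hε =>
    div_ne_zero hε.2.1.ne' hε.1
  have hvalue : ∀ z ∈ (Set.univ : Set ℝ) ×ˢ levelParam ρ b,
      AnalyticAt ℝ (fun z : ℝ × (ℝ × ℝ) => levelValue ρ z.2) z := fun z hz =>
    (analyticAt_levelValue hz.2.2.1.ne').comp_of_eq analyticAt_snd rfl
  exact {
    isOpen_param := isOpen_levelParam ρ b
    isOpen_region := isOpen_lt continuous_const (by fun_prop)
    moment_ne_zero := fun ε hε => hε.1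
    denom_pos := fun ε hε => hε.2.1
    analytic := fun z hz => analyticAt_const_mulVec F
      (analyticAt_levelPoint σ (hvalue z hz) analyticAt_fst hz.2.2.2)
    analytic_slowness := fun z hz => analyticAt_levelSlowness hσ0
      ((analyticAt_levelFactor ρ hz.2.1).comp_of_eq analyticAt_snd rfl) (hκ z.2 hz.2)
      (hvalue z hz) analyticAt_fst hz.2.2.2
    add_one := fun s ε => congrArg (F *ᵥ ·) (levelPoint_add_one b σ _ s)
    slowness_add_one := fun s ε => levelSlowness_add_one b σ _ _ s
    slowness_ne_zero := fun s ε hε => levelSlowness_ne_zero hε.2.2 hσ0 (hκ ε hε) s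
    unit := fun s ε hε => (dot_mulVec_mulVec hF _ _).trans (levelPoint_dot_self hε.2.2 hσ s)
    level := fun s ε hε => by
      rw [conj_mulVec_mulVec hF, dot_mulVec_mulVec hF, levelPoint_dot_diagonal_mulVec hε.2.2 hσ]
    velocity := fun s ε hε => hasDerivAt_mulVec_levelPoint hF hε.2.2 hσ (hκ ε hε) s
    injective := fun ε hε s t hst => levelPoint_injective hε.2.2 (mulVec_injective hF hst)
    mem_region := fun s ε hε => transpose_mulVec_levelPoint_apply_two_pos hF hε.2.2 hσ s
    surjective := fun ε hε u hu huc hpos =>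
      exists_eq_mulVec_levelPoint hF hε.2.2 hσ hu huc hpos
    cross_ne_zero := fun s ε hε => mulVec_levelPoint_cross_ne_zero hF hε.2.2 hσ0 s }

end LevelCurve

/-! ### Regular values of the energy -/

theorem hasDerivAt_exp_smul_zero {𝔸 : Type*} [NormedRing 𝔸] [NormedAlgebra ℝ 𝔸]
    [CompleteSpace 𝔸] (M : 𝔸) : HasDerivAt (fun s : ℝ => NormedSpace.exp (s • M)) M 0 := by
  simpa only [zero_smul, NormedSpace.exp_zero, one_mul] using
    hasDerivAt_exp_smul_const (𝕂 := ℝ) M 0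

-- The norm on `Mat` is not submultiplicative; it induces the same topology as the operator norm.
theorem hasDerivAt_matrix_exp_smul_zero (M : Mat) :
    HasDerivAt (fun s : ℝ => NormedSpace.exp (s • M)) M 0 :=
  @hasDerivAt_exp_smul_zero Mat Matrix.linftyOpNormedRing Matrix.linftyOpNormedAlgebra
    inferInstance M

theorem exp_transpose_mul_exp {n : Type*} [Fintype n] [DecidableEq n] {M : Matrix n n ℝ}
    (hM : Mᵀ = -M) : (NormedSpace.exp M)ᵀ * NormedSpace.exp M = 1 := by
  rw [← Matrix.exp_transpose, hM, Matrix.exp_neg, Matrix.nonsing_inv_mul _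
    ((Matrix.isUnit_iff_isUnit_det _).1 (Matrix.isUnit_exp M))]

theorem vert_mul_exp_dot_self {A : Mat} (hA : A ∈ SO3) (ν : Vec) (s : ℝ) :
    vert (A * NormedSpace.exp (s • hat ν)) ⬝ᵥ vert (A * NormedSpace.exp (s • hat ν)) = 1 := by
  have hskew : (s • hat ν)ᵀ = -(s • hat ν) := by rw [transpose_smul, hat_transpose, smul_neg]
  have hexp := mul_eq_one_comm.1 (exp_transpose_mul_exp hskew)
  rw [vert, mulVec_dot, mulVec_mulVec, transpose_transpose, transpose_mul, Matrix.mul_assoc,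
    ← Matrix.mul_assoc (NormedSpace.exp _), hexp, Matrix.one_mul, mul_transpose_of_mem hA,
    one_mulVec, e₃_dot_e₃]

theorem hasDerivAt_vert_mul_exp (A : Mat) (ν : Vec) :
    HasDerivAt (fun s : ℝ => vert (A * NormedSpace.exp (s • hat ν))) (vert A ⨯₃ ν) 0 := by
  rw [← vert_mul_hat]
  refine (hasDerivAt_vert (hasDerivAt_mul (hasDerivAt_const 0 A)
    (hasDerivAt_matrix_exp_smul_zero (hat ν)))).congr_deriv ?_
  rw [Matrix.zero_mul, zero_add]

namespace IsInertiaInverse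

variable {I : Mat} {ρ : ℝ} {B : Mat}

theorem inertiaAt_mulVec_omegaOf (hB : IsInertiaInverse I ρ B) {A : Mat}
    (hu : vert A ⬝ᵥ vert A = 1) (j : ℝ) :
    inertiaAt I ρ (vert A) *ᵥ omegaOf I ρ (j • e₃) A = j • vert A := by
  have hdet : IsUnit (inertiaAt I ρ (vert A)).det := by
    refine isUnit_iff_ne_zero.2 fun hzero => ?_
    obtain ⟨ω, hω, hker⟩ := Matrix.exists_mulVec_eq_zero_iff.2 hzero
    have hω_eq := (hB.inertiaAt_mulVec_eq_iff hu 0).1 (by rw [hker, zero_smul])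
    rw [zero_div, zero_smul] at hω_eq
    exact hω hω_eq
  rw [omegaOf, Matrix.mulVec_mulVec, Matrix.mul_nonsing_inv _ hdet, one_mulVec, mulVec_smul, vert]

theorem energyOn_eq (hB : IsInertiaInverse I ρ B) {A : Mat} (hu : vert A ⬝ᵥ vert A = 1) (j : ℝ) :
    energyOn I ρ (j • e₃) A =
      1 / 2 * j ^ 2 * (vert A ⬝ᵥ (B *ᵥ vert A)) / (1 - ρ * (vert A ⬝ᵥ (B *ᵥ vert A))) :=
  hB.energy_eq hu (hB.inertiaAt_mulVec_omegaOf hu j)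

theorem energyOn_of_mem (hB : IsInertiaInverse I ρ B) {j T : ℝ} {z : Mat × Vec}
    (hz : z ∈ levelSet I ρ (j • e₃) T) : energyOn I ρ (j • e₃) z.1 = T := by
  have hu := vert_dot_vert hz.1
  rw [hB.energyOn_eq hu, ← hB.energy_eq hu ((moment_eq_iff hz.1).1 hz.2.1), hz.2.2]

theorem hasDerivAt_dot_vert_mul_exp (hB : IsInertiaInverse I ρ B) (A : Mat) (ν : Vec) :
    HasDerivAt (fun s : ℝ => vert (A * NormedSpace.exp (s • hat ν)) ⬝ᵥ
      (B *ᵥ vert (A * NormedSpace.exp (s • hat ν))))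
      (2 * ((B *ᵥ vert A) ⬝ᵥ (vert A ⨯₃ ν))) 0 := by
  have hvert := hasDerivAt_vert_mul_exp A ν
  refine (hasDerivAt_dot hvert (hasDerivAt_const_mulVec B hvert)).congr_deriv ?_
  rw [zero_smul, NormedSpace.exp_zero, Matrix.mul_one, ← hB.dot_comm (vert A), two_mul,
    dotProduct_comm]

theorem deriv_energyOn_eq_zero (hB : IsInertiaInverse I ρ B) {A : Mat} (hA : A ∈ SO3) {c : ℝ}
    (hc : B *ᵥ vert A = c • vert A) (j : ℝ) (ν : Vec) :
    deriv (fun s : ℝ => energyOn I ρ (j • e₃) (A * NormedSpace.exp (s • hat ν))) 0 = 0 := by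
  have hform := hB.hasDerivAt_dot_vert_mul_exp A ν
  rw [hc, smul_dotProduct, dot_self_cross, smul_zero, mul_zero] at hform
  have henergy := (hform.const_mul (1 / 2 * j ^ 2)).fun_div ((hform.const_mul ρ).const_sub 1)
    (sub_pos.2 (hB.lt_one _ (vert_mul_exp_dot_self hA ν 0))).ne'
  rw [funext fun s => hB.energyOn_eq (vert_mul_exp_dot_self hA ν s) j, henergy.deriv]
  simp only [mul_zero, zero_mul, neg_zero, sub_zero, zero_div]

theorem mulVec_ne_smul (hB : IsInertiaInverse I ρ B) {j T : ℝ}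
    (hT : IsRegularValue I ρ (j • e₃) T) {A : Mat} (hA : A ∈ SO3)
    (hAT : energyOn I ρ (j • e₃) A = T) (c : ℝ) : B *ᵥ vert A ≠ c • vert A := fun hc =>
  have ⟨ν, hν⟩ := hT A hA hAT
  hν (hB.deriv_energyOn_eq_zero hA hc j ν)

theorem moment_ne_zero (hB : IsInertiaInverse I ρ B) {j T : ℝ}
    (hT : IsRegularValue I ρ (j • e₃) T) {z : Mat × Vec} (hz : z ∈ levelSet I ρ (j • e₃) T) :
    j ≠ 0 := by
  rintro rfl
  obtain ⟨ν, hν⟩ := hT z.1 hz.1 (hB.energyOn_of_mem hz)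
  refine hν ?_
  rw [funext fun s => hB.energyOn_eq (vert_mul_exp_dot_self hz.1 ν s) 0]
  simp only [ne_eq, OfNat.ofNat_ne_zero, not_false_eq_true, zero_pow, mul_zero, zero_mul,
    zero_div, deriv_const]

theorem ne_levelValue (hB : IsInertiaInverse I ρ B) {j T : ℝ}
    (hT : IsRegularValue I ρ (j • e₃) T) {z : Mat × Vec} (hz : z ∈ levelSet I ρ (j • e₃) T)
    {F : Mat} (hF : F ∈ SO3) {b : Vec} (hFB : B = F * diagonal b * Fᵀ) :
    b 2 ≠ vert z.1 ⬝ᵥ (B *ᵥ vert z.1) := by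
  intro hb
  have heigen : diagonal b *ᵥ e₃ = b 2 • e₃ := by
    ext i
    fin_cases i <;> simp [mulVec_diagonal, e₃]
  have hvert : vert Fᵀ = F *ᵥ e₃ := by rw [vert, transpose_transpose]
  have hBF : B *ᵥ vert Fᵀ = b 2 • vert Fᵀ := by
    rw [hvert, hFB, conj_mulVec_mulVec hF, heigen, mulVec_smul]
  have hu := vert_dot_vert (transpose_mem_SO3 hF)
  refine hB.mulVec_ne_smul hT (transpose_mem_SO3 hF) ?_ (b 2) hBF
  rw [← hB.energyOn_of_mem hz, hB.energyOn_eq (vert_dot_vert hz.1), hB.energyOn_eq hu, hBF,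
    dotProduct_smul, hu, smul_eq_mul, mul_one, hb]

end IsInertiaInverse

/-! ### Principal axes -/

theorem exists_conj_diagonal {I : Mat} (hI : I.PosDef) :
    ∃ F ∈ SO3, ∃ d : Vec, (∀ i, 0 < d i) ∧ I = F * diagonal d * Fᵀ := by
  have hH := hI.isHermitian
  set W : Mat := (hH.eigenvectorUnitary : Mat)
  have hspectral : I = W * diagonal hH.eigenvalues * Wᵀ := by
    have h := hH.spectral_theorem
    rwa [Unitary.conjStarAlgAut_apply, star_eq_conjTranspose,
      conjTranspose_eq_transpose_of_trivial] at h
  have horth : Wᵀ * W = 1 := by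
    have h := Unitary.coe_star_mul_self hH.eigenvectorUnitary
    rwa [star_eq_conjTranspose, conjTranspose_eq_transpose_of_trivial] at h
  have hdet : W.det * W.det = 1 := by
    rw [← det_one (n := Fin 3) (R := ℝ), ← horth, det_mul, det_transpose]
  rcases mul_self_eq_one_iff.1 hdet with hdet | hdet
  · exact ⟨W, ⟨horth, hdet⟩, _, hI.eigenvalues_pos, hspectral⟩
  · refine ⟨-W, ⟨?_, ?_⟩, _, hI.eigenvalues_pos, ?_⟩
    · rw [transpose_neg, neg_mul_neg, horth]
    · rw [det_neg, hdet, Fintype.card_fin]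
      norm_num
    · rwa [transpose_neg, Matrix.neg_mul, neg_mul_neg]

theorem conj_diagonal_mul_conj_diagonal {F : Mat} (hF : F ∈ SO3) (d e : Vec) :
    F * diagonal d * Fᵀ * (F * diagonal e * Fᵀ) = F * diagonal (fun i => d i * e i) * Fᵀ := by
  calc F * diagonal d * Fᵀ * (F * diagonal e * Fᵀ)
      = F * (diagonal d * (Fᵀ * F) * diagonal e) * Fᵀ := by simp only [Matrix.mul_assoc]
    _ = F * diagonal (fun i => d i * e i) * Fᵀ := by
      rw [hF.1, Matrix.mul_one, diagonal_mul_diagonal]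

theorem conj_diagonal_const {F : Mat} (hF : F ∈ SO3) (ρ : ℝ) :
    F * diagonal (fun _ => ρ) * Fᵀ = ρ • (1 : Mat) := by
  rw [← smul_one_eq_diagonal, Matrix.mul_smul, Matrix.smul_mul, Matrix.mul_one,
    mul_transpose_of_mem hF]

theorem dot_diagonal_mulVec_pos {n : Type*} [Fintype n] [DecidableEq n] {p v : n → ℝ}
    (hp : ∀ i, 0 < p i) (hv : v ⬝ᵥ v = 1) : 0 < v ⬝ᵥ (diagonal p *ᵥ v) := by
  have hv0 : v ≠ 0 := by
    rintro rfl
    simp at hv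
  simpa only [star_trivial] using (PosDef.diagonal hp).dotProduct_mulVec_pos hv0

theorem exists_isInertiaInverse {I : Mat} (hI : I.PosDef) {ρ : ℝ} (hρ : 0 ≤ ρ) :
    ∃ F ∈ SO3, ∃ b : Vec, IsInertiaInverse I ρ (F * diagonal b * Fᵀ) := by
  obtain ⟨F, hF, d, hd, rfl⟩ := exists_conj_diagonal hI
  have hsum : ∀ i, 0 < d i + ρ := fun i => add_pos_of_pos_of_nonneg (hd i) hρ
  refine ⟨F, hF, fun i => (d i + ρ)⁻¹, ?_, ?_, fun u hu => ?_⟩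
  · rw [← conj_diagonal_const hF, ← Matrix.add_mul, ← Matrix.mul_add, diagonal_add,
      conj_diagonal_mul_conj_diagonal hF]
    simp only [mul_inv_cancel₀ (hsum _).ne', conj_diagonal_const hF, one_smul]
  · rw [transpose_mul, transpose_mul, transpose_transpose, diagonal_transpose, Matrix.mul_assoc]
  · rw [dot_conj_mulVec]
    rw [← dot_mulVec_mulVec (transpose_mem_SO3 hF)] at hu
    have hp : ∀ i, 0 < 1 - ρ * (d i + ρ)⁻¹ := fun i => by
      rw [sub_pos, ← div_eq_mul_inv, div_lt_one (hsum i)]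
      linarith [hd i]
    have hpos := dot_diagonal_mulVec_pos hp hu
    simp only [mulVec_diagonal, dotProduct, Fin.sum_univ_three] at hu hpos ⊢
    linarith

/-- The rotation that permutes the coordinate axes cyclically. -/
def cyclic : Mat := !![0, 0, 1; 1, 0, 0; 0, 1, 0]

theorem cyclic_mem_SO3 : cyclic ∈ SO3 := by
  refine ⟨?_, by simp [cyclic, det_fin_three]⟩
  ext i j
  fin_cases i <;> fin_cases j <;> simp [cyclic, Matrix.mul_apply, Fin.sum_univ_three]

theorem conj_cyclic (F : Mat) (b : Vec) :
    F * cyclic * diagonal ![b 1, b 2, b 0] * (F * cyclic)ᵀ = F * diagonal b * Fᵀ := by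
  have hperm : cyclic * diagonal ![b 1, b 2, b 0] * cyclicᵀ = diagonal b := by
    ext i j
    fin_cases i <;> fin_cases j <;>
      simp [cyclic, Matrix.mul_apply, diagonal, vecHead, vecTail]
  rw [← hperm, transpose_mul]
  simp only [Matrix.mul_assoc]

section IsolatedAxis

variable {b v : Vec} {c : ℝ}

theorem IsolatesThird.apply_two_ne_zero (h : IsolatesThird b c) (hv : v ⬝ᵥ v = 1)
    (hvc : v ⬝ᵥ (diagonal b *ᵥ v) = c) : v 2 ≠ 0 := by
  intro hv2
  have hp : ∀ i, 0 < ![(b 2 - c) * (c - b 0), (b 2 - c) * (c - b 1), 1] i := fun i => by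
    fin_cases i
    exacts [h.1, h.2, one_pos]
  have hpos := dot_diagonal_mulVec_pos hp hv
  simp only [mulVec_diagonal, dotProduct, Fin.sum_univ_three, hv2, cons_val_zero,
    cons_val_one, cons_val] at hpos hv hvc
  exact hpos.ne' (by linear_combination (b 2 - c) * c * hv - (b 2 - c) * hvc)

-- Since `c` is a weighted mean of the `b i`, the three numbers `b i - c` do not all have the same
-- sign; the axis to be isolated is that of the one whose sign differs from the other two.
theorem exists_isolatesThird (hv : v ⬝ᵥ v = 1) (hvc : v ⬝ᵥ (diagonal b *ᵥ v) = c)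
    (hb : ∀ i, b i ≠ c) : IsolatesThird b c ∨ IsolatesThird ![b 1, b 2, b 0] c ∨
      IsolatesThird ![b 2, b 0, b 1] c := by
  have hsub : ∀ i, b i - c ≠ 0 := fun i => sub_ne_zero.2 (hb i)
  have hcomm : ∀ i j, (b i - c) * (c - b j) = (b j - c) * (c - b i) := fun i j => by ring
  have htrans : ∀ i j k, 0 < (b i - c) * (c - b j) → 0 < (b j - c) * (b k - c) →
      0 < (b i - c) * (c - b k) := fun i j k hij hjk => by
    have hprod := mul_pos hij hjk
    have hsq := sq_pos_of_ne_zero (hsub j)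
    refine pos_of_mul_pos_left (b := (b j - c) ^ 2) ?_ hsq.le
    linear_combination hprod
  have hsign : ∀ i j, 0 < (b i - c) * (c - b j) ∨ 0 < (b i - c) * (b j - c) := fun i j => by
    rcases (mul_ne_zero (hsub i) (hsub j)).lt_or_gt with hneg | hpos
    · exact Or.inl (by linear_combination hneg)
    · exact Or.inr hpos
  rcases hsign 0 1 with h01 | h01 <;> rcases hsign 1 2 with h12 | h12
  · exact Or.inr (Or.inr ⟨h12, by rwa [hcomm] at h01⟩)
  · exact Or.inr (Or.inl ⟨h01, htrans 0 1 2 h01 h12⟩)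
  · rw [hcomm] at h12
    rw [mul_comm] at h01
    exact Or.inl ⟨htrans 2 1 0 h12 h01, h12⟩
  · have hp : ∀ i, 0 < (b 1 - c) * (b i - c) := fun i => by
      fin_cases i
      exacts [by rwa [mul_comm] at h01, mul_self_pos.2 (hsub 1), h12]
    have hpos := dot_diagonal_mulVec_pos hp hv
    simp only [mulVec_diagonal, dotProduct, Fin.sum_univ_three] at hpos hv hvc
    exact absurd (by linear_combination (b 1 - c) * hvc - (b 1 - c) * c * hv) hpos.ne'

end IsolatedAxis

theorem IsInertiaInverse.exists_isolatesThird {I : Mat} {ρ : ℝ} {B : Mat}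
    (hB : IsInertiaInverse I ρ B) {j T : ℝ} (hT : IsRegularValue I ρ (j • e₃) T) {z : Mat × Vec}
    (hz : z ∈ levelSet I ρ (j • e₃) T) {F : Mat} (hF : F ∈ SO3) {b : Vec}
    (hFB : B = F * diagonal b * Fᵀ) :
    ∃ F' ∈ SO3, ∃ b' : Vec, B = F' * diagonal b' * F'ᵀ ∧
      IsolatesThird b' (vert z.1 ⬝ᵥ (B *ᵥ vert z.1)) := by
  have hF₁ := mul_mem_SO3 hF cyclic_mem_SO3
  have hF₂ := mul_mem_SO3 hF₁ cyclic_mem_SO3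
  have hB₁ : B = F * cyclic * diagonal ![b 1, b 2, b 0] * (F * cyclic)ᵀ := by
    rw [conj_cyclic, hFB]
  have hB₂ : B = F * cyclic * cyclic * diagonal ![b 2, b 0, b 1] * (F * cyclic * cyclic)ᵀ :=
    hB₁.trans (conj_cyclic (F * cyclic) ![b 1, b 2, b 0]).symm
  have hne : ∀ i, b i ≠ vert z.1 ⬝ᵥ (B *ᵥ vert z.1) := fun i => by
    fin_cases i
    exacts [hB.ne_levelValue hT hz hF₁ hB₁, hB.ne_levelValue hT hz hF₂ hB₂,
      hB.ne_levelValue hT hz hF hFB]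
  have hunit := (dot_mulVec_mulVec (transpose_mem_SO3 hF) (vert z.1) (vert z.1)).trans
    (vert_dot_vert hz.1)
  have hform := dot_conj_mulVec F (diagonal b) (vert z.1)
  rw [← hFB] at hform
  rcases ChaplyginSphere.exists_isolatesThird hunit hform.symm hne with h | h | h
  exacts [⟨F, hF, b, hFB, h⟩, ⟨_, hF₁, _, hB₁, h⟩, ⟨_, hF₂, _, hB₂, h⟩]

theorem exists_isTrajectoryFamily {I : Mat} {ρ : ℝ} (hI : I.PosDef) (hρ : 0 ≤ ρ) {j T : ℝ}
    (hT : IsRegularValue I ρ (j • e₃) T) {z : Mat × Vec} (hz : z ∈ levelSet I ρ (j • e₃) T) :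
    ∃ B, IsInertiaInverse I ρ B ∧ ∃ E G θ K U, IsTrajectoryFamily I ρ E G θ K U ∧
      (j, T) ∈ E ∧ vert z.1 ∈ U := by
  obtain ⟨F₀, hF₀, b₀, hB⟩ := exists_isInertiaInverse hI hρ
  obtain ⟨F, hF, b, hFB, haxis⟩ := hB.exists_isolatesThird hT hz hF₀ rfl
  have hj := hB.moment_ne_zero hT hz
  have hD := hB.pos_of_mem_levelSet (ε := (j, T)) hj hz
  have hlevel := ((hB.mem_levelSet_iff (ε := (j, T)) hj hD hz.1).1 hz).1
  rw [hFB] at hB hlevel haxis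
  have hunit := (dot_mulVec_mulVec (transpose_mem_SO3 hF) (vert z.1) (vert z.1)).trans
    (vert_dot_vert hz.1)
  have hv2 := haxis.apply_two_ne_zero hunit (dot_conj_mulVec F (diagonal b) (vert z.1)).symm
  rw [hlevel] at haxis
  obtain ⟨σ, hσ, hpos⟩ : ∃ σ : ℝ, σ ^ 2 = 1 ∧ 0 < σ * (Fᵀ *ᵥ vert z.1) 2 := by
    rcases hv2.lt_or_gt with hneg | hpos
    · exact ⟨-1, by norm_num, by linarith⟩
    · exact ⟨1, by norm_num, by linarith⟩
  exact ⟨_, hB, _, _, _, _, _, (isLevelCurve hF hσ).isTrajectoryFamily hB, ⟨hj, hD, haxis⟩, hpos⟩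

/-! ### Periods and resonance -/

section Periods

variable {X : Type*}

theorem IsMinimalPeriod.unique {f : ℝ → X} {P Q : ℝ} (hP : IsMinimalPeriod f P)
    (hQ : IsMinimalPeriod f Q) : P = Q := by
  rcases lt_trichotomy P Q with hlt | heq | hlt
  · exact absurd hP.2.1 (hQ.2.2 P hP.1 hlt)
  · exact heq
  · exact absurd hQ.2.1 (hP.2.2 Q hQ.1 hlt)

theorem periodic_comp_add_mul_inv {f : ℝ → X} (hf : Function.Periodic f 1) (a K : ℝ) :
    Function.Periodic (fun t => f (a + t * K⁻¹)) |K| := by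
  have hK : Function.Periodic (fun t => f (a + t * K⁻¹)) K := by
    simpa only [one_mul] using (hf.const_add a).mul_const_inv K
  rcases abs_choice K with habs | habs <;> rw [habs]
  exacts [hK, hK.neg]

theorem isMinimalPeriod_comp_add_mul_inv {f : ℝ → X}
    (hf : ∀ x y, f x = f y ↔ ∃ n : ℤ, x = y + n) (a : ℝ) {K : ℝ} (hK : K ≠ 0) :
    IsMinimalPeriod (fun t => f (a + t * K⁻¹)) |K| := by
  have hone : Function.Periodic f 1 := fun s => (hf _ _).2 ⟨1, by rw [Int.cast_one]⟩
  refine ⟨abs_pos.2 hK, periodic_comp_add_mul_inv hone a K, fun Q hQ hQK hper => ?_⟩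
  obtain ⟨n, hn⟩ := (hf _ _).1 (hper 0)
  have hQn : Q = n * K := by
    field_simp at hn
    linarith
  have hlt : |(n : ℝ)| * |K| < 1 * |K| := by
    rwa [← abs_mul, ← hQn, one_mul, abs_of_pos hQ]
  have hn1 : |n| < 1 := by exact_mod_cast lt_of_mul_lt_mul_right hlt (abs_nonneg K)
  rw [Int.abs_lt_one_iff.1 hn1, Int.cast_zero, zero_mul] at hQn
  exact hQ.ne' hQn

theorem isBounded_range_of_int_periodic [PseudoMetricSpace X] {n : ℕ} {f : (Fin n → ℝ) → X}
    (hf : Continuous f)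
    (hper : ∀ x y : Fin n → ℝ, (∃ k : Fin n → ℤ, ∀ i, x i = y i + k i) → f x = f y) :
    Bornology.IsBounded (Set.range f) := by
  refine ((isCompact_Icc (a := (0 : Fin n → ℝ)) (b := 1)).image hf).isBounded.subset ?_
  rintro _ ⟨x, rfl⟩
  exact ⟨fun i => Int.fract (x i),
    ⟨fun i => Int.fract_nonneg _, fun i => (Int.fract_lt_one _).le⟩,
    (hper _ _ ⟨fun i => ⌊x i⌋, fun i => (Int.fract_add_floor (x i)).symm⟩).symm⟩

end Periods

section Resonance

variable {I : Mat} {m r ρ : ℝ} {B : Mat} {E : Set (ℝ × ℝ)} {G : ℝ × (ℝ × ℝ) → Mat × Vec}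
  {θ K : ℝ × ℝ → ℝ} {U : Set Vec} {ε : ℝ × ℝ}

theorem IsTrajectoryFamily.reduce_eq_iff (h : IsTrajectoryFamily I ρ E G θ K U) (hε : ε ∈ E)
    (x y : ℝ) : reduce (G (x, ε)) = reduce (G (y, ε)) ↔ ∃ n : ℤ, x = y + n := by
  refine ⟨fun heq => h.injective ε hε x y (congrArg Prod.fst heq), ?_⟩
  have hone : Function.Periodic (fun x => reduce (G (x, ε))) 1 := fun x => by
    beta_reduce
    rw [h.add_one x ε hε, reduce, vert_rotState]
    rfl
  rintro ⟨n, rfl⟩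
  simpa only [mul_one] using hone.int_mul n y

theorem IsTrajectoryFamily.isMinimalPeriod (h : IsTrajectoryFamily I ρ E G θ K U) (x : Fin 2 → ℝ)
    (hε : ε ∈ E) :
    IsMinimalPeriod (fun t : ℝ => reduce (rotTorus G θ (x + t • torusFrequency θ K ε, ε)))
      |K ε| := by
  simp only [rotTorus_line, reduce, vert_rotState]
  exact isMinimalPeriod_comp_add_mul_inv (f := fun s => reduce (G (s, ε))) (h.reduce_eq_iff hε)
    (x 1) (h.period_ne_zero ε hε)

theorem IsTrajectoryFamily.periodic (h : IsTrajectoryFamily I ρ E G θ K U) (x : Fin 2 → ℝ)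
    (hε : ε ∈ E) (hθ : Real.cos (2 * Real.pi * θ ε) = 1) :
    Function.Periodic (fun t : ℝ => rotTorus G θ (x + t • torusFrequency θ K ε, ε)) |K ε| := by
  have hone : Function.Periodic (fun s => G (s, ε)) 1 := fun s => by
    beta_reduce
    rw [h.add_one s ε hε, rotState, rotVertical_eq_one_iff.2 (cos_two_pi_mul_eq_one_iff.1 hθ),
      Matrix.one_mul]
  simp only [rotTorus_line]
  exact (periodic_comp_add_mul_inv hone (x 1) (K ε)).comp (rotState (torusAngle θ (x, ε)))

theorem IsTrajectoryFamily.nonresonant (h : IsTrajectoryFamily I ρ E G θ K U) :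
    IsTrajectoryFamily I ρ (E ∩ {ε | Real.cos (2 * Real.pi * θ ε) ≠ 1}) G θ K U := by
  refine h.mono ?_ Set.inter_subset_left
  exact (Real.continuous_cos.comp_continuousOn
    (continuousOn_const.mul h.analytic_angle.continuousOn)).isOpen_inter_preimage
      h.isOpen_param isOpen_compl_singleton

theorem IsTrajectoryFamily.eq_rotTorus (hB : IsInertiaInverse I ρ B)
    (h : IsTrajectoryFamily I ρ E G θ K U) (hε : ε ∈ E) {γ : ℝ → Mat × Vec}
    (hγ : IsRotSolution I ρ γ) {x : Fin 2 → ℝ} (hx : rotTorus G θ (x, ε) = γ 0) :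
    γ = fun t => rotTorus G θ (x + t • torusFrequency θ K ε, ε) := by
  have hz := h.rotTorus_mem_levelSet x hε
  rw [hx] at hz
  exact hB.isRotSolution_unique hγ (h.isRotSolution x hε) hz.2.1 (by rw [zero_smul, add_zero, hx])

theorem IsContactFamily.isBounded {σ : ℝ × (ℝ × ℝ) → Plane} (hσ : IsContactFamily r E G θ K σ)
    (h : IsTrajectoryFamily I ρ E G θ K U) (hε : ε ∈ E) (c : Plane) :
    Bornology.IsBounded
      (Set.range fun x : Fin 2 → ℝ => (translates (fullTorus G θ σ) (x, ε, c)).2.2) := by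
  refine isBounded_range_of_int_periodic ?_ fun x y hxy => ?_
  · refine continuous_snd.comp (continuous_snd.comp (continuous_iff_continuousAt.2 fun x => ?_))
    exact (analyticAt_translates
      (hσ.analytic_fullTorus h (x, ε) ⟨trivial, hε⟩) c).continuousAt.comp_of_eq
        (f := fun x => (x, ε, c)) (by fun_prop) rfl
  · rw [snd_translates_fullTorus, snd_translates_fullTorus, hσ.rotPlane_mulVec_eq hε hxy]

end Resonance

section RegularLevel

variable {I : Mat} {m r ρ j T : ℝ}

theorem exists_isMinimalPeriod_of_isReducedSolution (hI : I.PosDef) (hρ : 0 ≤ ρ)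
    (hT : IsRegularValue I ρ (j • e₃) T) {γ : ℝ → Vec × Vec} (hγ : IsReducedSolution I ρ γ)
    (h0 : γ 0 ∈ reduce '' levelSet I ρ (j • e₃) T) : ∃ P, IsMinimalPeriod γ P := by
  obtain ⟨z, hz, hz0⟩ := h0
  obtain ⟨B, hB, E, G, θ, K, U, h, hE, hU⟩ := exists_isTrajectoryFamily hI hρ hT hz
  obtain ⟨x, hx⟩ := h.exists_rotTorus_eq hB hE hz hU
  have hmoment : inertiaAt I ρ (γ 0).1 *ᵥ (γ 0).2 = j • (γ 0).1 := by
    rw [← hz0]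
    exact (moment_eq_iff hz.1).1 hz.2.1
  have hγx := hB.isReducedSolution_unique hγ (h.isRotSolution x hE).reduce hmoment
    (by rw [← hz0, zero_smul, add_zero, hx])
  exact ⟨|K (j, T)|, hγx ▸ h.isMinimalPeriod x hE⟩

theorem exists_isQuasiperiodicFamily_rot (hI : I.PosDef) (hρ : 0 ≤ ρ)
    (hT : IsRegularValue I ρ (j • e₃) T) {z : Mat × Vec} (hz : z ∈ levelSet I ρ (j • e₃) T) :
    ∃ (E : Set (ℝ × ℝ)) (Φ : (Fin 2 → ℝ) × (ℝ × ℝ) → Mat × Vec) (ν : ℝ × ℝ → Fin 2 → ℝ)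
      (x : Fin 2 → ℝ),
      IsQuasiperiodicFamily (verticalRot I ρ) (IsRotSolution I ρ) E Φ ν ∧
      (∀ x, ∀ ε ∈ E, Φ (x, ε) ∈ levelSet I ρ (ε.1 • e₃) ε.2) ∧
      (j, T) ∈ E ∧ Φ (x, (j, T)) = z ∧
      ∀ γ : ℝ → Mat × Vec, IsRotSolution I ρ γ → γ 0 = z →
        ∀ t, γ t = Φ (x + t • ν (j, T), (j, T)) := by
  obtain ⟨B, hB, E, G, θ, K, U, h, hE, hU⟩ := exists_isTrajectoryFamily hI hρ hT hz
  obtain ⟨x, hx⟩ := h.exists_rotTorus_eq hB hE hz hU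
  exact ⟨E, rotTorus G θ, torusFrequency θ K, x, h.isQuasiperiodicFamily_rot hB,
    fun x ε hε => h.rotTorus_mem_levelSet x hε, hE, hx,
    fun γ hγ hγ0 => congrFun (h.eq_rotTorus hB hE hγ (hx.trans hγ0.symm))⟩

theorem exists_nonresonant_isTrajectoryFamily (hI : I.PosDef) (hρ : 0 ≤ ρ)
    (hT : IsRegularValue I ρ (j • e₃) T) {γ : ℝ → Mat × Vec} (hγ : IsRotSolution I ρ γ)
    (h0 : γ 0 ∈ levelSet I ρ (j • e₃) T) {P : ℝ}
    (hP : IsMinimalPeriod (fun t => reduce (γ t)) P) (hnper : ¬ Function.Periodic γ P) :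
    ∃ B, IsInertiaInverse I ρ B ∧ ∃ E G θ K U, IsTrajectoryFamily I ρ E G θ K U ∧
      (∀ ε ∈ E, Real.cos (2 * Real.pi * θ ε) ≠ 1) ∧ (j, T) ∈ E ∧ vert (γ 0).1 ∈ U := by
  obtain ⟨B, hB, E, G, θ, K, U, h, hE, hU⟩ := exists_isTrajectoryFamily hI hρ hT h0
  obtain ⟨x, hx⟩ := h.exists_rotTorus_eq hB hE h0 hU
  obtain rfl := h.eq_rotTorus hB hE hγ hx
  obtain rfl := hP.unique (h.isMinimalPeriod x hE)
  exact ⟨B, hB, _, G, θ, K, U, h.nonresonant, fun ε hε => hε.2,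
    ⟨hE, fun hθ => hnper (h.periodic x hE hθ)⟩, hU⟩

theorem exists_isQuasiperiodicFamily_full (hI : I.PosDef) (hρ : 0 ≤ m * r ^ 2)
    (hT : IsRegularValue I (m * r ^ 2) (j • e₃) T) {γ : ℝ → Mat × Vec × Plane}
    (hγ : IsFullSolution I m r γ)
    (h0 : ((γ 0).1, (γ 0).2.1) ∈ levelSet I (m * r ^ 2) (j • e₃) T) {P : ℝ}
    (hP : IsMinimalPeriod (fun t => reduce ((γ t).1, (γ t).2.1)) P)
    (hnper : ¬ Function.Periodic (fun t => ((γ t).1, (γ t).2.1)) P) :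
    (∃ (E : Set (ℝ × ℝ)) (Φ : (Fin 2 → ℝ) × (ℝ × ℝ) → Mat × Vec × Plane)
      (ν : ℝ × ℝ → Fin 2 → ℝ) (x : Fin 2 → ℝ) (c : Plane),
      IsQuasiperiodicFamily (verticalFull I (m * r ^ 2)) (IsFullSolution I m r) (E ×ˢ Set.univ)
        (translates Φ) (fun δ => ν δ.1) ∧
      (∀ x, ∀ ε ∈ E, ((Φ (x, ε)).1, (Φ (x, ε)).2.1) ∈ levelSet I (m * r ^ 2) (ε.1 • e₃) ε.2) ∧
      (j, T) ∈ E ∧ ∀ t, γ t = translates Φ (x + t • ν (j, T), ((j, T), c))) ∧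
    Bornology.IsBounded (Set.range (fun t => (γ t).2.2)) := by
  obtain ⟨B, hB, E, G, θ, K, U, h, hθ, hE, hU⟩ :=
    exists_nonresonant_isTrajectoryFamily hI hρ hT hγ.isRotSolution h0 hP hnper
  obtain ⟨σ, hσ⟩ := h.exists_isContactFamily r hθ
  obtain ⟨x, c, hxc⟩ := h.exists_translates_eq (σ := σ) hB hE h0 hU
  have hγx := congrFun (hB.isFullSolution_unique hγ (hσ.isFullSolution h x (ε := ((j, T), c)) hE)
    h0.2.1 (by rw [zero_smul, add_zero, hxc]))
  refine ⟨⟨E, fullTorus G θ σ, torusFrequency θ K, x, c, hσ.isQuasiperiodicFamily_full hB h,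
    fun x ε hε => h.rotTorus_mem_levelSet x hε, hE, hγx⟩, (hσ.isBounded h hE c).subset ?_⟩
  rintro _ ⟨t, rfl⟩
  exact ⟨x + t • torusFrequency θ K (j, T), by simp only [hγx t]⟩

end RegularLevel

end ChaplyginSphere

theorem mainTheorem10
    (I : ChaplyginSphere.Mat) (hI : I.PosDef) (m r : ℝ) (hm : 0 < m) (hr : 0 < r)
    (j₃ T : ℝ)
    (hT : ChaplyginSphere.IsRegularValue I (m * r ^ 2) (j₃ • ChaplyginSphere.e₃) T) :
    -- every solution of the reduced system on the level set is periodic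
    (∀ γ : ℝ → ChaplyginSphere.Vec × ChaplyginSphere.Vec,
      ChaplyginSphere.IsReducedSolution I (m * r ^ 2) γ →
      γ 0 ∈ ChaplyginSphere.reduce ''
        ChaplyginSphere.levelSet I (m * r ^ 2) (j₃ • ChaplyginSphere.e₃) T →
      ∃ P, ChaplyginSphere.IsMinimalPeriod γ P) ∧
    -- the rotational motion is quasiperiodic on 2-tori depending analytically on `j` and `T`
    (∀ z₀ ∈ ChaplyginSphere.levelSet I (m * r ^ 2) (j₃ • ChaplyginSphere.e₃) T,
      ∃ (E : Set (ℝ × ℝ))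
        (Φ : (Fin 2 → ℝ) × (ℝ × ℝ) → ChaplyginSphere.Mat × ChaplyginSphere.Vec)
        (ν : ℝ × ℝ → Fin 2 → ℝ) (x₀ : Fin 2 → ℝ),
        ChaplyginSphere.IsQuasiperiodicFamily (ChaplyginSphere.verticalRot I (m * r ^ 2))
          (ChaplyginSphere.IsRotSolution I (m * r ^ 2)) E Φ ν ∧
        (∀ x, ∀ ε ∈ E, Φ (x, ε) ∈
          ChaplyginSphere.levelSet I (m * r ^ 2) (ε.1 • ChaplyginSphere.e₃) ε.2) ∧
        (j₃, T) ∈ E ∧ Φ (x₀, (j₃, T)) = z₀ ∧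
        ∀ γ : ℝ → ChaplyginSphere.Mat × ChaplyginSphere.Vec,
          ChaplyginSphere.IsRotSolution I (m * r ^ 2) γ → γ 0 = z₀ →
          ∀ t, γ t = Φ (x₀ + t • ν (j₃, T), (j₃, T))) ∧
    -- the full motion, where `P` is the minimal period of the reduced motion
    (∀ γ : ℝ → ChaplyginSphere.Mat × ChaplyginSphere.Vec × ChaplyginSphere.Plane,
      ChaplyginSphere.IsFullSolution I m r γ →
      ((γ 0).1, (γ 0).2.1) ∈
        ChaplyginSphere.levelSet I (m * r ^ 2) (j₃ • ChaplyginSphere.e₃) T →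
      ∀ P, ChaplyginSphere.IsMinimalPeriod
          (fun t => ChaplyginSphere.reduce ((γ t).1, (γ t).2.1)) P →
        (¬ Function.Periodic (fun t => ((γ t).1, (γ t).2.1)) P →
          (∃ (E : Set (ℝ × ℝ))
            (Φ : (Fin 2 → ℝ) × (ℝ × ℝ) →
              ChaplyginSphere.Mat × ChaplyginSphere.Vec × ChaplyginSphere.Plane)
            (ν : ℝ × ℝ → Fin 2 → ℝ) (x₀ : Fin 2 → ℝ) (c₀ : ChaplyginSphere.Plane),
            ChaplyginSphere.IsQuasiperiodicFamily (ChaplyginSphere.verticalFull I (m * r ^ 2))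
              (ChaplyginSphere.IsFullSolution I m r) (E ×ˢ Set.univ)
              (ChaplyginSphere.translates Φ) (fun δ => ν δ.1) ∧
            (∀ x, ∀ ε ∈ E, ((Φ (x, ε)).1, (Φ (x, ε)).2.1) ∈
              ChaplyginSphere.levelSet I (m * r ^ 2) (ε.1 • ChaplyginSphere.e₃) ε.2) ∧
            (j₃, T) ∈ E ∧
            ∀ t, γ t = ChaplyginSphere.translates Φ
              (x₀ + t • ν (j₃, T), ((j₃, T), c₀))) ∧
          Bornology.IsBounded (Set.range (fun t => (γ t).2.2))) ∧
        (Function.Periodic (fun t => ((γ t).1, (γ t).2.1)) P →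
          ∃ (w : ChaplyginSphere.Plane) (q : ℝ → ChaplyginSphere.Plane),
            Function.Periodic q P ∧ ∀ t, (γ t).2.2 = t • w + q t)) := by
  have hρ : 0 ≤ m * r ^ 2 := by positivity
  refine ⟨fun γ hγ h0 => ?periodic, fun z₀ hz₀ => ?rotational, fun γ hγ h0 P hP => ⟨?full, ?drift⟩⟩
  case periodic =>
    exact ChaplyginSphere.exists_isMinimalPeriod_of_isReducedSolution hI hρ hT hγ h0
  case rotational => exact ChaplyginSphere.exists_isQuasiperiodicFamily_rot hI hρ hT hz₀
  case full => exact ChaplyginSphere.exists_isQuasiperiodicFamily_full hI hρ hT hγ h0 hP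
  case drift => exact hγ.exists_drift hP.1.ne'
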